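/- \textbf{Model.} In the $k$-machine model, $k\ge 2$ machines are pairwise joined by links that carry $W\ge 1$ bits per round in each direction; computation is synchronous, local computation is free, and each machine has private random bits. The input is an $n$-vertex undirected graph $G$ ($n\ge k$) whose vertices carry distinct labels from a set of size at most $n^c$; for MST the edges carry real weights from a set $\Lambda$ of size at most $n^c$. Each vertex is assigned independently and uniformly at random to one of the machines, its home machine, which initially knows the label of the vertex and, for each incident edge, the label and the home machine of the other endpoint and the datum (weight or mark) on the edge. Each machine irrevocably sets an output variable. Let $m$ be the number of edges of $G$, $\Delta$ the maximum degree, and $D$ the diameter (for disconnected $G$: the largest distance between two vertices of the same component). $\tilde O(x)$ means at most $C\,x\log^{e} n+C\log^{e} n$ with constants $C,e$ depending only on $c$ (not on $n,k,W,\Lambda$ or the input). An algorithm solves a problem in $T$ rounds with high probability if on every input it terminates within $T$ rounds for every partition and all random bits, and its output is correct with probability at least $1-1/n$ over the random partition and the random bits. \textbf{Theorem.} For every fixed $c$ and all $n\ge k\ge 2$, $W\ge 1$: (1) In the clique model (the $n$ vertices are the processors, each initially knows its own label and the labels of its neighbours and the weights of its incident edges in $G$, and in every round each vertex sends the same message of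 $W$ bits to all other vertices or remains silent) there is a deterministic broadcast algorithm that computes an MST of every connected weighted graph in $\tilde O(1)$ (i.e. polylogarithmically many) rounds with broadcast complexity (total number of broadcasts) $\tilde O(n)$; each vertex outputs its incident MST edges. (2) In the $k$-machine model, an MST of a connected weighted graph can be computed in $\tilde O(n/k)$ rounds with high probability: for one and the same MST, each machine outputs the MST edges incident to its vertices. (3) Connectivity of $G$ can be decided (every machine outputs the answer) in $$\tilde O\Bigl(\min\Bigl(\frac nk,\ \frac m{k^2}+D\Bigl\lceil\frac{\Delta}{k}\Bigr\rceil\Bigr)\Bigr)$$ rounds with high probability, by an algorithm that is not given $m$, $D$, $\Delta$. (4) Spanning tree verification (given $G$ and a marked subset $S$ of its edges, each machine initially knowing the marks of the edges incident to its vertices, every machine outputs whether $S$ is a spanning tree of $G$) can be solved within the same bound, with $m,D,\Delta$ the parameters of $G$, with high probability, by an algorithm that is not given $m$, $D$, $\Delta$. -/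

import Mathlib

namespace KMachine

/-! ### Input graphs -/

/-- An `n`-vertex input graph.  The vertices carry distinct labels `ident v` from a label set of
size `N`, and every edge `e` carries a datum `label e` of type `E` (a weight, a mark, or nothing);
the values of `label` outside the edge set are never shown to anyone. -/
structure Input (n N : ℕ) (E : Type) where
  graph : SimpleGraph (Fin n)
  ident : Fin n ↪ Fin N
  label : Sym2 (Fin n) → E

/-- The number `m` of edges. -/
noncomputable def numEdges {n : ℕ} (G : SimpleGraph (Fin n)) : ℕ := G.edgeSet.ncard

open Classical in
/-- The maximum degree `Δ`. -/
noncomputable def maxDeg {n : ℕ} (G : SimpleGraph (Fin n)) : ℕ := G.maxDegree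

/-- The diameter `D`: the largest distance between two vertices that are joined by a path
(`SimpleGraph.dist` is `0` for vertices in different components).  For a connected graph this
is the usual diameter, see `diameter_eq_diam`; it is finite also for disconnected graphs. -/
noncomputable def diameter {n : ℕ} (G : SimpleGraph (Fin n)) : ℕ :=
  Finset.univ.sup fun p : Fin n × Fin n => G.dist p.1 p.2

theorem diameter_eq_diam {n : ℕ} (G : SimpleGraph (Fin n)) (hG : G.Connected) :
    diameter G = G.diam := by
  have := hG.nonempty
  apply le_antisymm
  · exact Finset.sup_le fun p _ =>
      SimpleGraph.dist_le_diam (SimpleGraph.connected_iff_ediam_ne_top.1 hG)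
  · obtain ⟨u, v, h⟩ := G.exists_dist_eq_diam
    rw [← h]
    exact Finset.le_sup (f := fun p : Fin n × Fin n => G.dist p.1 p.2) (Finset.mem_univ (u, v))

/-! ### The `k`-machine model -/

/-- What a machine knows initially: the labels of the vertices it hosts, and, for each edge at a
hosted vertex, the labels of the hosted end and of the other end, the home machine of the
other end, and the datum on the edge. -/
structure MachineView (k N : ℕ) (E : Type) where
  own : Set (Fin N)
  incident : Set (Fin N × Fin N × Fin k × E)

/-- The initial knowledge of machine `i` if the vertices are distributed by `home`. -/
def Input.machineView {n N k : ℕ} {E : Type} (I : Input n N E) (home : Fin n → Fin k)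
    (i : Fin k) : MachineView k N E where
  own := {x | ∃ u, home u = i ∧ I.ident u = x}
  incident := {x | ∃ u v, home u = i ∧ I.graph.Adj u v ∧
    x = (I.ident u, I.ident v, home v, I.label s(u, v))}

/-- A (randomized) synchronous algorithm for `k` machines that are pairwise joined by links
carrying `W` bits per round in each direction.  Each machine has private random bits.  Local
computation is free.  The output variable of a machine is `none` until the machine sets it, and
it is irrevocable.  (What a machine sends to itself is part of its free local computation.) -/
structure MachineAlg (k W N : ℕ) (E Out : Type) where
  coins : ℕ
  State : Type
  init : Fin k → MachineView k N E → (Fin coins → Bool) → State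
  send : Fin k → State → Fin k → (Fin W → Bool)
  recv : Fin k → State → (Fin k → (Fin W → Bool)) → State
  output : Fin k → State → Option Out
  irrevocable : ∀ i s msgs o, output i s = some o → output i (recv i s msgs) = some o

namespace MachineAlg

variable {n k W N : ℕ} {E Out : Type}

/-- The states of all machines after `t` rounds. -/
def run (A : MachineAlg k W N E Out) (I : Input n N E) (home : Fin n → Fin k)
    (ω : Fin k → Fin A.coins → Bool) : ℕ → Fin k → A.State
  | 0 => fun i => A.init i (I.machineView home i) (ω i)
  | t + 1 => fun i =>
      A.recv i (A.run I home ω t i) fun j => A.send j (A.run I home ω t j) i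

/-- After `t` rounds all machines have set their outputs, to the configuration `o`. -/
def Outputs (A : MachineAlg k W N E Out) (I : Input n N E) (home : Fin n → Fin k)
    (ω : Fin k → Fin A.coins → Bool) (t : ℕ) (o : Fin k → Out) : Prop :=
  ∀ i, A.output i (A.run I home ω t i) = some (o i)

end MachineAlg

/-- The probability of an event under the uniform distribution on a finite set. -/
noncomputable def prob {Ω : Type} [Fintype Ω] (p : Ω → Prop) : ℝ :=
  (Nat.card {ω // p ω} : ℝ) / Fintype.card Ω

/-- `A` is an `ε`-error algorithm for the problem with input domain `dom` and with feasible output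
configurations `feasible`, and its running time on an input `I` is at most `bound I`: it
always terminates within `bound I` rounds, whatever the partition and the random bits are, and
with probability at least `1 - ε` over the uniformly random vertex partition and the random bits
its output configuration is feasible. -/
def SolvesWithin {n k W N : ℕ} {E Out : Type} (A : MachineAlg k W N E Out)
    (dom : Set (Input n N E))
    (feasible : Input n N E → (Fin n → Fin k) → (Fin k → Out) → Prop)
    (ε : ℝ) (bound : Input n N E → ℝ) : Prop :=
  ∀ I ∈ dom,
    (∀ home ω, ∃ (t : ℕ) (o : Fin k → Out), (t : ℝ) ≤ bound I ∧ A.Outputs I home ω t o) ∧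
    1 - ε ≤ prob fun r : (Fin n → Fin k) × (Fin k → Fin A.coins → Bool) =>
      ∃ (t : ℕ) (o : Fin k → Out), A.Outputs I r.1 r.2 t o ∧ feasible I r.1 o

/-! ### The problems -/

/-- The total weight of a graph. -/
noncomputable def totalWeight {n : ℕ} (w : Sym2 (Fin n) → ℝ) (T : SimpleGraph (Fin n)) : ℝ :=
  ∑ e ∈ T.edgeSet.toFinite.toFinset, w e

/-- `T` is a spanning tree of `G`. -/
def IsSpanningTree {n : ℕ} (G T : SimpleGraph (Fin n)) : Prop := T ≤ G ∧ T.IsTree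

/-- `T` is a minimum spanning tree of `G` with edge weights `w`. -/
def IsMST {n : ℕ} (G : SimpleGraph (Fin n)) (w : Sym2 (Fin n) → ℝ) (T : SimpleGraph (Fin n)) :
    Prop :=
  IsSpanningTree G T ∧ ∀ T', IsSpanningTree G T' → totalWeight w T ≤ totalWeight w T'

/-- Connected graphs with edge weights from `Λ`. -/
def weightedInputs (n N : ℕ) (Λ : Finset ℝ) : Set (Input n N ℝ) :=
  {I | I.graph.Connected ∧ ∀ e ∈ I.graph.edgeSet, I.label e ∈ Λ}

/-- The edges of `T` that are incident to a vertex in `U`, written through the vertex labels. -/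
def edgesAt {n N : ℕ} (ident : Fin n ↪ Fin N) (T : SimpleGraph (Fin n)) (U : Set (Fin n)) :
    Set (Sym2 (Fin N)) :=
  {e | ∃ u v, u ∈ U ∧ T.Adj u v ∧ e = s(ident u, ident v)}

/-- MST: for one and the same minimum spanning tree `T`, each machine outputs the set of
the edges of `T` that are incident to its vertices. -/
def mstFeasible {n N k : ℕ} (I : Input n N ℝ) (home : Fin n → Fin k)
    (o : Fin k → Set (Sym2 (Fin N))) : Prop :=
  ∃ T, IsMST I.graph I.label T ∧ ∀ i, o i = edgesAt I.ident T {u | home u = i}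

/-- Connectivity: each machine outputs whether the input graph is connected. -/
def connFeasible {n N k : ℕ} (I : Input n N Unit) (_home : Fin n → Fin k) (o : Fin k → Bool) :
    Prop :=
  ∀ i, o i = true ↔ I.graph.Connected

/-- The subgraph formed by the marked edges. -/
def markedSubgraph {n N : ℕ} (I : Input n N Bool) : SimpleGraph (Fin n) :=
  SimpleGraph.fromEdgeSet {e | e ∈ I.graph.edgeSet ∧ I.label e = true}

/-- Spanning tree verification: each machine outputs whether the marked edges form a spanning
tree of the input graph. -/
def stFeasible {n N k : ℕ} (I : Input n N Bool) (_home : Fin n → Fin k) (o : Fin k → Bool) :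
    Prop :=
  ∀ i, o i = true ↔ IsSpanningTree I.graph (markedSubgraph I)

/-! ### Broadcast algorithms in the clique model -/

/-- What a vertex knows initially in the clique model, besides its own label: the labels of its
neighbours in the input graph and the data on its edges. -/
def Input.vertexView {n N : ℕ} {E : Type} (I : Input n N E) (u : Fin n) : Set (Fin N × E) :=
  {x | ∃ v, I.graph.Adj u v ∧ x = (I.ident v, I.label s(u, v))}

/-- A deterministic broadcast algorithm in the clique model with bandwidth `W`: in each round each
vertex sends one and the same `W`-bit message to all other vertices, or remains silent (`none`).
A vertex receives the set of pairs (label of the sender, message). -/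
structure BroadcastAlg (W N : ℕ) (E Out : Type) where
  State : Type
  init : Fin N → Set (Fin N × E) → State
  bcast : State → Option (Fin W → Bool)
  recv : State → Set (Fin N × (Fin W → Bool)) → State
  output : State → Option Out
  irrevocable : ∀ s msgs o, output s = some o → output (recv s msgs) = some o

namespace BroadcastAlg

variable {n W N : ℕ} {E Out : Type}

/-- The states of all vertices after `t` rounds. -/
def run (A : BroadcastAlg W N E Out) (I : Input n N E) : ℕ → Fin n → A.State
  | 0 => fun u => A.init (I.ident u) (I.vertexView u)
  | t + 1 => fun u =>
      A.recv (A.run I t u) {x | ∃ v, v ≠ u ∧ x.1 = I.ident v ∧ A.bcast (A.run I t v) = some x.2}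

/-- After `t` rounds all vertices have set their outputs, to the configuration `o`. -/
def Outputs (A : BroadcastAlg W N E Out) (I : Input n N E) (t : ℕ) (o : Fin n → Out) : Prop :=
  ∀ u, A.output (A.run I t u) = some (o u)

/-- The number of broadcasts that are made in the first `t` rounds. -/
noncomputable def broadcasts (A : BroadcastAlg W N E Out) (I : Input n N E) (t : ℕ) : ℕ :=
  Nat.card {x : Fin t × Fin n // A.bcast (A.run I x.1 x.2) ≠ none}

end BroadcastAlg

/-- The broadcast algorithm `A` computes, on every input in `dom`, a minimum spanning tree (each
vertex outputs the tree edges incident to it), within `time` rounds and with at most `bc`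
broadcasts. -/
def BroadcastComputesMST {n W N : ℕ} (A : BroadcastAlg W N ℝ (Set (Sym2 (Fin N))))
    (dom : Set (Input n N ℝ)) (time bc : ℝ) : Prop :=
  ∀ I ∈ dom, ∃ (t : ℕ) (T : SimpleGraph (Fin n)),
    (t : ℝ) ≤ time ∧ (A.broadcasts I t : ℝ) ≤ bc ∧ IsMST I.graph I.label T ∧
    A.Outputs I t fun u => edgesAt I.ident T {u}

/-! ### Bounds -/

/-- The upper bound hidden in `Õ(x)`: a polylogarithmic factor and an additive polylogarithmic
term. -/
noncomputable def softO (C : ℝ) (e n : ℕ) (x : ℝ) : ℝ :=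
  C * Real.log n ^ e * x + C * Real.log n ^ e

/-- `min (n/k, m/k² + D⌈Δ/k⌉)`. -/
noncomputable def connBound {n : ℕ} (k : ℕ) (G : SimpleGraph (Fin n)) : ℝ :=
  min ((n : ℝ) / k)
    ((numEdges G : ℝ) / (k : ℝ) ^ 2 + (diameter G : ℝ) * (⌈(maxDeg G : ℝ) / k⌉₊ : ℝ))

end KMachine

namespace KMachine

/-! ### Sending messages bit by bit -/

/-! All algorithms are organised in phases with messages of logarithmic size, and a generic
simulation (`exists_broadcastAlg`, `Phased.toAlg_outputs`) sends these messages bit by bit, so that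
even `W = 1` costs only a logarithmic factor. Since labels are all that is known to the processors,
the algorithms work with graphs on the label set, where unused labels are isolated.

For MST the algorithm is Borůvka's. Every vertex announces its smallest edge that leaves its current
component, everybody hears all announcements, and hence everybody maintains the same forest. Ties
are broken by a fixed enumeration of label pairs, so the keys are injective and the limit is
Kruskal's forest (`boruvka_eq_kruskal`), a minimum spanning tree by exchange (`isMST_kruskal`). A
component that can still grow at least doubles in each phase (`two_pow_le_component`), so
logarithmically many phases suffice. With `k` machines each link carries the announcements of the
vertices hosted by one machine, about `n/k` of them by a Chernoff bound.

Connectivity and spanning tree verification share one algorithm, applied to the graph `H` of the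
kept edges. Each component under construction has a name and each name flips a coin; a name showing
tails adopts the least adjacent name showing heads. The expected number of names with an edge to
another name drops by a factor 3/4 per phase (`sum_activeNames_le`), so after logarithmically many
phases names are, with high probability, the components. Each name has a random proxy machine that
merges the candidates found by the machines. A machine has about `m/k + Δ` arcs up to logarithms,
hence at most `min(n, O(m/k + Δ))` names to ask for, and the proxies spread these over `k` links.
The load is thus `min(n/k, m/k² + Δ/k)` up to logarithms. The diameter enters only through `D ≥ 1`
as soon as there is an edge (`linkCap_le`).

Coins and proxies must be common to all machines. As in Newman's theorem, a short list of random
strings is good for all balanced inputs (`exists_derandomization`, `exists_seed_function`), so a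
logarithmic seed published by one machine replaces them. The first phase also publishes arc counts
and degrees, from which all machines compute the same link capacity. Overfull messages are dropped,
so overload can spoil the answer but never the running time. -/

theorem exists_bits (M : Type) [Fintype M] {B : ℕ} (h : Fintype.card M ≤ 2 ^ B) :
    ∃ e : M → ℕ → Bool, ∀ s t, (∀ i < B, e s i = e t i) → s = t := by
  obtain ⟨f⟩ := Function.Embedding.nonempty_of_card_le (α := M) (β := Fin B → Bool)
    (by simpa using h)
  refine ⟨fun m i => if h : i < B then f m ⟨i, h⟩ else false, fun s t hst => f.injective ?_⟩
  ext i
  simpa using hst i i.2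

/-- Keep a set of words only if it does not exceed the capacity. -/
def truncate {Word : Type} (c : ℕ) (s : Finset Word) : Finset Word := if s.card ≤ c then s else ∅

theorem card_truncate {Word : Type} (c : ℕ) (s : Finset Word) : (truncate c s).card ≤ c := by
  unfold truncate
  split_ifs with h
  · exact h
  · simp

theorem truncate_eq {Word : Type} {c : ℕ} {s : Finset Word} (h : s.card ≤ c) :
    truncate c s = s := if_pos h

/-- A set is listed in `c` slots of `b` bits each. The strict inequality leaves one spare code word
for an empty slot. -/
theorem exists_bits_finset (Word : Type) [Fintype Word] {b : ℕ} (h : Fintype.card Word < 2 ^ b)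
    (c : ℕ) : ∃ e : Finset Word → ℕ → Bool, ∀ s t : Finset Word, s.card ≤ c → t.card ≤ c →
      (∀ i < c * b, e s i = e t i) → s = t := by
  classical
  obtain ⟨e, he⟩ := exists_bits (Fin c → Option Word) (B := c * b) (by
    rw [Fintype.card_fun, Fintype.card_option, Fintype.card_fin, mul_comm, pow_mul]
    exact Nat.pow_le_pow_left h c)
  refine ⟨fun s => e fun i => s.toList[(i : ℕ)]?, fun s t hs ht hst => ?_⟩
  have h1 := he _ _ hst
  have : s.toList = t.toList := by
    refine List.ext_getElem? fun i => ?_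
    by_cases hi : i < c
    · exact congrFun h1 ⟨i, hi⟩
    · rw [List.getElem?_eq_none (by simp; omega), List.getElem?_eq_none (by simp; omega)]
  rw [← Finset.toList_toFinset s, this, Finset.toList_toFinset]

open Classical in
/-- An encoding of the sets of at most `c` words by `c * b` bits. -/
noncomputable def encode (Word : Type) (b c : ℕ) : Finset Word → ℕ → Bool :=
  if h : ∃ e : Finset Word → ℕ → Bool, ∀ s t : Finset Word, s.card ≤ c → t.card ≤ c →
      (∀ i < c * b, e s i = e t i) → s = t then h.choose else fun _ _ => false

open Classical in
/-- The decoding that belongs to `encode`. -/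
noncomputable def decode (Word : Type) (b c : ℕ) (f : ℕ → Bool) : Finset Word :=
  if h : ∃ s : Finset Word, s.card ≤ c ∧ ∀ i < c * b, encode Word b c s i = f i
    then h.choose else ∅

theorem decode_eq {Word : Type} [Fintype Word] {b : ℕ} (hb : Fintype.card Word < 2 ^ b) {c : ℕ}
    {f : ℕ → Bool} {s : Finset Word} (hs : s.card ≤ c)
    (hf : ∀ i < c * b, encode Word b c s i = f i) : decode Word b c f = s := by
  have h1 := exists_bits_finset Word hb c
  have h2 : ∃ s : Finset Word, s.card ≤ c ∧ ∀ i < c * b, encode Word b c s i = f i := ⟨s, hs, hf⟩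
  rw [decode, dif_pos h2]
  have h3 := h2.choose_spec
  have h4 := h1.choose_spec h2.choose s h3.1 hs
  refine h4 fun i hi => ?_
  have h5 := (h3.2 i hi).trans (hf i hi).symm
  have h6 : encode Word b c = h1.choose := dif_pos h1
  exact (congrFun (congrFun h6 _) i).symm.trans (h5.trans (congrFun (congrFun h6 _) i))

/-! ### Phased broadcast algorithms -/

/-- Any algorithm in which all vertices broadcast a value of a small type in each of `P` phases
can be carried out with messages of one bit. -/
theorem exists_broadcastAlg {W N P B : ℕ} {E Out S M : Type} [Fintype M] (hW : 1 ≤ W) (hB : 0 < B)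
    (hM : Fintype.card M ≤ 2 ^ B) (init : Fin N → Set (Fin N × E) → S) (msg : S → M)
    (step : S → Set (Fin N × M) → S) (out : S → Out) :
    ∃ A : BroadcastAlg W N E Out, ∀ (n : ℕ) (I : Input n N E) (s : ℕ → Fin n → S),
      (∀ u, s 0 u = init (I.ident u) (I.vertexView u)) →
      (∀ p < P, ∀ u, s (p + 1) u = step (s p u) {z | ∃ v, v ≠ u ∧ z = (I.ident v, msg (s p v))}) →
      A.Outputs I (P * B) fun u => out (s P u) := by
  classical
  obtain ⟨e, he⟩ := exists_bits M hM
  refine ⟨{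
    State := S × ℕ × ℕ × (ℕ → Set (Fin N × (Fin W → Bool)))
    init := fun x X => (init x X, 0, 0, fun _ => ∅)
    bcast := fun σ => some fun _ => e (msg σ.1) σ.2.2.1
    recv := fun σ X =>
      if P ≤ σ.2.1 then σ
      else if σ.2.2.1 + 1 = B then
        -- A value counts as received from a label if every bit of its code has arrived from that
        -- label.
        (step σ.1 {z | ∀ b < B, (z.1, fun _ => e z.2 b) ∈
          Function.update σ.2.2.2 σ.2.2.1 X b}, σ.2.1 + 1, 0, fun _ => ∅)
      else (σ.1, σ.2.1, σ.2.2.1 + 1, Function.update σ.2.2.2 σ.2.2.1 X)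
    output := fun σ => if P ≤ σ.2.1 then some (out σ.1) else none
    irrevocable := ?_ }, ?_⟩
  · intro σ X o h
    split_ifs at h with hP
    rw [if_pos hP, if_pos hP, h]
  intro n I s h0 hs
  set A : BroadcastAlg W N E Out := _
  change A.Outputs I (P * B) fun u => out (s P u)
  have key : ∀ p ≤ P, ∀ u, A.run I (p * B) u = (s p u, p, 0, fun _ => ∅) := by
    intro p
    induction p with
    | zero =>
      intro _ u
      rw [zero_mul, h0]
      rfl
    | succ p ih =>
      intro hp
      have hlt : p < P := hp
      have hin : ∀ q < B, ∀ u, ∃ H, A.run I (p * B + q) u = (s p u, p, q, H) ∧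
          ∀ b < q, H b = {x | ∃ v, v ≠ u ∧ x.1 = I.ident v ∧ x.2 = fun _ => e (msg (s p v)) b} := by
        intro q
        induction q with
        | zero => exact fun _ u => ⟨_, ih hlt.le u, fun b hb => absurd hb (Nat.not_lt_zero b)⟩
        | succ q ihq =>
          intro hq u
          have ihq := ihq (by omega)
          obtain ⟨H, hrun, hH⟩ := ihq u
          refine ⟨Function.update H q {x | ∃ v, v ≠ u ∧ x.1 = I.ident v ∧
            A.bcast (A.run I (p * B + q) v) = some x.2}, ?_, ?_⟩
          · change A.recv (A.run I (p * B + q) u) _ = _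
            rw [hrun]
            exact (if_neg (show ¬ P ≤ p by omega)).trans (if_neg (show ¬ q + 1 = B by omega))
          · intro b hb
            by_cases hbq : b = q
            · subst hbq
              rw [Function.update_self]
              ext x
              refine exists_congr fun v => and_congr_right fun _ => and_congr_right fun _ => ?_
              obtain ⟨H', hrun', -⟩ := ihq v
              rw [hrun']
              exact ⟨fun h => (Option.some.inj h).symm, fun h => congrArg some h.symm⟩
            · rw [Function.update_of_ne hbq]
              exact hH b (by omega)
      intro u
      obtain ⟨q, rfl⟩ : ∃ q, B = q + 1 := ⟨B - 1, by omega⟩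
      have hin := hin q (by omega)
      obtain ⟨H, hrun, hH⟩ := hin u
      rw [show (p + 1) * (q + 1) = p * (q + 1) + q + 1 by ring]
      change A.recv (A.run I (p * (q + 1) + q) u) _ = _
      rw [hrun]
      change (if P ≤ p then _ else if q + 1 = q + 1 then _ else _) = _
      rw [if_neg (by omega), if_pos rfl, hs p hlt u]
      congr 2
      ext ⟨x, m⟩
      have hall : ∀ b < q + 1, Function.update H q {x | ∃ v, v ≠ u ∧ x.1 = I.ident v ∧
            A.bcast (A.run I (p * (q + 1) + q) v) = some x.2} b =
          {x | ∃ v, v ≠ u ∧ x.1 = I.ident v ∧ x.2 = fun _ => e (msg (s p v)) b} := by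
        intro b hb
        by_cases hbq : b = q
        · subst hbq
          rw [Function.update_self]
          ext x
          refine exists_congr fun v => and_congr_right fun _ => and_congr_right fun _ => ?_
          obtain ⟨H', hrun', -⟩ := hin v
          rw [hrun']
          exact ⟨fun h => (Option.some.inj h).symm, fun h => congrArg some h.symm⟩
        · rw [Function.update_of_ne hbq]
          exact hH b (by omega)
      constructor
      · intro h
        have h' : ∀ b < q + 1, ∃ v, v ≠ u ∧ x = I.ident v ∧
            (fun _ : Fin W => e m b) = fun _ => e (msg (s p v)) b := by
          intro b hb
          have := h b hb
          rw [hall b hb] at this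
          exact this
        -- Bit 0 exists because `0 < B`, and it identifies a sender. As labels are distinct, the
        -- same vertex sent all other bits.
        obtain ⟨v, hv, hx, -⟩ := h' 0 (by omega)
        refine ⟨v, hv, Prod.ext hx (he _ _ fun b hb => ?_)⟩
        obtain ⟨v', -, hx', hm⟩ := h' b hb
        rw [hx] at hx'
        rw [← I.ident.injective hx'] at hm
        exact congrFun hm ⟨0, hW⟩
      · rintro ⟨v, hv, h⟩ b hb
        rw [Prod.mk.injEq] at h
        rw [hall b hb, h.1, h.2]
        exact ⟨v, hv, rfl, rfl⟩
  intro u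
  rw [key P le_rfl u]
  exact if_pos le_rfl

theorem BroadcastAlg.broadcasts_le {n W N : ℕ} {E Out : Type} (A : BroadcastAlg W N E Out)
    (I : Input n N E) (t : ℕ) : A.broadcasts I t ≤ t * n := by
  unfold BroadcastAlg.broadcasts
  refine (Finite.card_subtype_le _).trans ?_
  simp

/-! ### Phased algorithms for `k` machines -/

/-- An algorithm for `k` machines in which each machine sends a set of words to each machine in
every phase.  The capacity of the links in a phase is computed by the machines. -/
structure Phased (k N : ℕ) (E Out Word : Type) where
  coins : ℕ
  State : Type
  phases : ℕ
  init : Fin k → MachineView k N E → (Fin coins → Bool) → State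
  cap : State → ℕ
  send : Fin k → State → Fin k → Finset Word
  recv : Fin k → State → (Fin k → Finset Word) → State
  out : Fin k → State → Out

namespace Phased

variable {n k W N : ℕ} {E Out Word : Type}

/-- The states after `p` phases; messages that exceed the capacity are lost. -/
def run (A : Phased k N E Out Word) (I : Input n N E) (home : Fin n → Fin k)
    (ω : Fin k → Fin A.coins → Bool) : ℕ → Fin k → A.State
  | 0 => fun i => A.init i (I.machineView home i) (ω i)
  | p + 1 => fun i => A.recv i (A.run I home ω p i) fun j =>
      truncate (A.cap (A.run I home ω p i)) (A.send j (A.run I home ω p j) i)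

open Classical in
/-- The algorithm that sends the words bit by bit. -/
noncomputable def toAlg (A : Phased k N E Out Word) (hW : 1 ≤ W) (b : ℕ) :
    MachineAlg k W N E Out where
  coins := A.coins
  State := A.State × ℕ × ℕ × (ℕ → Fin k → Bool)
  init i X ω := (A.init i X ω, 0, 0, fun _ _ => false)
  send i σ j := fun _ =>
    encode Word b (A.cap σ.1) (truncate (A.cap σ.1) (A.send i σ.1 j)) σ.2.2.1
  recv i σ X :=
    if A.phases ≤ σ.2.1 then σ
    else if σ.2.2.1 + 1 = A.cap σ.1 * b then
      (A.recv i σ.1 fun j => decode Word b (A.cap σ.1) fun q =>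
        Function.update σ.2.2.2 σ.2.2.1 (fun j => X j ⟨0, hW⟩) q j, σ.2.1 + 1, 0, fun _ _ => false)
    else (σ.1, σ.2.1, σ.2.2.1 + 1, Function.update σ.2.2.2 σ.2.2.1 fun j => X j ⟨0, hW⟩)
  output i σ := if A.phases ≤ σ.2.1 then some (A.out i σ.1) else none
  irrevocable := by
    intro i σ X o h
    split_ifs at h with hP
    rw [if_pos hP, if_pos hP, h]

theorem toAlg_recv_of_ne (A : Phased k N E Out Word) (hW : 1 ≤ W) {b p q : ℕ} {i : Fin k}
    {s : A.State} {H : ℕ → Fin k → Bool} {X : Fin k → Fin W → Bool} (hp : p < A.phases)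
    (hq : q + 1 ≠ A.cap s * b) :
    (A.toAlg hW b).recv i (s, p, q, H) X =
      (s, p, q + 1, Function.update H q fun j => X j ⟨0, hW⟩) :=
  (if_neg (show ¬ A.phases ≤ p by omega)).trans (if_neg hq)

theorem toAlg_recv_of_eq (A : Phased k N E Out Word) (hW : 1 ≤ W) {b p q : ℕ} {i : Fin k}
    {s : A.State} {H : ℕ → Fin k → Bool} {X : Fin k → Fin W → Bool} (hp : p < A.phases)
    (hq : q + 1 = A.cap s * b) :
    (A.toAlg hW b).recv i (s, p, q, H) X =
      (A.recv i s fun j => decode Word b (A.cap s) fun q' =>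
        Function.update H q (fun j => X j ⟨0, hW⟩) q' j, p + 1, 0, fun _ _ => false) :=
  (if_neg (show ¬ A.phases ≤ p by omega)).trans (if_pos hq)

/-- The machines stay in lockstep because all of them compute the same capacity `c p`; phase `p`
then takes `c p * b` rounds everywhere. Positivity guarantees that a phase has a last round, which
is when the decoding happens. -/
theorem toAlg_outputs [Fintype Word] (A : Phased k N E Out Word) (hW : 1 ≤ W) {b : ℕ}
    (hb0 : 0 < b) (hb : Fintype.card Word < 2 ^ b) (I : Input n N E) (home : Fin n → Fin k)
    (ω : Fin k → Fin A.coins → Bool) (c : ℕ → ℕ)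
    (hc : ∀ p < A.phases, 0 < c p ∧ ∀ i, A.cap (A.run I home ω p i) = c p) :
    (A.toAlg hW b).Outputs I home ω (∑ p ∈ Finset.range A.phases, c p * b)
      fun i => A.out i (A.run I home ω A.phases i) := by
  classical
  set R := A.toAlg hW b (W := W) with hR
  set s := A.run I home ω with hs
  have key : ∀ p ≤ A.phases, ∀ i,
      R.run I home ω (∑ p ∈ Finset.range p, c p * b) i = (s p i, p, 0, fun _ _ => false) := by
    intro p
    induction p with
    | zero => exact fun _ i => rfl
    | succ p ih =>
      intro hp
      have hlt : p < A.phases := hp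
      set t := ∑ p ∈ Finset.range p, c p * b
      obtain ⟨hc0, hci⟩ := hc p hlt
      have hpos : 0 < c p * b := Nat.mul_pos hc0 (hb0)
      have hin : ∀ q < c p * b, ∀ i, ∃ H, R.run I home ω (t + q) i = (s p i, p, q, H) ∧
          ∀ a < q, ∀ j, H a j = encode Word b (c p) (truncate (c p) (A.send j (s p j) i)) a := by
        intro q
        induction q with
        | zero => exact fun _ i => ⟨_, ih hlt.le i, fun b hb => absurd hb (Nat.not_lt_zero b)⟩
        | succ q ihq =>
          intro hq i
          have ihq := ihq (by omega)
          obtain ⟨H, hrun, hH⟩ := ihq i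
          refine ⟨Function.update H q fun j => R.send j (R.run I home ω (t + q) j) i ⟨0, hW⟩, ?_, ?_⟩
          · change R.recv i (R.run I home ω (t + q) i) _ = _
            rw [hrun]
            exact toAlg_recv_of_ne A hW (by omega) (by rw [hci]; omega)
          · intro a ha j
            by_cases haq : a = q
            · subst haq
              rw [Function.update_self]
              obtain ⟨H', hrun', -⟩ := ihq j
              rw [hrun', ← hci j]
              rfl
            · rw [Function.update_of_ne haq]
              exact hH a (by omega) j
      intro i
      obtain ⟨q, hq⟩ : ∃ q, c p * b = q + 1 := ⟨c p * b - 1, by omega⟩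
      have hin := hin q (by omega)
      obtain ⟨H, hrun, hH⟩ := hin i
      rw [Finset.sum_range_succ, hq, ← add_assoc]
      change R.recv i (R.run I home ω (t + q) i) _ = _
      rw [hrun]
      refine (toAlg_recv_of_eq A hW (by omega) (by rw [hci, hq])).trans ?_
      change _ = (A.recv i (s p i) _, _, _, _)
      congr 2
      funext j
      change decode _ _ _ _ = truncate (A.cap (s p i)) (A.send j (s p j) i)
      rw [hci]
      refine decode_eq hb (card_truncate _ _) fun a ha => ?_
      by_cases haq : a = q
      · subst haq
        rw [Function.update_self]
        obtain ⟨H', hrun', -⟩ := hin j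
        rw [hrun', ← hci j]
        rfl
      · rw [Function.update_of_ne haq]
        exact (hH a (by omega) j).symm
  intro i
  rw [key _ le_rfl i]
  exact if_pos le_rfl

end Phased
/-! ### Kruskal's forest -/

section Kruskal

variable {V K : Type*} [LinearOrder K]

/-- The edges of `G` whose key is smaller than `b`. -/
def edgesBelow (G : SimpleGraph V) (key : Sym2 V → K) (b : K) : SimpleGraph V :=
  SimpleGraph.fromEdgeSet {f | f ∈ G.edgeSet ∧ key f < b}

theorem edgesBelow_adj {G : SimpleGraph V} {key : Sym2 V → K} {b : K} {u v : V} :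
    (edgesBelow G key b).Adj u v ↔ G.Adj u v ∧ key s(u, v) < b := by
  simp only [edgesBelow, SimpleGraph.fromEdgeSet_adj, Set.mem_ofPred_eq, SimpleGraph.mem_edgeSet]
  exact ⟨fun h => h.1, fun h => ⟨h, h.1.ne⟩⟩

/-- The minimum spanning forest: the edges whose ends are not joined by edges of smaller key. -/
def kruskal (G : SimpleGraph V) (key : Sym2 V → K) : SimpleGraph V where
  Adj u v := G.Adj u v ∧ ¬ (edgesBelow G key (key s(u, v))).Reachable u v
  symm := ⟨fun u v h => ⟨h.1.symm, by
    rw [Sym2.eq_swap]; exact fun h' => h.2 h'.symm⟩⟩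
  loopless := ⟨fun u h => h.1.ne rfl⟩

theorem kruskal_le (G : SimpleGraph V) (key : Sym2 V → K) : kruskal G key ≤ G :=
  fun _ _ h => h.1

/-- The edge of smallest key that leaves a set belongs to the minimum spanning forest. -/
theorem kruskal_adj_of_cut {G : SimpleGraph V} {key : Sym2 V → K} {S : Set V} {u v : V}
    (huv : G.Adj u v) (hu : u ∈ S) (hv : v ∉ S)
    (hmin : ∀ x ∈ S, ∀ y, y ∉ S → G.Adj x y → key s(u, v) ≤ key s(x, y)) :
    (kruskal G key).Adj u v := by
  refine ⟨huv, fun ⟨p⟩ => ?_⟩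
  obtain ⟨d, -, h1, h2⟩ := p.exists_boundary_dart S hu hv
  have := edgesBelow_adj.1 d.adj
  exact absurd this.2 (not_lt.2 (hmin _ h1 _ h2 this.1))

/-- On a cycle, the ends of the edge of largest key are joined by the remaining edges, all of
smaller key, so that edge is not in the forest. -/
theorem kruskal_isAcyclic (G : SimpleGraph V) {key : Sym2 V → K} (hkey : Function.Injective key) :
    (kruskal G key).IsAcyclic := by
  classical
  intro v c hc
  have hne : c.edges.toFinset.Nonempty := by
    have := hc.three_le_length
    rw [List.toFinset_nonempty_iff]
    intro h
    rw [← SimpleGraph.Walk.length_edges, h] at this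
    simp at this
  obtain ⟨e, he, hmax⟩ := Finset.exists_max_image _ key hne
  rw [List.mem_toFinset] at he
  induction e with | h a b =>
  have hadj : (kruskal G key).Adj a b := c.adj_of_mem_edges he
  refine hadj.2 ?_
  set H := SimpleGraph.fromEdgeSet {f | f ∈ c.edges} with hH
  have hHadj : ∀ f ∈ c.edges, f ∈ H.edgeSet := by
    intro f hf
    rw [hH, SimpleGraph.edgeSet_fromEdgeSet]
    exact ⟨hf, (kruskal G key).not_isDiag_of_mem_edgeSet (c.edges_subset_edgeSet hf)⟩
  have hreach : (H.deleteEdges {s(a, b)}).Reachable a b :=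
    (SimpleGraph.adj_and_reachable_delete_edges_iff_exists_cycle.2
      ⟨v, c.transfer H hHadj, hc.transfer hHadj, by simpa using he⟩).2
  refine hreach.mono fun x y hxy => ?_
  rw [SimpleGraph.deleteEdges_adj, hH, SimpleGraph.fromEdgeSet_adj] at hxy
  obtain ⟨⟨h1, -⟩, h3⟩ := hxy
  rw [edgesBelow_adj]
  exact ⟨(c.adj_of_mem_edges h1).1, lt_of_le_of_ne (hmax _ (by simpa using h1))
    fun h => h3 (hkey h)⟩

/-- A component of the forest with an outgoing edge in `G` would have a smallest one, which belongs
to the forest by the cut property. -/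
theorem reachable_kruskal (G : SimpleGraph V) [Finite V] (key : Sym2 V → K)
    {u v : V} (h : G.Reachable u v) : (kruskal G key).Reachable u v := by
  classical
  cases nonempty_fintype V
  by_contra hn
  set S : Set V := {x | (kruskal G key).Reachable u x} with hS
  obtain ⟨p⟩ := h
  obtain ⟨d, -, h1, h2⟩ := p.exists_boundary_dart S (SimpleGraph.Reachable.refl u) hn
  set D : Finset (V × V) := Finset.univ.filter fun x => x.1 ∈ S ∧ x.2 ∉ S ∧ G.Adj x.1 x.2 with hD
  have hne : D.Nonempty := ⟨(d.fst, d.snd), by simp [hD, h1, h2, d.adj]⟩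
  obtain ⟨⟨a, b⟩, hab, hmin⟩ := Finset.exists_min_image D (fun x => key s(x.1, x.2)) hne
  simp only [hD, Finset.mem_filter, Finset.mem_univ, true_and] at hab
  have : (kruskal G key).Adj a b := kruskal_adj_of_cut hab.2.2 hab.1 hab.2.1 fun x hx y hy hxy =>
    hmin (x, y) (by simp [hD, hx, hy, hxy])
  exact hab.2.1 (SimpleGraph.Reachable.trans hab.1 this.reachable)

/-- A subgraph of the minimum spanning forest with the same reachability is the whole forest. -/
theorem eq_kruskal_of_le {G F : SimpleGraph V} {key : Sym2 V → K} (hkey : Function.Injective key)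
    (hF : F ≤ kruskal G key) (hreach : ∀ u v, G.Adj u v → F.Reachable u v) :
    F = kruskal G key := by
  refine le_antisymm hF fun u v huv => ?_
  by_contra hn
  have hb := SimpleGraph.isAcyclic_iff_forall_adj_isBridge.1 (kruskal_isAcyclic G hkey) huv
  rw [SimpleGraph.isBridge_iff] at hb
  refine hb ((hreach u v huv.1).mono fun x y hxy => ?_)
  rw [SimpleGraph.deleteEdges_adj]
  refine ⟨hF hxy, fun h => hn ?_⟩
  rw [← SimpleGraph.mem_edgeSet, ← h]
  exact hxy

end Kruskal

/-- An exchange step towards Kruskal's tree. -/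
theorem exists_swap {V K : Type*} [LinearOrder K] [Finite V] {G T : SimpleGraph V}
    {key : Sym2 V → K} (hkey : Function.Injective key) (hTG : T ≤ G) (hT : T.IsTree)
    (hne : T ≠ kruskal G key) :
    ∃ e f : Sym2 V, e ∉ T.edgeSet ∧ f ∈ T.edgeSet ∧ key e < key f ∧
      ∃ T' : SimpleGraph V, T' ≤ G ∧ T'.IsTree ∧ T'.edgeSet = insert e (T.edgeSet \ {f}) := by
  classical
  -- Otherwise `T` contains the forest, which already connects the ends of every edge of `T`; a
  -- further edge would close a cycle in `T`.
  have hex : ∃ u v, (kruskal G key).Adj u v ∧ ¬ T.Adj u v := by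
    by_contra! h
    have hle : kruskal G key ≤ T := fun u v huv => h u v huv
    refine hne (le_antisymm ?_ hle)
    intro u v huv
    by_contra hn
    have hb := SimpleGraph.isAcyclic_iff_forall_adj_isBridge.1 hT.isAcyclic huv
    rw [SimpleGraph.isBridge_iff] at hb
    refine hb ((reachable_kruskal G key (hTG huv).reachable).mono fun x y hxy => ?_)
    rw [SimpleGraph.deleteEdges_adj]
    refine ⟨hle hxy, fun h => hn ?_⟩
    rw [← SimpleGraph.mem_edgeSet, ← h]
    exact hxy
  obtain ⟨u, v, huv, hnT⟩ := hex
  obtain ⟨p, hp⟩ := hT.connected.exists_isPath v u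
  -- If all edges of the tree path were smaller than `uv`, they would disqualify `uv` from Kruskal's
  -- forest.
  have hf : ∃ f ∈ p.edges, key s(u, v) ≤ key f := by
    by_contra! h
    refine huv.2 ⟨(p.transfer _ fun f hf => ?_).reverse⟩
    have h1 := SimpleGraph.edgeSet_mono hTG (p.edges_subset_edgeSet hf)
    have h2 := h f hf
    induction f with | h a b =>
    exact edgesBelow_adj.2 ⟨h1, h2⟩
  obtain ⟨f, hf, hle⟩ := hf
  have hfT := p.edges_subset_edgeSet hf
  have hef : s(u, v) ≠ f := fun h => hnT (by rw [← SimpleGraph.mem_edgeSet, h]; exact hfT)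
  have hlt : key s(u, v) < key f := lt_of_le_of_ne hle fun h => hef (hkey h)
  set T' := (T ⊔ SimpleGraph.edge u v).deleteEdges {f} with hT'
  have hedge : T'.edgeSet = insert s(u, v) (T.edgeSet \ {f}) := by
    rw [hT', SimpleGraph.edgeSet_deleteEdges, SimpleGraph.edgeSet_sup,
      SimpleGraph.edgeSet_edge_of_ne huv.ne]
    ext x
    simp only [Set.mem_sdiff, Set.mem_union, Set.mem_singleton_iff, Set.mem_insert_iff]
    constructor
    · tauto
    · rintro (rfl | h)
      · exact ⟨.inr rfl, hef⟩
      · exact ⟨.inl h.1, h.2⟩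
  refine ⟨s(u, v), f, hnT, hfT, hlt, T', ?_, ?_, hedge⟩
  · rw [← SimpleGraph.edgeSet_subset_edgeSet, hedge]
    rintro x (rfl | hx)
    · exact huv.1
    · exact SimpleGraph.edgeSet_mono hTG hx.1
  · rw [SimpleGraph.isTree_iff_connected_and_card] at hT ⊢
    constructor
    · have hc : (T ⊔ SimpleGraph.edge u v).Connected := hT.1.mono le_sup_left
      have hadj : (T ⊔ SimpleGraph.edge u v).Adj u v :=
        .inr ((SimpleGraph.edge_adj _ _ _ _).2 ⟨.inl ⟨rfl, rfl⟩, huv.ne⟩)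
      induction f with | h a b =>
      refine hc.connected_delete_edge_of_not_isBridge ?_
      rw [SimpleGraph.isBridge_iff, not_not]
      have hpath : (p.mapLe (le_sup_left : T ≤ T ⊔ SimpleGraph.edge u v)).IsPath := hp.mapLe _
      refine (SimpleGraph.adj_and_reachable_delete_edges_iff_exists_cycle.2
        ⟨u, .cons hadj (p.mapLe le_sup_left),
          SimpleGraph.Path.cons_isCycle ⟨_, hpath⟩ hadj ?_, ?_⟩).2
      · intro h
        rw [SimpleGraph.Walk.edges_mapLe_eq_edges] at h
        exact hnT (p.adj_of_mem_edges h)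
      · rw [SimpleGraph.Walk.edges_cons, SimpleGraph.Walk.edges_mapLe_eq_edges]
        exact List.mem_cons_of_mem _ hf
    · rw [← hT.2, hedge, Nat.card_coe_set_eq, Nat.card_coe_set_eq,
        Set.ncard_insert_of_notMem (fun h => hnT h.1) (Set.toFinite _),
        Set.ncard_sdiff_singleton_add_one hfT (Set.toFinite _)]

/-- Kruskal's forest of a connected graph is a minimum spanning tree. -/
theorem isMST_kruskal {n : ℕ} {K : Type*} [LinearOrder K] {G : SimpleGraph (Fin n)}
    (hG : G.Connected) (w : Sym2 (Fin n) → ℝ) {key : Sym2 (Fin n) → K}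
    (hkey : Function.Injective key) (hw : ∀ e f, key e ≤ key f → w e ≤ w f) :
    IsMST G w (kruskal G key) := by
  classical
  have := hG.nonempty
  refine ⟨⟨kruskal_le G key, ⟨⟨fun u v => reachable_kruskal G key (hG.preconnected u v)⟩,
    kruskal_isAcyclic G hkey⟩⟩, fun T hT => ?_⟩
  -- Weights may stay equal in an exchange, and keys live in an arbitrary order. The sum of the
  -- ranks of the keys is a natural number that strictly decreases, so the induction runs on it.
  set rk : Sym2 (Fin n) → ℕ := fun e => (Finset.univ.filter fun f => key f < key e).card with hrk
  have hrk_lt : ∀ e f, key e < key f → rk e < rk f := by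
    intro e f h
    refine Finset.card_lt_card (Finset.ssubset_iff_of_subset ?_ |>.2 ⟨e, ?_, ?_⟩)
    · intro x hx
      simp only [Finset.mem_filter, Finset.mem_univ, true_and] at hx ⊢
      exact hx.trans h
    · simpa using h
    · simp
  obtain ⟨s, hs⟩ : ∃ s, s = ∑ e ∈ T.edgeSet.toFinite.toFinset, rk e := ⟨_, rfl⟩
  induction s using Nat.strong_induction_on generalizing T with | _ s ih =>
  by_cases hTk : T = kruskal G key
  · rw [hTk]
  obtain ⟨e, f, he, hf, hlt, T', hT'G, hT', hedge⟩ := exists_swap hkey hT.1 hT.2 hTk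
  have hsum : ∀ {M : Type} [AddCommMonoid M] (g : Sym2 (Fin n) → M),
      ∃ r, ∑ x ∈ T.edgeSet.toFinite.toFinset, g x = g f + r ∧
        ∑ x ∈ T'.edgeSet.toFinite.toFinset, g x = g e + r := by
    intro M _ g
    refine ⟨∑ x ∈ T.edgeSet.toFinite.toFinset.erase f, g x, ?_, ?_⟩
    · exact (Finset.add_sum_erase _ _ (by simpa using hf)).symm
    · have : T'.edgeSet.toFinite.toFinset = insert e (T.edgeSet.toFinite.toFinset.erase f) := by
        ext x
        simp only [Set.Finite.mem_toFinset, hedge, Set.mem_insert_iff, Set.mem_sdiff,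
          Set.mem_singleton_iff, Finset.mem_insert, Finset.mem_erase]
        tauto
      rw [this, Finset.sum_insert]
      simp only [Finset.mem_erase, Set.Finite.mem_toFinset, not_and]
      exact fun _ => he
  obtain ⟨r, h1, h2⟩ := hsum rk
  obtain ⟨q, h3, h4⟩ := hsum w
  have hl := hrk_lt e f hlt
  refine (ih _ ?_ T' ⟨hT'G, hT'⟩ rfl).trans ?_
  · rw [hs]; omega
  · rw [totalWeight, totalWeight, h3, h4]
    linarith [hw e f hlt.le]

/-! ### Embeddings of graphs -/

section Map

variable {V V' : Type*}

theorem exists_reachable_of_map {G : SimpleGraph V} {f : V ↪ V'} {u : V} {y : V'}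
    (h : (G.map f).Reachable (f u) y) : ∃ v, f v = y ∧ G.Reachable u v := by
  obtain ⟨p⟩ := h
  generalize hx : f u = x at p
  induction p generalizing u with
  | nil => exact ⟨u, hx, .refl u⟩
  | cons hadj p ih =>
    subst hx
    obtain ⟨a, b, hab, ha, hb⟩ := (SimpleGraph.map_adj _ _ _ _).1 hadj
    subst hb
    rw [f.injective ha] at hab
    obtain ⟨v, hv, hr⟩ := ih rfl
    exact ⟨v, hv, hab.reachable.trans hr⟩

theorem reachable_map_iff {G : SimpleGraph V} (f : V ↪ V') {u v : V} :
    (G.map f).Reachable (f u) (f v) ↔ G.Reachable u v := by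
  constructor
  · intro h
    obtain ⟨w, hw, h⟩ := exists_reachable_of_map h
    rwa [f.injective hw] at h
  · exact fun h => h.map (SimpleGraph.Embedding.map f G).toHom

/-- This transfers the forest computed on the label set back to the vertices. -/
theorem kruskal_map {K : Type*} [LinearOrder K] (G : SimpleGraph V) (f : V ↪ V')
    (key : Sym2 V' → K) :
    kruskal (G.map f) key = (kruskal G fun e => key (e.map f)).map f := by
  have hb : ∀ b, edgesBelow (G.map f) key b = (edgesBelow G (fun e => key (e.map f)) b).map f := by
    intro b
    ext x y
    rw [edgesBelow_adj, SimpleGraph.map_adj, SimpleGraph.map_adj]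
    constructor
    · rintro ⟨⟨u, v, huv, rfl, rfl⟩, h⟩
      exact ⟨u, v, edgesBelow_adj.2 ⟨huv, h⟩, rfl, rfl⟩
    · rintro ⟨u, v, huv, rfl, rfl⟩
      exact ⟨⟨u, v, (edgesBelow_adj.1 huv).1, rfl, rfl⟩, (edgesBelow_adj.1 huv).2⟩
  ext x y
  rw [SimpleGraph.map_adj]
  constructor
  · rintro ⟨hxy, h⟩
    obtain ⟨u, v, huv, rfl, rfl⟩ := (SimpleGraph.map_adj _ _ _ _).1 hxy
    rw [hb, reachable_map_iff] at h
    exact ⟨u, v, ⟨huv, h⟩, rfl, rfl⟩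
  · rintro ⟨u, v, ⟨huv, h⟩, rfl, rfl⟩
    refine ⟨(SimpleGraph.map_adj _ _ _ _).2 ⟨u, v, huv, rfl, rfl⟩, ?_⟩
    rw [hb, reachable_map_iff]
    exact h

end Map

/-! ### Borůvka's algorithm -/

section Boruvka

variable {V K : Type*} [LinearOrder K]

/-- `xy` is the edge of smallest key that leaves the component of `x` in `F`. -/
def IsMinOut (G : SimpleGraph V) (key : Sym2 V → K) (F : SimpleGraph V) (x y : V) : Prop :=
  G.Adj x y ∧ ¬ F.Reachable x y ∧
    ∀ a b, F.Reachable x a → G.Adj a b → ¬ F.Reachable a b → key s(x, y) ≤ key s(a, b)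

/-- One phase: every component is joined along its smallest outgoing edge. -/
def boruvkaStep (G : SimpleGraph V) (key : Sym2 V → K) (F : SimpleGraph V) : SimpleGraph V :=
  F ⊔ SimpleGraph.fromRel (IsMinOut G key F)

/-- The forest after `p` phases. -/
def boruvka (G : SimpleGraph V) (key : Sym2 V → K) : ℕ → SimpleGraph V
  | 0 => ⊥
  | p + 1 => boruvkaStep G key (boruvka G key p)

/-- The cut property, applied to the component of `x` in `F`. -/
theorem IsMinOut.kruskal_adj {G F : SimpleGraph V} {key : Sym2 V → K} {x y : V}
    (h : IsMinOut G key F x y) : (kruskal G key).Adj x y :=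
  kruskal_adj_of_cut (S := {z | F.Reachable x z}) h.1 (SimpleGraph.Reachable.refl x) h.2.1
    fun a ha b hb hab => h.2.2 a b ha hab fun h' => hb (SimpleGraph.Reachable.trans ha h')

theorem boruvka_le_kruskal (G : SimpleGraph V) (key : Sym2 V → K) (p : ℕ) :
    boruvka G key p ≤ kruskal G key := by
  induction p with
  | zero => exact bot_le
  | succ p ih =>
    refine sup_le ih fun x y h => ?_
    rw [SimpleGraph.fromRel_adj] at h
    exact h.2.elim (fun h => h.kruskal_adj) fun h => h.kruskal_adj.symm

theorem exists_isMinOut [Finite V] {G F : SimpleGraph V} (key : Sym2 V → K) {x a b : V}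
    (hxa : F.Reachable x a) (hab : G.Adj a b) (hn : ¬ F.Reachable a b) :
    ∃ a' b', F.Reachable x a' ∧ IsMinOut G key F a' b' := by
  classical
  cases nonempty_fintype V
  set D : Finset (V × V) := Finset.univ.filter fun e =>
    F.Reachable x e.1 ∧ G.Adj e.1 e.2 ∧ ¬ F.Reachable e.1 e.2 with hD
  obtain ⟨⟨a', b'⟩, hm, hmin⟩ := Finset.exists_min_image D (fun e => key s(e.1, e.2))
    ⟨(a, b), by simp [hD, hxa, hab, hn]⟩
  simp only [hD, Finset.mem_filter, Finset.mem_univ, true_and] at hm hmin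
  exact ⟨a', b', hm.1, hm.2.1, hm.2.2, fun c d hc hcd hn => hmin (c, d) ⟨hm.1.trans hc, hcd, hn⟩⟩

/-- A component that can still grow after a phase contains an old component that could grow before
it. That one was joined along its smallest outgoing edge to another old component with an outgoing
edge, and by induction each of the two is large. -/
theorem two_pow_le_component [Finite V] (G : SimpleGraph V) (key : Sym2 V → K) (p : ℕ) :
    ∀ x a b, (boruvka G key p).Reachable x a → G.Adj a b → ¬ (boruvka G key p).Reachable a b →
      2 ^ p ≤ {y | (boruvka G key p).Reachable x y}.ncard := by
  induction p with
  | zero =>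
    intro x _ _ _ _ _
    exact (Set.ncard_pos (Set.toFinite _)).2 ⟨x, SimpleGraph.Reachable.refl x⟩
  | succ p ih =>
    intro x a b hxa hab hn
    set F := boruvka G key p
    set F' := boruvka G key (p + 1) with hF'
    have hFF' : F ≤ F' := le_sup_left
    have hnF : ¬ F.Reachable a b := fun h => hn (h.mono hFF')
    obtain ⟨c, d, hac, hcd⟩ := exists_isMinOut (F := F) key (SimpleGraph.Reachable.refl a) hab hnF
    have hcd' : F'.Adj c d := .inr (by
      rw [SimpleGraph.fromRel_adj]; exact ⟨hcd.1.ne, .inl hcd⟩)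
    have h1 := ih c a b hac.symm hab hnF
    have h2 := ih d d c (SimpleGraph.Reachable.refl d) hcd.1.symm fun h => hcd.2.1 h.symm
    have hdisj : Disjoint {y | F.Reachable c y} {y | F.Reachable d y} := by
      rw [Set.disjoint_left]
      exact fun y hy hy' => hcd.2.1 (SimpleGraph.Reachable.trans hy (SimpleGraph.Reachable.symm hy'))
    have hsub : {y | F.Reachable c y} ∪ {y | F.Reachable d y} ⊆ {y | F'.Reachable x y} := by
      have hxc : F'.Reachable x c := hxa.trans (hac.mono hFF')
      rintro y (hy | hy)
      · exact hxc.trans (SimpleGraph.Reachable.mono hFF' hy)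
      · exact (hxc.trans hcd'.reachable).trans (SimpleGraph.Reachable.mono hFF' hy)
    have h3 := Set.ncard_le_ncard hsub (Set.toFinite _)
    rw [Set.ncard_union_eq hdisj (Set.toFinite _) (Set.toFinite _)] at h3
    rw [pow_succ]
    omega

/-- After logarithmically many phases Borůvka's forest is the minimum spanning forest. -/
theorem boruvka_eq_kruskal [Finite V] (G : SimpleGraph V) {key : Sym2 V → K}
    (hkey : Function.Injective key) {p : ℕ} (hp : Nat.card V < 2 ^ p) :
    boruvka G key p = kruskal G key := by
  refine eq_kruskal_of_le hkey (boruvka_le_kruskal G key p) fun u v huv => ?_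
  by_contra hn
  have h1 := two_pow_le_component G key p u u v (SimpleGraph.Reachable.refl u) huv hn
  have h2 : {y | (boruvka G key p).Reachable u y}.ncard ≤ Nat.card V := by
    rw [← Set.ncard_univ]
    exact Set.ncard_le_ncard (Set.subset_univ _) (Set.toFinite _)
  omega

end Boruvka

/-! ### Borůvka's algorithm with broadcasts -/

section BoruvkaMessages

variable {N : ℕ} {Λ : Finset ℝ}

/-- The announcement of a vertex: the other end and the weight of an edge, or nothing. -/
abbrev EdgeMsg (N : ℕ) (Λ : Finset ℝ) : Type := Option (Fin N × {w // w ∈ Λ})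

/-- Edges are compared by weight; ties are broken by a fixed enumeration of the label pairs. -/
noncomputable def edgeKey {N : ℕ} (w : ℝ) (e : Sym2 (Fin N)) :
    ℝ ×ₗ Fin (Fintype.card (Sym2 (Fin N))) :=
  toLex (w, Fintype.equivFin _ e)

/-- The edge `xy` of weight `w`, read off from the view `X` of `x`, is the smallest edge at `x` that
leaves the component of `x` in `F`. -/
def IsBestEdge (F : SimpleGraph (Fin N)) (x : Fin N) (X : Set (Fin N × ℝ))
    (m : Fin N × {w // w ∈ Λ}) : Prop :=
  (m.1, (m.2 : ℝ)) ∈ X ∧ ¬ F.Reachable x m.1 ∧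
    ∀ y w, (y, w) ∈ X → ¬ F.Reachable x y → edgeKey m.2 s(x, m.1) ≤ edgeKey w s(x, y)

open Classical in
/-- The announcement of the vertex with label `x` and view `X`. -/
noncomputable def bestEdge (Λ : Finset ℝ) (F : SimpleGraph (Fin N)) (x : Fin N)
    (X : Set (Fin N × ℝ)) : EdgeMsg N Λ :=
  if h : ∃ m : Fin N × {w // w ∈ Λ}, IsBestEdge F x X m then some h.choose else none

/-- Among the announcements of each component the smallest edge is added to the forest. -/
def addBest (F : SimpleGraph (Fin N)) (Z : Set (Fin N × EdgeMsg N Λ)) : SimpleGraph (Fin N) :=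
  F ⊔ SimpleGraph.fromRel fun x y => ∃ w, (x, some (y, w)) ∈ Z ∧
    ∀ x' y' w', (x', some (y', w')) ∈ Z → F.Reachable x x' →
      edgeKey (w : ℝ) s(x, y) ≤ edgeKey (w' : ℝ) s(x', y')

/-- The smallest edge leaving a component is the smallest among the best edges of its vertices.
Vertices outside `R` are isolated and have nothing to announce. -/
theorem addBest_eq_boruvkaStep {G : SimpleGraph (Fin N)} {wt : Sym2 (Fin N) → ℝ}
    (hΛ : ∀ e ∈ G.edgeSet, wt e ∈ Λ) {R : Set (Fin N)} (hR : ∀ x y, G.Adj x y → x ∈ R)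
    (F : SimpleGraph (Fin N)) :
    addBest F {z : Fin N × EdgeMsg N Λ | z.1 ∈ R ∧
      z.2 = bestEdge Λ F z.1 {p | G.Adj z.1 p.1 ∧ p.2 = wt s(z.1, p.1)}} =
    boruvkaStep G (fun e => edgeKey (wt e) e) F := by
  classical
  have hspec : ∀ x y (w : {w // w ∈ Λ}),
      bestEdge Λ F x {p | G.Adj x p.1 ∧ p.2 = wt s(x, p.1)} = some (y, w) →
      G.Adj x y ∧ w = wt s(x, y) ∧ ¬ F.Reachable x y ∧ ∀ y', G.Adj x y' → ¬ F.Reachable x y' →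
        edgeKey (w : ℝ) s(x, y) ≤ edgeKey (wt s(x, y')) s(x, y') := by
    intro x y w h
    rw [bestEdge] at h
    split_ifs at h with hex
    have := hex.choose_spec
    rw [Option.some.injEq] at h
    rw [h] at this
    exact ⟨this.1.1, this.1.2, this.2.1, fun y' h1 h2 => this.2.2 y' _ ⟨h1, rfl⟩ h2⟩
  have hsome : ∀ a b, G.Adj a b → ¬ F.Reachable a b → ∃ m : Fin N × {w // w ∈ Λ},
      bestEdge Λ F a {p | G.Adj a p.1 ∧ p.2 = wt s(a, p.1)} = some m := by
    intro a b hab hn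
    obtain ⟨y, hy, hmin⟩ := Finset.exists_min_image
      (Finset.univ.filter fun y => G.Adj a y ∧ ¬ F.Reachable a y)
      (fun y => edgeKey (wt s(a, y)) s(a, y)) ⟨b, by simp [hab, hn]⟩
    simp only [Finset.mem_filter, Finset.mem_univ, true_and] at hy hmin
    have hex : ∃ m : Fin N × {w // w ∈ Λ},
        IsBestEdge F a {p | G.Adj a p.1 ∧ p.2 = wt s(a, p.1)} m := by
      refine ⟨(y, ⟨wt s(a, y), hΛ _ hy.1⟩), ⟨hy.1, rfl⟩, hy.2, ?_⟩
      rintro y' w' ⟨h1, h2⟩ h3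
      change w' = _ at h2
      rw [h2]
      exact hmin y' ⟨h1, h3⟩
    exact ⟨hex.choose, by rw [bestEdge, dif_pos hex]⟩
  rw [addBest, boruvkaStep]
  congr 2
  ext x y
  constructor
  · rintro ⟨w, ⟨-, hxy⟩, hmin⟩
    obtain ⟨h1, h2, h3, h4⟩ := hspec x y w hxy.symm
    refine ⟨h1, h3, fun a b hxa hab hn => ?_⟩
    obtain ⟨⟨y', w'⟩, hm⟩ := hsome a b hab hn
    obtain ⟨g1, g2, g3, g4⟩ := hspec a y' w' hm
    have := hmin a y' w' ⟨hR a b hab, hm.symm⟩ hxa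
    rw [h2] at this
    exact this.trans (g4 b hab hn)
  · rintro ⟨h1, h2, h3⟩
    obtain ⟨⟨y', w'⟩, hm⟩ := hsome x y h1 h2
    obtain ⟨g1, g2, g3, g4⟩ := hspec x y' w' hm
    have hle := g4 y h1 h2
    have hge := h3 x y' (SimpleGraph.Reachable.refl x) g1 g3
    rw [g2] at hle
    -- Keys determine edges, so the edge announced by `x` is `xy` itself.
    have heq := le_antisymm hle hge
    simp only [edgeKey, Prod.mk.injEq, EmbeddingLike.apply_eq_iff_eq] at heq
    have hy : y' = y := by
      have := heq.2
      rw [Sym2.eq_iff] at this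
      rcases this with h | h
      · exact h.2
      · exact absurd h.1 h1.ne
    subst hy
    refine ⟨w', ⟨hR x y' h1, hm.symm⟩, ?_⟩
    rintro a b wb ⟨-, hab⟩ hxa
    obtain ⟨f1, f2, f3, -⟩ := hspec a b wb hab.symm
    rw [g2, f2]
    exact h3 a b hxa f1 f3

end BoruvkaMessages

/-! ### Inputs seen through their labels -/

section Labels

variable {n N : ℕ}

/-- The input graph on the labels. -/
def Input.labelGraph {E : Type} (I : Input n N E) : SimpleGraph (Fin N) := I.graph.map I.ident

/-- The edge weights on the label pairs. -/
noncomputable def Input.labelWeight (I : Input n N ℝ) : Sym2 (Fin N) → ℝ :=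
  Function.extend (Sym2.map I.ident) I.label 0

theorem Input.labelWeight_map (I : Input n N ℝ) (e : Sym2 (Fin n)) :
    I.labelWeight (e.map I.ident) = I.label e :=
  (Sym2.map.injective I.ident.injective).extend_apply _ _ _

theorem Input.vertexView_eq (I : Input n N ℝ) (u : Fin n) : I.vertexView u =
    {p | I.labelGraph.Adj (I.ident u) p.1 ∧ p.2 = I.labelWeight s(I.ident u, p.1)} := by
  ext ⟨y, w⟩
  constructor
  · rintro ⟨v, huv, h⟩
    rw [Prod.mk.injEq] at h
    obtain ⟨rfl, rfl⟩ := h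
    exact ⟨(SimpleGraph.map_adj _ _ _ _).2 ⟨u, v, huv, rfl, rfl⟩,
      (I.labelWeight_map s(u, v)).symm⟩
  · rintro ⟨h1, h2⟩
    obtain ⟨u', v, huv, hu, hv⟩ := (SimpleGraph.map_adj _ _ _ _).1 h1
    simp only at hv h2
    subst hv
    rw [I.ident.injective hu] at huv
    exact ⟨v, huv, by rw [h2]; exact congrArg _ (I.labelWeight_map s(u, v))⟩

/-- Borůvka's forest of the input after `p` phases, on the labels. -/
noncomputable def Input.forest (I : Input n N ℝ) (p : ℕ) : SimpleGraph (Fin N) :=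
  boruvka I.labelGraph (fun e => edgeKey (I.labelWeight e) e) p

theorem Input.forest_succ {Λ : Finset ℝ} {I : Input n N ℝ} (hI : I ∈ weightedInputs n N Λ) (p : ℕ) :
    addBest (I.forest p) {z : Fin N × EdgeMsg N Λ | ∃ v,
      z = (I.ident v, bestEdge Λ (I.forest p) (I.ident v) (I.vertexView v))} =
    I.forest (p + 1) := by
  rw [Input.forest, Input.forest, boruvka,
    ← addBest_eq_boruvkaStep (Λ := Λ) (R := Set.range I.ident)]
  · congr 1
    ext ⟨x, m⟩
    constructor
    · rintro ⟨v, h⟩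
      rw [Prod.mk.injEq] at h
      obtain ⟨rfl, rfl⟩ := h
      exact ⟨⟨v, rfl⟩, by rw [I.vertexView_eq]⟩
    · rintro ⟨⟨v, rfl⟩, h⟩
      exact ⟨v, by rw [I.vertexView_eq]; exact Prod.ext rfl h⟩
  · intro e he
    induction e with | h x y =>
    obtain ⟨u, v, huv, rfl, rfl⟩ := (SimpleGraph.map_adj _ _ _ _).1 he
    have := I.labelWeight_map s(u, v)
    rw [Sym2.map_mk] at this
    exact this ▸ hI.2 _ huv
  · intro x y h
    obtain ⟨u, v, huv, rfl, rfl⟩ := (SimpleGraph.map_adj _ _ _ _).1 h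
    exact ⟨u, rfl⟩

/-- The tree is Kruskal's tree for the keys pulled back along the labels; it is chosen before `U`,
so all processors output parts of one and the same tree. -/
theorem Input.exists_isMST {Λ : Finset ℝ} {I : Input n N ℝ} (hI : I ∈ weightedInputs n N Λ) {p : ℕ}
    (hp : N < 2 ^ p) : ∃ T, IsMST I.graph I.label T ∧ ∀ U : Set (Fin n), edgesAt I.ident T U =
      {e | ∃ x y, (∃ u ∈ U, I.ident u = x) ∧ (I.forest p).Adj x y ∧ e = s(x, y)} := by
  have hinj : Function.Injective fun e : Sym2 (Fin N) => edgeKey (I.labelWeight e) e := by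
    intro e f h
    simp only [edgeKey, Prod.mk.injEq, EmbeddingLike.apply_eq_iff_eq] at h
    exact h.2
  refine ⟨kruskal I.graph fun e => edgeKey (I.labelWeight (e.map I.ident)) (e.map I.ident),
    isMST_kruskal hI.1 _ (hinj.comp (Sym2.map.injective I.ident.injective)) ?_, fun U => ?_⟩
  · intro e f h
    simp only [edgeKey, Prod.Lex.toLex_le_toLex, I.labelWeight_map] at h
    exact h.elim le_of_lt fun h => h.1.le
  · rw [Input.forest, boruvka_eq_kruskal _ hinj (by simpa using hp), Input.labelGraph, kruskal_map]
    ext e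
    constructor
    · rintro ⟨u, v, hu, huv, rfl⟩
      exact ⟨_, _, ⟨u, hu, rfl⟩, (SimpleGraph.map_adj _ _ _ _).2 ⟨u, v, huv, rfl, rfl⟩, rfl⟩
    · rintro ⟨x, y, ⟨u, hu, rfl⟩, hxy, rfl⟩
      obtain ⟨u', v, huv, hu', rfl⟩ := (SimpleGraph.map_adj _ _ _ _).1 hxy
      rw [I.ident.injective hu'] at huv
      exact ⟨u, v, hu, huv, rfl⟩

end Labels

/-! ### Uniform probabilities -/

section Prob

variable {Ω Ω' : Type} [Fintype Ω] [Fintype Ω']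

open Classical in
theorem prob_eq_sum (p : Ω → Prop) :
    prob p = (∑ ω, if p ω then (1 : ℝ) else 0) / Fintype.card Ω := by
  rw [prob, Nat.card_eq_fintype_card, Fintype.card_subtype, Finset.sum_boole]

theorem prob_nonneg (p : Ω → Prop) : 0 ≤ prob p := by
  unfold prob; positivity

theorem prob_mono {p q : Ω → Prop} (h : ∀ ω, p ω → q ω) : prob p ≤ prob q := by
  unfold prob
  have : Nat.card {ω // p ω} ≤ Nat.card {ω // q ω} :=
    Nat.card_le_card_of_injective (Subtype.map id h) (Subtype.map_injective h Function.injective_id)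
  gcongr

theorem prob_eq_one_sub [Nonempty Ω] (p : Ω → Prop) : prob p = 1 - prob fun ω => ¬ p ω := by
  classical
  rw [prob_eq_sum, prob_eq_sum, eq_sub_iff_add_eq, ← add_div, ← Finset.sum_add_distrib,
    div_eq_one_iff_eq (by simp)]
  rw [Finset.sum_congr rfl (g := fun _ => (1 : ℝ)) fun ω _ => by split_ifs <;> simp_all]
  simp

theorem prob_exists_le {ι : Type*} [Fintype ι] (p : ι → Ω → Prop) :
    (prob fun ω => ∃ i, p i ω) ≤ ∑ i, prob (p i) := by
  classical
  simp only [prob_eq_sum]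
  rw [← Finset.sum_div, Finset.sum_comm]
  gcongr with ω
  split_ifs with h
  · obtain ⟨i, hi⟩ := h
    refine le_trans ?_ (Finset.single_le_sum (f := fun i => if p i ω then (1 : ℝ) else 0)
      (fun i _ => by positivity) (Finset.mem_univ i))
    rw [if_pos hi]
  · positivity

theorem prob_or_le (p q : Ω → Prop) : (prob fun ω => p ω ∨ q ω) ≤ prob p + prob q := by
  classical
  simp only [prob_eq_sum]
  rw [← add_div, ← Finset.sum_add_distrib]
  gcongr with ω
  split_ifs <;> simp_all

/-- Markov's inequality. -/
theorem prob_le_of_le {p : Ω → Prop} {f : Ω → ℝ} (hf : ∀ ω, 0 ≤ f ω) {a : ℝ} (ha : 0 < a)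
    (h : ∀ ω, p ω → a ≤ f ω) : prob p ≤ (∑ ω, f ω) / Fintype.card Ω / a := by
  classical
  rw [prob_eq_sum, div_right_comm, Finset.sum_div Finset.univ f a]
  refine div_le_div_of_nonneg_right (Finset.sum_le_sum fun ω _ => ?_) (Nat.cast_nonneg _)
  split_ifs with hp
  · rw [one_le_div ha]; exact h ω hp
  · exact div_nonneg (hf ω) ha.le

theorem prob_prod_eq (p : Ω → Ω' → Prop) :
    (prob fun x : Ω × Ω' => p x.1 x.2) = (∑ ω, prob (p ω)) / Fintype.card Ω := by
  classical
  simp only [prob_eq_sum]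
  rw [← Finset.sum_div, div_div, Fintype.sum_prod_type, Fintype.card_prod, Nat.cast_mul, mul_comm]

theorem prob_le_one (p : Ω → Prop) : prob p ≤ 1 := by
  unfold prob
  rw [← Nat.card_eq_fintype_card]
  exact div_le_one_of_le₀ (by exact_mod_cast Finite.card_subtype_le p) (by positivity)

/-- A union bound by conditioning: the first coordinate may be exceptional, and otherwise the second
one, being independent, fails rarely. -/
theorem prob_prod_le {p : Ω → Ω' → Prop} {q : Ω → Prop} {ε : ℝ} (hε : 0 ≤ ε)
    (h : ∀ ω, ¬ q ω → prob (p ω) ≤ ε) :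
    (prob fun x : Ω × Ω' => p x.1 x.2) ≤ prob q + ε := by
  classical
  rw [prob_prod_eq]
  by_cases hΩ : Fintype.card Ω = 0
  · rw [hΩ]
    simpa using add_nonneg (prob_nonneg q) hε
  have hpos : (0 : ℝ) < Fintype.card Ω := by exact_mod_cast Nat.pos_of_ne_zero hΩ
  rw [prob_eq_sum, ← sub_nonneg]
  have : ∑ ω, prob (p ω) ≤ ∑ ω, ((if q ω then (1 : ℝ) else 0) + ε) := by
    gcongr with ω
    split_ifs with hq
    · linarith [prob_le_one (p ω)]
    · linarith [h ω hq]
  rw [Finset.sum_add_distrib, Finset.sum_const, Finset.card_univ, nsmul_eq_mul] at this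
  rw [sub_nonneg, div_add' _ _ _ hpos.ne', div_le_div_iff_of_pos_right hpos]
  linarith

theorem prob_fst_le (p : Ω → Prop) : (prob fun x : Ω × Ω' => p x.1) ≤ prob p := by
  refine (prob_prod_le (p := fun ω _ => p ω) (q := p) le_rfl fun ω h => ?_).trans_eq (add_zero _)
  simp [h, prob]

/-- One coordinate of a uniform function is uniform. -/
theorem prob_eval {ι : Type} [Fintype ι] [DecidableEq ι] (i : ι) [Nonempty Ω] (p : Ω → Prop) :
    (prob fun f : ι → Ω => p (f i)) = prob p := by
  have e := (Equiv.subtypeEquiv (Equiv.funSplitAt i Ω) (p := fun f => p (f i))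
    (q := fun x => p x.1) fun f => Iff.rfl).trans
    (Equiv.prodSubtypeFstEquivSubtypeProd (α := Ω) (β := {j // j ≠ i} → Ω) (p := p)).symm.symm
  unfold prob
  rw [Nat.card_congr e, Nat.card_prod, Fintype.card_congr (Equiv.funSplitAt i Ω),
    Fintype.card_prod, Nat.card_eq_fintype_card (α := {j // j ≠ i} → Ω), Nat.cast_mul, Nat.cast_mul,
    mul_div_mul_right]
  exact_mod_cast Fintype.card_ne_zero

end Prob

/-! ### Chernoff bounds and derandomization -/

section Chernoff

theorem sum_prod_eval {α β : Type*} [Fintype α] [DecidableEq α] [Fintype β] (g : α → β → ℝ) :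
    ∑ f : α → β, ∏ a, g a (f a) = ∏ a, ∑ b, g a b := by
  rw [Finset.prod_univ_sum, Fintype.piFinset_univ]

/-- A Chernoff bound for sums of independent variables with values in the unit interval. -/
theorem prob_le_sum_le {α β : Type} [Fintype α] [DecidableEq α] [Fintype β] [Nonempty β]
    (w : α → β → ℝ) (h0 : ∀ a b, 0 ≤ w a b) (h1 : ∀ a b, w a b ≤ 1) (r : ℝ) :
    (prob fun f : α → β => r ≤ ∑ a, w a (f a)) ≤
      Real.exp ((∑ a, ∑ b, w a b) / Fintype.card β - r * Real.log 2) := by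
  have hβ : (0 : ℝ) < Fintype.card β := by exact_mod_cast Fintype.card_pos
  -- Markov's inequality for the exponential moment with base 2.
  refine (prob_le_of_le (f := fun f => ∏ a, (2 : ℝ) ^ w a (f a)) (fun f => by positivity)
    (a := (2 : ℝ) ^ r) (by positivity) fun f hf => ?_).trans ?_
  · rw [← Real.rpow_sum_of_pos (by norm_num)]
    exact Real.rpow_le_rpow_of_exponent_le (by norm_num) hf
  · rw [sum_prod_eval (fun a b => (2 : ℝ) ^ w a b), Real.exp_sub,
      Real.rpow_def_of_pos (by norm_num : (0 : ℝ) < 2), mul_comm (Real.log 2), Fintype.card_fun,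
      Nat.cast_pow, ← Finset.card_univ (α := α), ← Finset.prod_const, ← Finset.prod_div_distrib,
      Finset.sum_div, Real.exp_sum]
    gcongr with a
    calc (∑ b, (2 : ℝ) ^ w a b) / Fintype.card β
        ≤ (∑ b, (1 + w a b)) / Fintype.card β := by
          gcongr with b
          -- Bernoulli's inequality for exponents in the unit interval: `2 ^ w ≤ 1 + w`.
          have := rpow_one_add_le_one_add_mul_self (s := 1) (by norm_num) (h0 a b) (h1 a b)
          norm_num at this
          exact this
      _ = (∑ b, w a b) / Fintype.card β + 1 := by
          rw [Finset.sum_add_distrib, add_div, add_comm, Finset.sum_const, Finset.card_univ,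
            nsmul_one, div_self hβ.ne']
      _ ≤ _ := Real.add_one_le_exp _

/-- The Chernoff bound for the weight that is mapped to a given point. -/
theorem prob_le_weight_le {α : Type} [Fintype α] [DecidableEq α] {k : ℕ} (i : Fin k)
    (w : α → ℝ) (h0 : ∀ a, 0 ≤ w a) (h1 : ∀ a, w a ≤ 1) (r : ℝ) :
    (prob fun f : α → Fin k => r ≤ ∑ a with f a = i, w a) ≤
      Real.exp ((∑ a, w a) / k - r * Real.log 2) := by
  have : Nonempty (Fin k) := ⟨i⟩
  have h := prob_le_sum_le (fun a (j : Fin k) => if j = i then w a else 0)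
    (fun a j => by split_ifs <;> simp [h0]) (fun a j => by split_ifs <;> simp [h1]) r
  simpa [Finset.sum_filter] using h

/-- Random strings can be drawn from a small list. -/
theorem exists_derandomization {X Y S : Type} [Fintype X] [Fintype Y] [Nonempty Y] [Fintype S]
    [Nonempty S] (bad : X → S → Prop) {n a : ℕ} (hn : 0 < n)
    (hbad : ∀ x, prob (bad x) ≤ 1 / (16 * n)) (hX : Fintype.card X < 2 ^ a)
    (hY : 4 * n * a ≤ Fintype.card Y) :
    ∃ g : Y → S, ∀ x, (prob fun y => bad x (g y)) ≤ 1 / (2 * n) := by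
  classical
  have hn' : (0 : ℝ) < n := by exact_mod_cast hn
  by_contra! hcon
  set t : ℝ := (Fintype.card Y : ℝ) with ht
  have htpos : 0 < t := by rw [ht]; exact_mod_cast Fintype.card_pos
  have h1 : (1 : ℝ) ≤ prob fun g : Y → S => ∃ x, 1 / (2 * n) < prob fun y => bad x (g y) := by
    rw [prob_eq_one_sub]
    simp only [hcon, not_true]
    simp [prob]
  -- For a random list `g` the number of bad entries is a sum of independent indicators with mean at
  -- most `t / (16 n)`. The Chernoff bound beats the fewer than `2 ^ a` choices of `x`, because `t ≥
  -- 4 n a`.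
  have h2 : ∀ x, (prob fun g : Y → S => 1 / (2 * n) < prob fun y => bad x (g y)) ≤
      Real.exp (-(t / (4 * n))) := by
    intro x
    refine (prob_mono (q := fun g : Y → S => t / (2 * n) ≤ ∑ y, if bad x (g y) then 1 else 0)
      fun g hg => ?_).trans ((prob_le_sum_le (fun _ s => if bad x s then 1 else 0)
        (fun _ _ => by positivity) (fun _ _ => by split_ifs <;> norm_num) _).trans ?_)
    · rw [prob_eq_sum, lt_div_iff₀ htpos] at hg
      refine le_trans (le_of_eq ?_) hg.le
      ring
    · rw [Real.exp_le_exp, Finset.sum_const, nsmul_eq_mul, Finset.card_univ, ← ht, mul_div_assoc,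
        ← prob_eq_sum]
      have hl := Real.log_two_gt_d9
      have h3 : t * prob (bad x) ≤ t * (1 / (16 * n)) := by gcongr; exact hbad x
      -- The margin between the constants is `1/16 + 1/4 < (log 2) / 2`.
      have h4 : t * (1 / (16 * n)) - t / (2 * n) * Real.log 2 - -(t / (4 * n)) =
        (t / n) * (1 / 16 + 1 / 4 - Real.log 2 / 2) := by field_simp; ring
      have h5 : (t / n) * (1 / 16 + 1 / 4 - Real.log 2 / 2) ≤ 0 :=
        mul_nonpos_of_nonneg_of_nonpos (by positivity) (by linarith)
      linarith
  have h3 := (h1.trans (prob_exists_le _)).trans (Finset.sum_le_sum fun x _ => h2 x)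
  rw [Finset.sum_const, nsmul_eq_mul, Finset.card_univ, Real.exp_neg, ← div_eq_mul_inv,
    one_le_div (Real.exp_pos _)] at h3
  have h4 : (2 : ℝ) ^ a ≤ Real.exp (t / (4 * n)) := by
    calc (2 : ℝ) ^ a ≤ Real.exp 1 ^ a := by
          gcongr
          linarith [Real.add_one_le_exp (1 : ℝ)]
      _ = Real.exp a := by rw [← Real.exp_nat_mul, mul_one]
      _ ≤ _ := by
        rw [Real.exp_le_exp, le_div_iff₀ (by positivity)]
        have : ((4 * n * a : ℕ) : ℝ) ≤ t := by rw [ht]; exact_mod_cast hY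
        push_cast at this
        linarith
  have h5 : (Fintype.card X : ℝ) < 2 ^ a := by exact_mod_cast hX
  linarith

end Chernoff

/-! ### Randomized contraction -/

section Contraction

variable {N : ℕ}

open Classical in
/-- The least element of a set, if there is one. -/
noncomputable def least (S : Set (Fin N)) : Option (Fin N) :=
  if h : ∃ a, IsLeast S a then some h.choose else none

theorem least_eq_some_iff {S : Set (Fin N)} {a : Fin N} : least S = some a ↔ IsLeast S a := by
  unfold least
  split_ifs with h
  · rw [Option.some.injEq]
    exact ⟨fun h' => h' ▸ h.choose_spec, fun h' => h.choose_spec.unique h'⟩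
  · exact ⟨fun h' => by simp at h', fun h' => (h ⟨a, h'⟩).elim⟩

theorem exists_isLeast {S : Set (Fin N)} (h : S.Nonempty) : ∃ a, IsLeast S a := by
  obtain ⟨a, ha, hmin⟩ := (Set.toFinite S).exists_minimal h
  exact ⟨a, ha, fun b hb => (le_total a b).elim id fun h => hmin hb h⟩

theorem least_eq_none_iff {S : Set (Fin N)} : least S = none ↔ S = ∅ := by
  constructor
  · intro h
    by_contra hne
    obtain ⟨a, ha⟩ := exists_isLeast (Set.nonempty_iff_ne_empty.2 hne)
    rw [least_eq_some_iff.2 ha] at h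
    exact Option.some_ne_none _ h
  · rintro rfl
    exact dif_neg fun ⟨a, ha⟩ => ha.1

/-- This is why a machine may report only its least candidate: the proxy recovers the least
candidate overall. -/
theorem least_iUnion {ι : Type*} (S : ι → Set (Fin N)) :
    least {a | ∃ i, least (S i) = some a} = least (⋃ i, S i) := by
  cases h : least (⋃ i, S i) with
  | none =>
    rw [least_eq_none_iff] at h ⊢
    rw [Set.eq_empty_iff_forall_notMem] at h ⊢
    rintro a ⟨i, hi⟩
    exact h a (Set.mem_iUnion.2 ⟨i, (least_eq_some_iff.1 hi).1⟩)
  | some a =>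
    rw [least_eq_some_iff] at h ⊢
    obtain ⟨hm, hle⟩ := h
    obtain ⟨i, hi⟩ := Set.mem_iUnion.1 hm
    refine ⟨⟨i, least_eq_some_iff.2 ⟨hi, fun b hb => hle (Set.mem_iUnion.2 ⟨i, hb⟩)⟩⟩, ?_⟩
    rintro b ⟨j, hj⟩
    exact hle (Set.mem_iUnion.2 ⟨j, (least_eq_some_iff.1 hj).1⟩)

/-- The names with head coins among the neighbours, through the edges in `E`, of a name `C` whose
coin shows tails. -/
def headNeighbors (E : Set (Fin N × Fin N)) (ν : Fin N → Fin N) (c : Fin N → Bool) (C : Fin N) :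
    Set (Fin N) :=
  {D | c C = false ∧ c D = true ∧ ∃ e ∈ E, ν e.1 = C ∧ ν e.2 = D}

/-- The directed edges of a graph. -/
def arcs (G : SimpleGraph (Fin N)) : Set (Fin N × Fin N) := {e | G.Adj e.1 e.2}

/-- The new name of the vertices that had the name `C`. -/
noncomputable def rename (G : SimpleGraph (Fin N)) (ν : Fin N → Fin N) (c : Fin N → Bool)
    (C : Fin N) : Fin N :=
  (least (headNeighbors (arcs G) ν c C)).getD C

/-- The names of the vertices after `p` phases of contraction with the coins `c`. -/
noncomputable def names (G : SimpleGraph (Fin N)) (c : ℕ → Fin N → Bool) : ℕ → Fin N → Fin N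
  | 0 => id
  | p + 1 => fun x => rename G (names G c p) (c p) (names G c p x)

theorem rename_eq_or (G : SimpleGraph (Fin N)) (ν : Fin N → Fin N) (c : Fin N → Bool) (C : Fin N) :
    (headNeighbors (arcs G) ν c C = ∅ ∧ rename G ν c C = C) ∨
      rename G ν c C ∈ headNeighbors (arcs G) ν c C := by
  unfold rename
  cases h : least (headNeighbors (arcs G) ν c C) with
  | none => exact .inl ⟨least_eq_none_iff.1 h, rfl⟩
  | some a => exact .inr (least_eq_some_iff.1 h).1

/-- A renaming follows an edge of `G`, so for any coins a name never leaves the component. The coins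
can only cause too little merging. -/
theorem reachable_names (G : SimpleGraph (Fin N)) (c : ℕ → Fin N → Bool) (p : ℕ) (x : Fin N) :
    G.Reachable x (names G c p x) := by
  induction p generalizing x with
  | zero => exact .refl x
  | succ p ih =>
    change G.Reachable x (rename G (names G c p) (c p) (names G c p x))
    rcases rename_eq_or G (names G c p) (c p) (names G c p x) with h | ⟨-, -, ⟨a, b⟩, hab, h1, h2⟩
    · rw [h.2]; exact ih x
    · rw [← h2]
      refine (ih x).trans ?_
      rw [← h1]
      exact (ih a).symm.trans ((SimpleGraph.Adj.reachable hab).trans (ih b))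

/-- The names that have an edge to another name. -/
def activeNames (G : SimpleGraph (Fin N)) (ν : Fin N → Fin N) : Set (Fin N) :=
  {C | ∃ x y, G.Adj x y ∧ ν x = C ∧ ν y ≠ C}

/-- A name in use after the phase either was kept by its vertices or was adopted by others. In the
first case it found no head neighbour; in the second it shows heads and did not look for one. -/
theorem activeNames_rename_subset (G : SimpleGraph (Fin N)) (ν : Fin N → Fin N)
    (c : Fin N → Bool) : activeNames G (fun x => rename G ν c (ν x)) ⊆
      {C | C ∈ activeNames G ν ∧ headNeighbors (arcs G) ν c C = ∅} := by
  rintro C ⟨x, y, hxy, hx, hy⟩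
  simp only at hx hy
  rcases rename_eq_or G ν c (ν x) with h | h
  · have hxC : ν x = C := h.2.symm.trans hx
    refine ⟨⟨x, y, hxy, hxC, fun hyC => hy ?_⟩, hxC ▸ h.1⟩
    rw [hyC, ← hxC, h.2]
  · rw [hx] at h
    obtain ⟨h1, h2, ⟨a, b⟩, hab, ha, hb⟩ := h
    refine ⟨⟨b, a, SimpleGraph.Adj.symm hab, hb, fun h => ?_⟩, ?_⟩
    · rw [ha] at h
      rw [h, h2] at h1
      exact Bool.noConfusion h1
    · rw [Set.eq_empty_iff_forall_notMem]
      rintro D ⟨h3, -⟩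
      rw [h2] at h3
      exact Bool.noConfusion h3

theorem prob_two_coins {C D : Fin N} (h : C ≠ D) :
    (prob fun c : Fin N → Bool => ¬ (c C = false ∧ c D = true)) = 3 / 4 := by
  have h1 : (prob fun c : Fin N → Bool => c C = false ∧ c D = true) = 1 / 4 := by
    have hind : ∀ c : Fin N → Bool, (if c C = false ∧ c D = true then (1 : ℝ) else 0) =
        ∏ a, (if (a = C → c a = false) ∧ (a = D → c a = true) then (1 : ℝ) else 0) := by
      intro c
      rw [Finset.prod_ite_zero]
      simp only [Finset.prod_const_one, Finset.mem_univ, forall_true_left]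
      refine if_congr ⟨?_, ?_⟩ rfl rfl
      · rintro ⟨h1, h2⟩ a
        exact ⟨fun h => h ▸ h1, fun h => h ▸ h2⟩
      · exact fun h => ⟨(h C).1 rfl, (h D).2 rfl⟩
    rw [prob_eq_sum]
    have : ∀ c : Fin N → Bool, (@ite _ (c C = false ∧ c D = true) (Classical.propDecidable _)
      (1 : ℝ) 0) = _ := fun c => (by congr : _ = _).trans (hind c)
    rw [Finset.sum_congr rfl fun c _ => this c,
      sum_prod_eval fun a b =>
        if (a = C → b = false) ∧ (a = D → b = true) then (1 : ℝ) else 0]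
    rw [Fintype.card_fun, Fintype.card_bool, Nat.cast_pow, ← Finset.card_univ, ← Finset.prod_const,
      ← Finset.prod_div_distrib]
    rw [Finset.prod_congr rfl (g := fun a => if a ∈ ({C, D} : Finset (Fin N)) then (1 / 2 : ℝ) else 1)]
    · rw [Finset.prod_ite_mem, Finset.univ_inter, Finset.prod_const, Finset.card_pair h]
      norm_num
    · intro a _
      by_cases h1 : a = C
      · subst h1; simp [h]
      · by_cases h2 : a = D
        · subst h2; simp [h1]
        · simp [h1, h2]
  have h2 := prob_eq_one_sub (fun c : Fin N → Bool => c C = false ∧ c D = true)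
  linarith

/-- Fix for each active name one adjacent name. With probability 1/4 the former shows tails and the
latter heads, and then the active name disappears. -/
theorem sum_activeNames_le (G : SimpleGraph (Fin N)) (ν : Fin N → Fin N) :
    (∑ c : Fin N → Bool, ((activeNames G fun x => rename G ν c (ν x)).ncard : ℝ)) ≤
      3 / 4 * 2 ^ N * (activeNames G ν).ncard := by
  classical
  have hc : ∀ S : Set (Fin N), (S.ncard : ℝ) = ∑ C, if C ∈ S then (1 : ℝ) else 0 := by
    intro S
    rw [Finset.sum_boole, Set.ncard_eq_toFinset_card', Nat.cast_inj]
    congr 1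
    ext C
    simp
  simp only [hc]
  rw [Finset.sum_comm, Finset.mul_sum]
  gcongr with C
  split_ifs with h
  · obtain ⟨x, y, hxy, hx, hy⟩ := h
    have h2 := prob_two_coins (Ne.symm hy)
    rw [prob_eq_sum, Fintype.card_fun, Fintype.card_bool, Fintype.card_fin, Nat.cast_pow,
      div_eq_iff (by positivity), Nat.cast_two] at h2
    rw [mul_one, ← h2]
    gcongr with c
    split_ifs with h3 h4
    · have h5 := (activeNames_rename_subset G ν c h3).2
      exact absurd (show ν y ∈ headNeighbors (arcs G) ν c C from ⟨h4.1, h4.2, (x, y), hxy, hx, rfl⟩)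
        (Set.eq_empty_iff_forall_notMem.1 h5 (ν y))
    · rfl
    · rfl
    · exact zero_le_one
  · rw [mul_zero, Finset.sum_eq_zero]
    intro c _
    rw [if_neg]
    exact fun h' => h (activeNames_rename_subset G ν c h').1

/-- A finite sequence of coin functions, continued arbitrarily. -/
def extendSeq {P : ℕ} {X : Type*} (x₀ : X) (c : Fin P → X) (p : ℕ) : X :=
  if h : p < P then c ⟨p, h⟩ else x₀

theorem names_congr (G : SimpleGraph (Fin N)) {c c' : ℕ → Fin N → Bool} {P : ℕ}
    (h : ∀ p < P, c p = c' p) : names G c P = names G c' P := by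
  induction P with
  | zero => rfl
  | succ P ih =>
    funext x
    rw [names, names, ih fun p hp => h p (by omega), h P (by omega)]

/-- The last coins are independent of the earlier ones, so the one-phase bound applies with the
names reached so far held fixed. -/
theorem sum_activeNames_names_le (G : SimpleGraph (Fin N)) (x₀ : Fin N → Bool) (P : ℕ) :
    (∑ c : Fin P → Fin N → Bool, ((activeNames G (names G (extendSeq x₀ c) P)).ncard : ℝ)) ≤
      (3 / 4 * 2 ^ N) ^ P * N := by
  induction P with
  | zero =>
    rw [Fintype.sum_unique, pow_zero, one_mul, Nat.cast_le]
    exact (Set.ncard_le_card _).trans_eq (by simp)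
  | succ P ih =>
    rw [← (Fin.snocEquiv fun _ : Fin (P + 1) => Fin N → Bool).sum_comp, Fintype.sum_prod_type_right]
    calc _ = ∑ c : Fin P → Fin N → Bool, ∑ a : Fin N → Bool, ((activeNames G fun x =>
            rename G (names G (extendSeq x₀ c) P) a (names G (extendSeq x₀ c) P x)).ncard : ℝ) := by
          refine Finset.sum_congr rfl fun c _ => Finset.sum_congr rfl fun a _ => ?_
          congr 3
          funext x
          have h1 : names G (extendSeq x₀ ((Fin.snocEquiv fun _ : Fin (P + 1) => Fin N → Bool) (a, c)))
              P = names G (extendSeq x₀ c) P := by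
            refine names_congr G fun p hp => ?_
            rw [extendSeq, extendSeq, dif_pos hp, dif_pos (by omega)]
            exact Fin.snoc_castSucc (α := fun _ => Fin N → Bool) a c ⟨p, hp⟩
          have h2 : extendSeq x₀ ((Fin.snocEquiv fun _ : Fin (P + 1) => Fin N → Bool) (a, c)) P = a := by
            rw [extendSeq, dif_pos (by omega)]
            exact Fin.snoc_last (α := fun _ => Fin N → Bool) a c
          rw [names, h1, h2]
      _ ≤ ∑ c : Fin P → Fin N → Bool,
          3 / 4 * 2 ^ N * ((activeNames G (names G (extendSeq x₀ c) P)).ncard : ℝ) :=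
        Finset.sum_le_sum fun c _ => sum_activeNames_le G _
      _ ≤ _ := by
        rw [← Finset.mul_sum, pow_succ', mul_assoc (3 / 4 * 2 ^ N : ℝ)]
        exact mul_le_mul_of_nonneg_left ih (by positivity)

theorem prob_activeNames_le (G : SimpleGraph (Fin N)) (x₀ : Fin N → Bool) (P : ℕ) :
    (prob fun c : Fin P → Fin N → Bool => (activeNames G (names G (extendSeq x₀ c) P)).Nonempty) ≤
      (3 / 4) ^ P * N := by
  refine (prob_le_of_le
    (f := fun c => ((activeNames G (names G (extendSeq x₀ c) P)).ncard : ℝ))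
    (fun c => Nat.cast_nonneg _) one_pos fun c hc => ?_).trans ?_
  · have := (Set.ncard_pos (Set.toFinite _)).2 hc
    exact_mod_cast this
  · rw [div_one, Fintype.card_fun, Fintype.card_fun, Fintype.card_bool, Fintype.card_fin,
      Fintype.card_fin, div_le_iff₀ (by positivity)]
    refine (sum_activeNames_names_le G x₀ P).trans_eq ?_
    push_cast
    rw [mul_pow]
    ring

/-- Without active names no edge changes the name, hence no walk does; the converse holds because
names stay in their component. -/
theorem names_eq_iff_reachable {G : SimpleGraph (Fin N)} {c : ℕ → Fin N → Bool} {p : ℕ}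
    (h : ¬ (activeNames G (names G c p)).Nonempty) {x y : Fin N} :
    names G c p x = names G c p y ↔ G.Reachable x y := by
  constructor
  · intro hxy
    exact (reachable_names G c p x).trans (hxy ▸ (reachable_names G c p y).symm)
  · rintro ⟨w⟩
    induction w with
    | nil => rfl
    | cons hadj w ih =>
      refine Eq.trans ?_ ih
      by_contra hne
      exact h ⟨_, _, _, hadj, rfl, Ne.symm hne⟩

end Contraction

/-! ### Logarithms -/

/-- The number of binary digits of `n`. -/
def digits (n : ℕ) : ℕ := Nat.log 2 n + 1

theorem lt_two_pow_digits (n : ℕ) : n < 2 ^ digits n := Nat.lt_pow_succ_log_self one_lt_two n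

theorem digits_pos (n : ℕ) : 1 ≤ digits n := Nat.le_add_left 1 _

theorem digits_le {n : ℕ} (hn : 2 ≤ n) : (digits n : ℝ) ≤ 3 * Real.log n := by
  have h1 : (Nat.log 2 n : ℝ) * Real.log 2 ≤ Real.log n := by
    rw [← Real.log_pow]
    refine Real.log_le_log (by positivity) ?_
    exact_mod_cast Nat.pow_log_le_self 2 (by omega)
  have h2 : Real.log 2 ≤ Real.log n := Real.log_le_log (by norm_num) (by exact_mod_cast hn)
  have h3 := Real.log_two_gt_d9
  have h4 : (Nat.log 2 n : ℝ) * (2 / 3) ≤ Nat.log 2 n * Real.log 2 := by gcongr; linarith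
  rw [digits]
  push_cast
  linarith

theorem le_two_pow_of_le_pow {N n c : ℕ} (h : N ≤ n ^ c) : N ≤ 2 ^ (c * digits n) :=
  h.trans (by
    rw [mul_comm, pow_mul]
    exact Nat.pow_le_pow_left (lt_two_pow_digits n).le c)

/-- Bounds in `digits n ≥ 1` may be raised to a larger exponent, which real logarithms below 1 would
not allow. So the passage to logarithms is made last, at the common exponent `a'`. -/
theorem le_softO {K a a' n : ℕ} {C T x : ℝ} (hn : 2 ≤ n) (hx : 0 ≤ x) (ha : a ≤ a')
    (hC : K * 3 ^ a' ≤ C) (h : T ≤ K * (digits n : ℝ) ^ a * (x + 1)) : T ≤ softO C a' n x := by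
  have hd : (1 : ℝ) ≤ digits n := by exact_mod_cast digits_pos n
  have hl : 0 ≤ Real.log n := Real.log_natCast_nonneg n
  calc T ≤ K * (digits n : ℝ) ^ a' * (x + 1) := h.trans (by gcongr)
    _ ≤ K * (3 * Real.log n) ^ a' * (x + 1) := by gcongr; exact digits_le hn
    _ = K * 3 ^ a' * Real.log n ^ a' * (x + 1) := by rw [mul_pow]; ring
    _ ≤ C * Real.log n ^ a' * (x + 1) := by gcongr
    _ = softO C a' n x := by rw [softO]; ring

/-- At the threshold of twice the mean plus `s`, the mean cancels from the Chernoff exponent since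
`2 log 2 > 1`. -/
theorem prob_heavy_le {α : Type} [Fintype α] [DecidableEq α] {k : ℕ} (i : Fin k)
    (w : α → ℝ) (h0 : ∀ a, 0 ≤ w a) (h1 : ∀ a, w a ≤ 1) (s : ℕ) :
    (prob fun f : α → Fin k => 2 * (∑ a, w a) / k + s ≤ ∑ a with f a = i, w a) ≤ (1 / 2) ^ s := by
  refine (prob_le_weight_le i w h0 h1 _).trans ?_
  have h2 : 0 ≤ (∑ a, w a) / k := div_nonneg (Finset.sum_nonneg fun a _ => h0 a) (Nat.cast_nonneg k)
  have h3 := Real.log_two_gt_d9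
  have h4 : ((1 : ℝ) / 2) ^ s = Real.exp (-(s * Real.log 2)) := by
    rw [Real.exp_neg, Real.exp_nat_mul, Real.exp_log (by norm_num), one_div, inv_pow]
  rw [h4, Real.exp_le_exp, mul_div_assoc]
  nlinarith

/-- Truncation makes time and correctness separate concerns: `hcap` concerns every partition and all
coins, and probability enters only through `hfail`. -/
theorem solvesWithin_toAlg {n k W N : ℕ} {E Out Word : Type} [Fintype Word] [Nonempty (Fin k)]
    (A : Phased k N E Out Word) (hW : 1 ≤ W) {b : ℕ} (hb0 : 0 < b)
    (hb : Fintype.card Word < 2 ^ b) {dom : Set (Input n N E)}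
    {feasible : Input n N E → (Fin n → Fin k) → (Fin k → Out) → Prop} {ε : ℝ}
    {bound : Input n N E → ℝ}
    (hcap : ∀ I ∈ dom, ∀ home ω, ∃ c : ℕ → ℕ,
      (∀ p < A.phases, 0 < c p ∧ ∀ i, A.cap (A.run I home ω p i) = c p) ∧
      ((∑ p ∈ Finset.range A.phases, c p * b : ℕ) : ℝ) ≤ bound I)
    (hfail : ∀ I ∈ dom, (prob fun r : (Fin n → Fin k) × (Fin k → Fin A.coins → Bool) =>
      ¬ feasible I r.1 fun i => A.out i (A.run I r.1 r.2 A.phases i)) ≤ ε) :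
    SolvesWithin (A.toAlg hW b) dom feasible ε bound := by
  intro I hI
  constructor
  · intro home ω
    obtain ⟨c, hc, hT⟩ := hcap I hI home ω
    exact ⟨_, _, hT, A.toAlg_outputs hW hb0 hb I home ω c hc⟩
  · have h := hfail I hI
    have h1 := prob_eq_one_sub fun r : (Fin n → Fin k) × (Fin k → Fin A.coins → Bool) =>
      feasible I r.1 fun i => A.out i (A.run I r.1 r.2 A.phases i)
    refine le_trans (by linarith) (prob_mono (p := fun r : (Fin n → Fin k) ×
      (Fin k → Fin A.coins → Bool) =>
        feasible I r.1 fun i => A.out i (A.run I r.1 r.2 A.phases i)) ?_)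
    intro r hr
    obtain ⟨c, hc, hT⟩ := hcap I hI r.1 r.2
    exact ⟨_, _, A.toAlg_outputs hW hb0 hb I r.1 r.2 c hc, hr⟩

/-! ### Minimum spanning trees -/

theorem exists_broadcastMST (c : ℕ) : ∃ K a : ℕ, ∀ (n N W : ℕ) (Λ : Finset ℝ),
    1 ≤ W → N ≤ n ^ c → Λ.card ≤ n ^ c →
    ∃ A : BroadcastAlg W N ℝ (Set (Sym2 (Fin N))), BroadcastComputesMST A (weightedInputs n N Λ)
      (K * (digits n : ℝ) ^ a * (0 + 1)) (K * (digits n : ℝ) ^ a * (n + 1)) := by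
  refine ⟨(c + 1) * (2 * c + 1), 2, fun n N W Λ hW hN hΛ => ?_⟩
  set L := digits n with hL
  have hL1 : 1 ≤ L := digits_pos n
  have hN' := le_two_pow_of_le_pow hN
  have hΛ' := le_two_pow_of_le_pow hΛ
  have hM : Fintype.card (EdgeMsg N Λ) ≤ 2 ^ (2 * c * L + 1) := by
    rw [Fintype.card_option, Fintype.card_prod, Fintype.card_fin, Fintype.card_coe]
    have h1 := Nat.mul_le_mul hN' hΛ'
    rw [← pow_add] at h1
    have h2 : 1 ≤ 2 ^ (2 * c * L) := Nat.one_le_two_pow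
    rw [pow_succ]
    rw [show c * L + c * L = 2 * c * L by ring] at h1
    omega
  obtain ⟨A, hA⟩ := exists_broadcastAlg (W := W) (P := c * L + 1) (B := 2 * c * L + 1) hW
    (Nat.succ_pos _) hM (fun x X => ((x, X, ⊥) : Fin N × Set (Fin N × ℝ) × SimpleGraph (Fin N)))
    (fun s => bestEdge Λ s.2.2 s.1 s.2.1)
    -- A vertex does not receive its own broadcast, so its announcement is inserted by hand.
    (fun s Z => (s.1, s.2.1, addBest s.2.2 (insert (s.1, bestEdge Λ s.2.2 s.1 s.2.1) Z)))
    (fun s => {e | ∃ x y, x = s.1 ∧ s.2.2.Adj x y ∧ e = s(x, y)})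
  refine ⟨A, fun I hI => ?_⟩
  obtain ⟨T, hT, hout⟩ := I.exists_isMST hI (p := c * L + 1)
    (hN'.trans_lt (Nat.pow_lt_pow_right one_lt_two (Nat.lt_succ_self _)))
  have htime : (c * L + 1) * (2 * c * L + 1) ≤ (c + 1) * (2 * c + 1) * L ^ 2 := by
    calc (c * L + 1) * (2 * c * L + 1) ≤ (c * L + L) * (2 * c * L + L) := by gcongr
      _ = _ := by ring
  have htime' : (((c * L + 1) * (2 * c * L + 1) : ℕ) : ℝ) ≤
      ((c + 1) * (2 * c + 1) : ℕ) * (L : ℝ) ^ 2 := by exact_mod_cast htime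
  refine ⟨(c * L + 1) * (2 * c * L + 1), T, ?_, ?_, hT, ?_⟩
  rotate_left 2
  · have := hA n I (fun p u => (I.ident u, I.vertexView u, I.forest p)) (fun u => rfl) ?_
    · intro u
      refine (this u).trans (congrArg some (Eq.trans ?_ (hout {u}).symm))
      simp [eq_comm]
    · intro p _ u
      refine Prod.ext rfl (Prod.ext rfl ?_)
      refine (I.forest_succ hI p).symm.trans ?_
      congr 1
      ext z
      constructor
      · rintro ⟨v, hv⟩
        by_cases h : v = u
        · exact .inl (h ▸ hv)
        · exact .inr ⟨v, h, hv⟩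
      · rintro (h | ⟨v, -, hv⟩)
        · exact ⟨u, h⟩
        · exact ⟨v, hv⟩
  · rw [zero_add, mul_one]
    exact htime'
  · have h1 := A.broadcasts_le I ((c * L + 1) * (2 * c * L + 1))
    calc _ ≤ ((((c * L + 1) * (2 * c * L + 1) : ℕ) : ℝ)) * n := by exact_mod_cast h1
      _ ≤ _ := by gcongr; linarith

/-- The words that a machine announces in a phase of Borůvka's algorithm. -/
noncomputable def announcements {k N : ℕ} (Λ : Finset ℝ) (X : MachineView k N ℝ)
    (F : SimpleGraph (Fin N)) : Set (Fin N × EdgeMsg N Λ) :=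
  {z | z.1 ∈ X.own ∧ z.2 = bestEdge Λ F z.1 {p | ∃ h, (z.1, p.1, h, p.2) ∈ X.incident}}

theorem Input.announcements_eq {n k N : ℕ} {Λ : Finset ℝ} (I : Input n N ℝ) (home : Fin n → Fin k)
    (i : Fin k) (F : SimpleGraph (Fin N)) : announcements Λ (I.machineView home i) F =
      {z | ∃ v, home v = i ∧ z = (I.ident v, bestEdge Λ F (I.ident v) (I.vertexView v))} := by
  have h : ∀ u, home u = i →
      {p : Fin N × ℝ | ∃ h, (I.ident u, p.1, h, p.2) ∈ (I.machineView home i).incident} =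
        I.vertexView u := by
    intro u hu
    ext ⟨y, w⟩
    constructor
    · rintro ⟨h, u', v, -, huv, heq⟩
      simp only [Prod.mk.injEq, EmbeddingLike.apply_eq_iff_eq] at heq
      obtain ⟨rfl, rfl, rfl, rfl⟩ := heq
      exact ⟨v, huv, rfl⟩
    · rintro ⟨v, huv, heq⟩
      rw [Prod.mk.injEq] at heq
      obtain ⟨rfl, rfl⟩ := heq
      exact ⟨home v, u, v, hu, huv, rfl⟩
  ext ⟨x, m⟩
  constructor
  · rintro ⟨⟨u, hu, rfl⟩, hm⟩
    simp only at hm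
    rw [h u hu] at hm
    exact ⟨u, hu, by rw [hm]⟩
  · rintro ⟨u, hu, heq⟩
    rw [Prod.mk.injEq] at heq
    obtain ⟨rfl, rfl⟩ := heq
    exact ⟨⟨u, hu, rfl⟩, by simp only; rw [h u hu]⟩

/-- Borůvka's algorithm for `k` machines. -/
noncomputable def boruvkaPhased (k N : ℕ) (Λ : Finset ℝ) (P cap : ℕ) :
    Phased k N ℝ (Set (Sym2 (Fin N))) (Fin N × EdgeMsg N Λ) where
  coins := 0
  State := MachineView k N ℝ × SimpleGraph (Fin N)
  phases := P
  init _ X _ := (X, ⊥)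
  cap _ := cap
  send _ σ _ := (Set.toFinite (announcements Λ σ.1 σ.2)).toFinset
  recv _ σ Z := (σ.1, addBest σ.2 {z | ∃ j, z ∈ Z j})
  out _ σ := {e | ∃ x y, x ∈ σ.1.own ∧ σ.2.Adj x y ∧ e = s(x, y)}

theorem boruvkaPhased_run {n k N : ℕ} {Λ : Finset ℝ} {P cap : ℕ} {I : Input n N ℝ}
    (hI : I ∈ weightedInputs n N Λ) {home : Fin n → Fin k}
    (hload : ∀ i, (Finset.univ.filter fun v => home v = i).card ≤ cap)
    (ω : Fin k → Fin (boruvkaPhased k N Λ P cap).coins → Bool) (p : ℕ) (i : Fin k) :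
    (boruvkaPhased k N Λ P cap).run I home ω p i = (I.machineView home i, I.forest p) := by
  classical
  induction p generalizing i with
  | zero => rfl
  | succ p ih =>
    change (((boruvkaPhased k N Λ P cap).run I home ω p i).1, addBest _ _) = _
    simp only [ih]
    refine Prod.ext rfl ((congrArg (addBest (I.forest p)) ?_).trans (I.forest_succ hI p))
    have hsend : ∀ j, truncate cap (Set.toFinite (announcements Λ (I.machineView home j)
        (I.forest p))).toFinset = (Set.toFinite (announcements Λ (I.machineView home j)
        (I.forest p))).toFinset := by
      intro j
      refine truncate_eq (le_trans ?_ (hload j))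
      refine (Finset.card_le_card ?_).trans (Finset.card_image_le (f := fun v =>
        (I.ident v, bestEdge Λ (I.forest p) (I.ident v) (I.vertexView v))))
      intro z hz
      rw [Set.Finite.mem_toFinset, I.announcements_eq] at hz
      obtain ⟨v, hv, rfl⟩ := hz
      exact Finset.mem_image.2 ⟨v, by simp [hv], rfl⟩
    ext z
    constructor
    · rintro ⟨j, hj⟩
      change z ∈ truncate cap (Set.toFinite (announcements Λ _ _)).toFinset at hj
      rw [hsend, Set.Finite.mem_toFinset, I.announcements_eq] at hj
      obtain ⟨v, -, hv⟩ := hj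
      exact ⟨v, hv⟩
    · rintro ⟨v, hv⟩
      refine ⟨home v, ?_⟩
      change z ∈ truncate cap (Set.toFinite (announcements Λ _ _)).toFinset
      rw [hsend, Set.Finite.mem_toFinset, I.announcements_eq]
      exact ⟨v, rfl, hv⟩

theorem one_half_pow_digits_le {n : ℕ} (hn : 2 ≤ n) (b : ℕ) :
    ((1 : ℝ) / 2) ^ (b * digits n) ≤ (1 / n) ^ b := by
  have h : (n : ℝ) ≤ 2 ^ digits n := by exact_mod_cast (lt_two_pow_digits n).le
  have hn' : (0 : ℝ) < n := by exact_mod_cast (by omega : 0 < n)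
  rw [mul_comm, pow_mul, one_div, inv_pow, one_div]
  gcongr

theorem exists_machineMST (c : ℕ) : ∃ K a : ℕ, ∀ (n k N W : ℕ) (Λ : Finset ℝ),
    2 ≤ k → k ≤ n → 1 ≤ W → N ≤ n ^ c → Λ.card ≤ n ^ c →
    ∃ A : MachineAlg k W N ℝ (Set (Sym2 (Fin N))),
      SolvesWithin A (weightedInputs n N Λ) mstFeasible (1 / n)
        fun _ => K * (digits n : ℝ) ^ a * ((n / k : ℝ) + 1) := by
  refine ⟨(c + 1) * (3 * c + 2) * 4, 3, fun n k N W Λ hk hkn hW hN hΛ => ?_⟩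
  set L := digits n with hL
  have hL1 : 1 ≤ L := digits_pos n
  have hN' := le_two_pow_of_le_pow hN
  have hΛ' := le_two_pow_of_le_pow hΛ
  have hword : Fintype.card (Fin N × EdgeMsg N Λ) < 2 ^ (3 * c * L + 2) := by
    rw [Fintype.card_prod, Fintype.card_option, Fintype.card_prod, Fintype.card_fin,
      Fintype.card_coe]
    have h1 := Nat.mul_le_mul hN' hΛ'
    have h2 : 1 ≤ 2 ^ (c * L) * 2 ^ (c * L) := Nat.mul_pos (by positivity) (by positivity)
    have h3 := Nat.mul_le_mul hN' (Nat.add_le_add h1 h2)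
    have h4 : 2 ^ (c * L) * (2 ^ (c * L) * 2 ^ (c * L) + 2 ^ (c * L) * 2 ^ (c * L)) =
      2 ^ (3 * c * L + 1) := by ring
    rw [h4] at h3
    exact h3.trans_lt (Nat.pow_lt_pow_right one_lt_two (Nat.lt_succ_self _))
  have : Nonempty (Fin k) := ⟨⟨0, by omega⟩⟩
  -- Twice the mean load, rounded up, plus `2 L`: a machine exceeds this with probability at most `1
  -- / n ^ 2`, which leaves `1 / n` after the union over the `k ≤ n` machines.
  set cap := 2 * (n / k + 1) + 2 * L with hcap
  have hn' : (0 : ℝ) < n := by exact_mod_cast (by omega : 0 < n)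
  have hk' : (0 : ℝ) < k := by exact_mod_cast (by omega : 0 < k)
  have hcap0 : 0 < cap := by rw [hcap]; positivity
  refine ⟨(boruvkaPhased k N Λ (c * L + 1) cap).toAlg hW (3 * c * L + 2),
    solvesWithin_toAlg _ hW (Nat.succ_pos _) hword ?_ ?_⟩
  · refine fun I _ home ω => ⟨fun _ => cap, fun p _ => ⟨hcap0, fun i => rfl⟩, ?_⟩
    change ((∑ p ∈ Finset.range (c * L + 1), _ : ℕ) : ℝ) ≤ _
    rw [Finset.sum_const, Finset.card_range, smul_eq_mul, hcap]
    push_cast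
    have h1 : ((n / k : ℕ) : ℝ) ≤ n / k := Nat.cast_div_le
    have hL1' : (1 : ℝ) ≤ L := by exact_mod_cast hL1
    calc _ ≤ ((c : ℝ) * L + L) * ((2 * ((n / k : ℝ) * L + L) + 2 * (L * (n / k : ℝ) + L)) *
          (3 * c * L + 2 * L)) := by
          have h2 : (c : ℝ) * L + 1 ≤ c * L + L := by linarith
          have h3 : (3 : ℝ) * c * L + 1 + 1 ≤ 3 * c * L + 2 * L := by linarith
          have h4 : 2 * (((n / k : ℕ) : ℝ) + 1) + 2 * L ≤
              2 * ((n / k : ℝ) * L + L) + 2 * (L * (n / k : ℝ) + L) := by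
            have h5 : (n / k : ℝ) ≤ (n / k : ℝ) * L := le_mul_of_one_le_right (by positivity) hL1'
            have h6 : 0 ≤ L * (n / k : ℝ) := by positivity
            linarith
          exact mul_le_mul h2 (mul_le_mul h4 h3 (by positivity) (by positivity)) (by positivity)
            (by positivity)
      _ = _ := by ring
  · intro I hI
    refine (prob_mono (q := fun r : (Fin n → Fin k) ×
        (Fin k → Fin (boruvkaPhased k N Λ (c * L + 1) cap).coins → Bool) =>
      ∃ i, cap < (Finset.univ.filter fun v => r.1 v = i).card) ?_).trans ?_
    · intro r hr
      by_contra! h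
      obtain ⟨T, hT, hout⟩ := I.exists_isMST hI (p := c * L + 1)
        (hN'.trans_lt (Nat.pow_lt_pow_right one_lt_two (Nat.lt_succ_self _)))
      refine hr ⟨T, hT, fun i => ?_⟩
      refine (congrArg ((boruvkaPhased k N Λ (c * L + 1) cap).out i)
        (boruvkaPhased_run hI h r.2 (c * L + 1) i)).trans ?_
      rw [hout]
      rfl
    · refine (prob_fst_le fun home : Fin n → Fin k =>
        ∃ i, cap < (Finset.univ.filter fun v => home v = i).card).trans ?_
      refine (prob_exists_le fun i (home : Fin n → Fin k) =>
          cap < (Finset.univ.filter fun v => home v = i).card).trans ?_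
      calc _ ≤ ∑ i : Fin k, ((1 : ℝ) / n) ^ 2 := by
            refine Finset.sum_le_sum fun i _ => le_trans (prob_mono fun home h => ?_)
              ((prob_heavy_le i (fun _ : Fin n => (1 : ℝ)) (fun _ => zero_le_one)
                (fun _ => le_rfl) (2 * L)).trans
              (one_half_pow_digits_le (by omega) 2))
            rw [Finset.sum_const, Finset.sum_const, nsmul_one, nsmul_one, Finset.card_univ,
              Fintype.card_fin]
            have h1 : (n : ℝ) / k ≤ (n / k : ℕ) + 1 := by
              rw [div_le_iff₀ hk']
              exact_mod_cast (Nat.lt_div_mul_add (by omega : 0 < k)).le.trans_eq (by ring)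
            have h2 : (cap : ℝ) < (Finset.univ.filter fun v => home v = i).card := by
              exact_mod_cast h
            rw [hcap] at h2
            push_cast at h2 ⊢
            rw [mul_div_assoc]
            linarith
        _ = k * (1 / n) ^ 2 := by simp
        _ ≤ n * (1 / n) ^ 2 := by gcongr
        _ = 1 / n := by field_simp

/-! ### Contraction by `k` machines -/

section Messages

variable {k N b : ℕ}

/-- What a machine publishes in the first phase: its seed, the number of its arcs, and the
maximum number of its arcs at a vertex. -/
abbrev PubMsg (N b : ℕ) : Type := (Fin b → Bool) × Fin (N * N + 1) × Fin (N + 1)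

/-- The words of the contraction algorithm. -/
abbrev ContractWord (N b : ℕ) : Type := PubMsg N b ⊕ (Fin N × Option (Fin N))

/-- A set of words as a message. -/
noncomputable def words (S : Set (ContractWord N b)) : Finset (ContractWord N b) :=
  (Set.toFinite S).toFinset

@[simp] theorem mem_words {S : Set (ContractWord N b)} {w : ContractWord N b} :
    w ∈ words S ↔ w ∈ S := Set.Finite.mem_toFinset _

theorem card_words (S : Set (ContractWord N b)) : (words S).card = S.ncard :=
  (Set.ncard_eq_toFinset_card S).symm

/-- The names with proxy `j` that occur at the ends of the arcs in `A`. -/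
def askedNames (A : Set (Fin N × Fin N)) (ν : Fin N → Fin N) (h : Fin N → Fin k) (j : Fin k) :
    Set (Fin N) :=
  {C | h C = j ∧ ∃ e ∈ A, ν e.1 = C ∨ ν e.2 = C}

/-- For each name, the best candidate for contraction among the arcs in `A` is sent to the proxy. -/
noncomputable def queries (A : Set (Fin N × Fin N)) (ν : Fin N → Fin N) (c : Fin N → Bool)
    (h : Fin N → Fin k) (j : Fin k) : Set (ContractWord N b) :=
  (fun C => .inr (C, least (headNeighbors A ν c C))) '' askedNames A ν h j

/-- The proxy answers machine `j` with the new names. -/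
noncomputable def replies (inbox : Fin k → Finset (ContractWord N b)) (j : Fin k) :
    Set (ContractWord N b) :=
  {w | ∃ C o, .inr (C, o) ∈ inbox j ∧
    w = .inr (C, some ((least {D | ∃ i, .inr (C, some D) ∈ inbox i}).getD C))}

/-- The update of the names after the answers. -/
noncomputable def readReplies (inbox : Fin k → Finset (ContractWord N b)) (ν : Fin N → Fin N)
    (x : Fin N) : Fin N :=
  (least {D | ∃ j, .inr (ν x, some D) ∈ inbox j}).getD (ν x)

/-- The least and the greatest name of the vertices in `own`. -/
def summary (own : Set (Fin N)) (ν : Fin N → Fin N) : Set (ContractWord N b) :=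
  {w | ∃ C, (IsLeast (ν '' own) C ∨ IsGreatest (ν '' own) C) ∧ w = .inr (C, none)}

theorem headNeighbors_congr {A : Set (Fin N × Fin N)} {ν ν' : Fin N → Fin N}
    (h : ∀ e ∈ A, ν e.1 = ν' e.1 ∧ ν e.2 = ν' e.2) (c : Fin N → Bool) (C : Fin N) :
    headNeighbors A ν c C = headNeighbors A ν' c C := by
  ext D
  refine and_congr_right fun _ => and_congr_right fun _ => exists_congr fun e =>
    and_congr_right fun he => ?_
  rw [(h e he).1, (h e he).2]

theorem askedNames_congr {A : Set (Fin N × Fin N)} {ν ν' : Fin N → Fin N}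
    (h : ∀ e ∈ A, ν e.1 = ν' e.1 ∧ ν e.2 = ν' e.2) (f : Fin N → Fin k) (j : Fin k) :
    askedNames A ν f j = askedNames A ν' f j := by
  ext D
  refine and_congr_right fun _ => exists_congr fun e => and_congr_right fun he => ?_
  rw [(h e he).1, (h e he).2]

theorem headNeighbors_iUnion {ι : Type*} (A : ι → Set (Fin N × Fin N)) (ν : Fin N → Fin N)
    (c : Fin N → Bool) (C : Fin N) :
    headNeighbors (⋃ i, A i) ν c C = ⋃ i, headNeighbors (A i) ν c C := by
  ext D
  simp only [headNeighbors, Set.mem_ofPred_eq, Set.mem_iUnion]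
  constructor
  · rintro ⟨h1, h2, e, ⟨i, hi⟩, he⟩
    exact ⟨i, h1, h2, e, hi, he⟩
  · rintro ⟨i, h1, h2, e, hi, he⟩
    exact ⟨h1, h2, e, ⟨i, hi⟩, he⟩

/-- All queries about a name reach its single proxy `j`, which therefore sees the candidates from
all arcs of `G`. Names at both ends are asked for, since a machine must also follow the names of the
far ends of its arcs. -/
theorem replies_eq {A : Fin k → Set (Fin N × Fin N)} {G : SimpleGraph (Fin N)}
    (hG : arcs G = ⋃ i, A i) (ν : Fin N → Fin N) (c : Fin N → Bool) (h : Fin N → Fin k)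
    (i j : Fin k) :
    replies (b := b) (fun i' => words (queries (A i') ν c h j)) i =
      (fun C => .inr (C, some (rename G ν c C))) '' askedNames (A i) ν h j := by
  have key : ∀ C, h C = j →
      {D | ∃ i', (.inr (C, some D) : ContractWord N b) ∈ words (queries (A i') ν c h j)} =
        {D | ∃ i', least (headNeighbors (A i') ν c C) = some D} := by
    intro C hC
    ext D
    refine exists_congr fun i' => ?_
    rw [mem_words]
    constructor
    · rintro ⟨C', -, heq⟩
      simp only [Sum.inr.injEq, Prod.mk.injEq] at heq
      rw [← heq.1]
      exact heq.2
    · intro hD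
      obtain ⟨-, -, e, he, h1, h2⟩ := (least_eq_some_iff.1 hD).1
      exact ⟨C, ⟨hC, e, he, .inl h1⟩, by rw [← hD]⟩
  have key2 : ∀ C, h C = j →
      (least {D | ∃ i', (.inr (C, some D) : ContractWord N b) ∈
        words (queries (A i') ν c h j)}).getD C = rename G ν c C := by
    intro C hC
    rw [key C hC, least_iUnion, ← headNeighbors_iUnion, ← hG, rename]
  ext w
  constructor
  · rintro ⟨C, o, hC, rfl⟩
    rw [mem_words] at hC
    obtain ⟨C', hC', heq⟩ := hC
    simp only [Sum.inr.injEq, Prod.mk.injEq] at heq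
    rw [heq.1] at hC'
    exact ⟨C, hC', by simp only; rw [key2 C hC'.1]⟩
  · rintro ⟨C, hC, rfl⟩
    refine ⟨C, least (headNeighbors (A i) ν c C), ?_, ?_⟩
    · rw [mem_words]
      exact ⟨C, hC, rfl⟩
    · rw [key2 C hC.1]

/-- A name that was asked for gets exactly one answer; a name without arcs at this machine gets none
and is kept, which `hr` declares correct. -/
theorem readReplies_eq {A : Set (Fin N × Fin N)} {ν₀ ν : Fin N → Fin N} {h : Fin N → Fin k}
    {x : Fin N} {r : Fin N → Fin N} (hr : (¬ ∃ e ∈ A, ν e.1 = ν₀ x ∨ ν e.2 = ν₀ x) → r (ν₀ x) = ν₀ x) :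
    readReplies (b := b) (fun j => words ((fun C => .inr (C, some (r C))) '' askedNames A ν h j))
      ν₀ x = r (ν₀ x) := by
  unfold readReplies
  by_cases hx : ∃ e ∈ A, ν e.1 = ν₀ x ∨ ν e.2 = ν₀ x
  · have : {D | ∃ j, (.inr (ν₀ x, some D) : ContractWord N b) ∈
        words ((fun C => .inr (C, some (r C))) '' askedNames A ν h j)} = {r (ν₀ x)} := by
      ext D
      constructor
      · rintro ⟨j, hj⟩
        rw [mem_words] at hj
        obtain ⟨C, -, heq⟩ := hj
        simp only [Sum.inr.injEq, Prod.mk.injEq, Option.some.injEq] at heq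
        rw [← heq.1]
        exact heq.2.symm
      · rintro rfl
        refine ⟨h (ν₀ x), ?_⟩
        rw [mem_words]
        exact ⟨ν₀ x, ⟨rfl, hx⟩, rfl⟩
    rw [this, least_eq_some_iff.2 isLeast_singleton]
    rfl
  · have : {D | ∃ j, (.inr (ν₀ x, some D) : ContractWord N b) ∈
        words ((fun C => .inr (C, some (r C))) '' askedNames A ν h j)} = ∅ := by
      rw [Set.eq_empty_iff_forall_notMem]
      rintro D ⟨j, hj⟩
      rw [mem_words] at hj
      obtain ⟨C, hC, heq⟩ := hj
      simp only [Sum.inr.injEq, Prod.mk.injEq, Option.some.injEq] at heq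
      rw [heq.1] at hC
      exact hx hC.2
    rw [this, least_eq_none_iff.2 rfl, hr hx]
    rfl

theorem card_summary_le (own : Set (Fin N)) (ν : Fin N → Fin N) :
    (words (summary (b := b) own ν)).card ≤ 2 := by
  classical
  rw [card_words]
  have h1 : ({C | IsLeast (ν '' own) C} : Set (Fin N)).ncard ≤ 1 :=
    (Set.ncard_le_one (Set.toFinite _)).2 fun a ha c hc => ha.unique hc
  have h2 : ({C | IsGreatest (ν '' own) C} : Set (Fin N)).ncard ≤ 1 :=
    (Set.ncard_le_one (Set.toFinite _)).2 fun a ha c hc => ha.unique hc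
  have hsub : summary (b := b) own ν ⊆ (fun C => .inr (C, none)) ''
      ({C | IsLeast (ν '' own) C} ∪ {C | IsGreatest (ν '' own) C}) := by
    rintro w ⟨C, hC, rfl⟩
    exact ⟨C, hC, rfl⟩
  have h3 := (Set.ncard_le_ncard hsub (Set.toFinite _)).trans (Set.ncard_image_le (Set.toFinite _))
  have h4 := Set.ncard_union_le {C | IsLeast (ν '' own) C} {C | IsGreatest (ν '' own) C}
  omega

/-- Equality of the least and the greatest name forces all names on a machine to be equal, so two
words per machine suffice. Machines without vertices send nothing and impose no condition. -/
theorem summary_agree_iff (own : Fin k → Set (Fin N)) (ν : Fin N → Fin N) :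
    (∀ i j C D o o', (.inr (C, o) : ContractWord N b) ∈ words (summary (own i) ν) →
      (.inr (D, o') : ContractWord N b) ∈ words (summary (own j) ν) → C = D) ↔
    ∀ i j, ∀ x ∈ own i, ∀ y ∈ own j, ν x = ν y := by
  constructor
  · intro H i j x hx y hy
    obtain ⟨a, ha⟩ := exists_isLeast (S := ν '' own i) ⟨ν x, x, hx, rfl⟩
    obtain ⟨d, hd⟩ := exists_isLeast (S := ν '' own j) ⟨ν y, y, hy, rfl⟩
    obtain ⟨a', ha', hamax⟩ := (Set.toFinite (ν '' own i)).exists_maximal ⟨ν x, x, hx, rfl⟩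
    obtain ⟨d', hd', hdmax⟩ := (Set.toFinite (ν '' own j)).exists_maximal ⟨ν y, y, hy, rfl⟩
    have ga : IsGreatest (ν '' own i) a' :=
      ⟨ha', fun z hz => (le_total z a').elim id fun h => hamax hz h⟩
    have gd : IsGreatest (ν '' own j) d' :=
      ⟨hd', fun z hz => (le_total z d').elim id fun h => hdmax hz h⟩
    have e1 : a = d := H i j a d none none (by simp only [mem_words]; exact ⟨a, .inl ha, rfl⟩)
      (by simp only [mem_words]; exact ⟨d, .inl hd, rfl⟩)
    have e2 : a = a' := H i i a a' none none (by simp only [mem_words]; exact ⟨a, .inl ha, rfl⟩)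
      (by simp only [mem_words]; exact ⟨a', .inr ga, rfl⟩)
    have e3 : d = d' := H j j d d' none none (by simp only [mem_words]; exact ⟨d, .inl hd, rfl⟩)
      (by simp only [mem_words]; exact ⟨d', .inr gd, rfl⟩)
    have hxa : ν x = a := le_antisymm (e2 ▸ ga.2 ⟨x, hx, rfl⟩) (ha.2 ⟨x, hx, rfl⟩)
    have hyd : ν y = d := le_antisymm (e3 ▸ gd.2 ⟨y, hy, rfl⟩) (hd.2 ⟨y, hy, rfl⟩)
    rw [hxa, hyd, e1]
  · intro H i j C D o o' hC hD
    rw [mem_words] at hC hD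
    obtain ⟨C', hC', heq⟩ := hC
    obtain ⟨D', hD', heq'⟩ := hD
    simp only [Sum.inr.injEq, Prod.mk.injEq] at heq heq'
    rw [heq.1, heq'.1]
    have h1 : C' ∈ ν '' own i := hC'.elim (fun h => h.1) fun h => h.1
    have h2 : D' ∈ ν '' own j := hD'.elim (fun h => h.1) fun h => h.1
    obtain ⟨x, hx, rfl⟩ := h1
    obtain ⟨y, hy, rfl⟩ := h2
    exact H i j x hx y hy

/-- The number of arcs. -/
noncomputable def arcCount (A : Set (Fin N × Fin N)) : Fin (N * N + 1) :=
  ⟨A.ncard, Nat.lt_succ_of_le ((Set.ncard_le_card A).trans_eq (by simp))⟩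

/-- The maximum number of arcs that leave a vertex. -/
noncomputable def arcDegree (A : Set (Fin N × Fin N)) : Fin (N + 1) :=
  ⟨Finset.univ.sup fun x => {y | (x, y) ∈ A}.ncard, Nat.lt_succ_of_le
    (Finset.sup_le fun x _ => (Set.ncard_le_card _).trans_eq (by simp))⟩

/-- The number of all arcs, as published. -/
def totalArcs (pub : Fin k → PubMsg N b) : ℕ := ∑ i, ((pub i).2.1 : ℕ)

/-- The maximum degree, as published. -/
def topDegree (pub : Fin k → PubMsg N b) : ℕ := Finset.univ.sup fun i => ((pub i).2.2 : ℕ)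

open Classical in
/-- The published message in an inbox. -/
noncomputable def readPub (s : Finset (ContractWord N b)) : PubMsg N b :=
  if h : ∃ x, .inl x ∈ s then h.choose else (fun _ => false, 0, 0)

theorem readPub_singleton (x : PubMsg N b) : readPub ({.inl x} : Finset (ContractWord N b)) = x := by
  have h : ∃ y, (.inl y : ContractWord N b) ∈ ({.inl x} : Finset (ContractWord N b)) :=
    ⟨x, Finset.mem_singleton_self _⟩
  rw [readPub, dif_pos h]
  exact Sum.inl.inj (Finset.mem_singleton.1 h.choose_spec)

end Messages

/-- The state of a machine in the contraction algorithm. -/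
structure ContractState (k N b : ℕ) where
  own : Set (Fin N)
  arcs : Set (Fin N × Fin N)
  seed : Fin b → Bool
  phase : ℕ
  pub : Fin k → PubMsg N b
  names : Fin N → Fin N
  inbox : Fin k → Finset (ContractWord N b)

/-- The arcs of kept edges that a machine knows. -/
def keptArcs {k N : ℕ} {E : Type} (keep : E → Bool) (X : MachineView k N E) :
    Set (Fin N × Fin N) :=
  {e | ∃ h d, (e.1, e.2, h, d) ∈ X.incident ∧ keep d = true}

/-- The capacity of the links. -/
def contractCap {k N b : ℕ} (cap : ℕ → ℕ → ℕ) (s : ContractState k N b) : ℕ :=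
  if s.phase = 0 then 1 else cap (totalArcs s.pub) (topDegree s.pub)

/-- The message to machine `j`: in the first phase the published data, in the last phase the least
and the greatest name, and in between queries and answers in turn. -/
noncomputable def contractSend {k N b : ℕ} (P : ℕ)
    (g : (Fin b → Bool) → (ℕ → Fin N → Bool) × (Fin N → Fin k)) (i₀ : Fin k)
    (s : ContractState k N b) (j : Fin k) : Finset (ContractWord N b) :=
  if s.phase = 0 then {.inl (s.seed, arcCount s.arcs, arcDegree s.arcs)}
  -- This phase number is odd, so it must be tested before the parity; the receiver stores the
  -- summaries in the inbox just like queries.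
  else if s.phase = 2 * P + 1 then words (summary s.own s.names)
  else if s.phase % 2 = 1 then
    words (queries s.arcs s.names ((g (s.pub i₀).1).1 (s.phase / 2)) (g (s.pub i₀).1).2 j)
  else words (replies s.inbox j)

/-- The update of the state. -/
noncomputable def contractRecv {k N b : ℕ} (s : ContractState k N b)
    (Z : Fin k → Finset (ContractWord N b)) : ContractState k N b :=
  if s.phase = 0 then { s with phase := 1, pub := fun j => readPub (Z j) }
  else if s.phase % 2 = 1 then { s with phase := s.phase + 1, inbox := Z }
  else { s with phase := s.phase + 1, names := readReplies Z s.names }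

/-- The data pass the check and all names agree. -/
def ContractState.Accepts {k N b : ℕ} (chk : ℕ → Bool) (s : ContractState k N b) : Prop :=
  chk (totalArcs s.pub / 2) = true ∧ ∀ i j C D o o', (.inr (C, o) : ContractWord N b) ∈ s.inbox i →
    (.inr (D, o') : ContractWord N b) ∈ s.inbox j → C = D

open Classical in
/-- The contraction algorithm.  It decides whether the graph of the kept edges is connected and
its number of edges passes a check.  The random coins and proxies are derived from the seed of
machine `i₀`. -/
noncomputable def contractPhased {k N b : ℕ} {E : Type} (P : ℕ) (keep : E → Bool) (chk : ℕ → Bool)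
    (cap : ℕ → ℕ → ℕ) (g : (Fin b → Bool) → (ℕ → Fin N → Bool) × (Fin N → Fin k)) (i₀ : Fin k) :
    Phased k N E Bool (ContractWord N b) where
  coins := b
  State := ContractState k N b
  phases := 2 * P + 2
  init _ X ω := ⟨X.own, keptArcs keep X, ω, 0, fun _ => (fun _ => false, 0, 0), id, fun _ => ∅⟩
  cap := contractCap cap
  send _ := contractSend P g i₀
  recv _ := contractRecv
  out _ s := decide (s.Accepts chk)

/-- What the machines publish. -/
noncomputable def published {n k N b : ℕ} {E : Type} (keep : E → Bool) (I : Input n N E)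
    (home : Fin n → Fin k) (ω : Fin k → Fin b → Bool) (i : Fin k) : PubMsg N b :=
  (ω i, arcCount (keptArcs keep (I.machineView home i)),
    arcDegree (keptArcs keep (I.machineView home i)))

/-! ### Analysis of a run of the contraction algorithm -/

section Run

variable {n k N b : ℕ} {E : Type} {P : ℕ} {keep : E → Bool} {chk : ℕ → Bool}
  {cap : ℕ → ℕ → ℕ} {g : (Fin b → Bool) → (ℕ → Fin N → Bool) × (Fin N → Fin k)} {i₀ : Fin k}
  {R : ℕ → Fin k → ContractState k N b}

/-- `R` is the run of the contraction algorithm. -/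
structure IsContractRun (P : ℕ) (keep : E → Bool) (cap : ℕ → ℕ → ℕ)
    (g : (Fin b → Bool) → (ℕ → Fin N → Bool) × (Fin N → Fin k)) (i₀ : Fin k)
    (I : Input n N E) (home : Fin n → Fin k) (ω : Fin k → Fin b → Bool)
    (R : ℕ → Fin k → ContractState k N b) : Prop where
  zero : ∀ i, R 0 i = ⟨(I.machineView home i).own, keptArcs keep (I.machineView home i), ω i, 0,
    fun _ => (fun _ => false, 0, 0), id, fun _ => ∅⟩
  succ : ∀ p i, R (p + 1) i = contractRecv (R p i) fun j =>
    truncate (contractCap cap (R p i)) (contractSend P g i₀ (R p j) i)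

theorem contractPhased_isRun (I : Input n N E) (home : Fin n → Fin k) (ω : Fin k → Fin b → Bool) :
    IsContractRun P keep cap g i₀ I home ω
      ((contractPhased P keep chk cap g i₀).run I home ω) :=
  ⟨fun _ => rfl, fun _ _ => rfl⟩

namespace IsContractRun

variable {I : Input n N E} {home : Fin n → Fin k} {ω : Fin k → Fin b → Bool}

/-- The parts of the states that do not depend on the communication after the first phase. -/
theorem static (hR : IsContractRun P keep cap g i₀ I home ω R) (p : ℕ) (i : Fin k) :
    (R p i).phase = p ∧ (R p i).own = (I.machineView home i).own ∧
      (R p i).arcs = keptArcs keep (I.machineView home i) ∧ (R p i).seed = ω i ∧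
      (0 < p → (R p i).pub = published keep I home ω) := by
  induction p generalizing i with
  | zero => rw [hR.zero]; exact ⟨rfl, rfl, rfl, rfl, fun h => absurd h (lt_irrefl 0)⟩
  | succ p ih =>
    obtain ⟨h1, h2, h3, h4, h5⟩ := ih i
    rw [hR.succ]
    by_cases hp : p = 0
    · subst hp
      rw [contractRecv, if_pos h1]
      refine ⟨rfl, h2, h3, h4, fun _ => ?_⟩
      funext j
      obtain ⟨g1, -, g3, g4, -⟩ := ih j
      simp only [contractSend, contractCap, if_pos h1, if_pos g1, g3, g4]
      rw [truncate_eq (by simp), readPub_singleton]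
      rfl
    · have h5' := h5 (Nat.pos_of_ne_zero hp)
      rw [contractRecv, if_neg (by rw [h1]; exact hp)]
      split_ifs <;> exact ⟨congrArg (· + 1) h1, h2, h3, h4, fun _ => h5'⟩

theorem cap_eq (hR : IsContractRun P keep cap g i₀ I home ω R) (p : ℕ) (i : Fin k) :
    contractCap cap (R p i) = if p = 0 then 1 else
      cap (totalArcs (published keep I home ω)) (topDegree (published keep I home ω)) := by
  obtain ⟨h1, -, -, -, h5⟩ := hR.static p i
  rw [contractCap, h1]
  split_ifs with h
  · rfl
  · rw [h5 (Nat.pos_of_ne_zero h)]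

/-- The names if no message exceeds the capacity. -/
theorem names_eq (hR : IsContractRun P keep cap g i₀ I home ω R) {G : SimpleGraph (Fin N)}
    (hG : arcs G = ⋃ i, keptArcs keep (I.machineView home i))
    (hown : ∀ i, ∀ x ∈ (I.machineView home i).own, ∀ y, G.Adj x y →
      (x, y) ∈ keptArcs keep (I.machineView home i))
    (hload : ∀ p < P, ∀ i j, (askedNames (keptArcs keep (I.machineView home i))
      (names G (g (ω i₀)).1 p) (g (ω i₀)).2 j).ncard ≤
        cap (totalArcs (published keep I home ω)) (topDegree (published keep I home ω)))
    {p : ℕ} (hp : p ≤ P) (i : Fin k) {x : Fin N} (hx : x ∈ (I.machineView home i).own ∨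
      ∃ e ∈ keptArcs keep (I.machineView home i), x = e.1 ∨ x = e.2) :
    (R (2 * p + 1) i).names x = names G (g (ω i₀)).1 p x := by
  set A : Fin k → Set (Fin N × Fin N) := fun i => keptArcs keep (I.machineView home i) with hA
  set κ := cap (totalArcs (published keep I home ω)) (topDegree (published keep I home ω)) with hκ
  induction p generalizing i x with
  | zero =>
    rw [mul_zero, names, hR.succ, contractRecv, if_pos (hR.static 0 i).1, hR.zero]
  | succ p ih =>
    have hpP : p < P := hp
    have ih := fun i x hx => ih hpP.le (i := i) (x := x) hx
    set c := (g (ω i₀)).1 with hc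
    set h := (g (ω i₀)).2 with hh
    set ν := names G c p with hν
    have hagree : ∀ i, ∀ e ∈ A i, (R (2 * p + 1) i).names e.1 = ν e.1 ∧
        (R (2 * p + 1) i).names e.2 = ν e.2 := fun i e he =>
      ⟨ih i _ (.inr ⟨e, he, .inl rfl⟩), ih i _ (.inr ⟨e, he, .inr rfl⟩)⟩
    have hasked : ∀ i j, (askedNames (A i) ν h j).ncard ≤ κ := fun i j => hload p hpP i j
    have hq : ∀ i j, contractSend P g i₀ (R (2 * p + 1) i) j =
        words (queries (A i) ν (c p) h j) := by
      intro i j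
      obtain ⟨h1, h2, h3, h4, h5⟩ := hR.static (2 * p + 1) i
      rw [contractSend, if_neg (by omega), if_neg (by omega), if_pos (by omega), h1, h3,
        h5 (by omega), show (2 * p + 1) / 2 = p by omega]
      change words (queries (A i) _ (c p) h j) = _
      unfold queries
      rw [askedNames_congr (hagree i)]
      congr 2
      funext C
      rw [headNeighbors_congr (hagree i)]
    have hstep1 : ∀ j, (R (2 * p + 2) j).inbox = (fun i => words (queries (A i) ν (c p) h j)) ∧
        (R (2 * p + 2) j).names = (R (2 * p + 1) j).names := by
      intro j
      have h1 := (hR.static (2 * p + 1) j).1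
      rw [hR.succ (2 * p + 1), hR.cap_eq, if_neg (by omega), contractRecv, if_neg (by omega),
        if_pos (by omega)]
      refine ⟨funext fun i => ?_, rfl⟩
      simp only
      rw [hq, truncate_eq]
      rw [card_words]
      exact (Set.ncard_image_le (Set.toFinite _)).trans (hasked i j)
    have hr : ∀ i j, contractSend P g i₀ (R (2 * p + 2) j) i =
        words ((fun C => .inr (C, some (rename G ν (c p) C))) '' askedNames (A i) ν h j) := by
      intro i j
      have h1 := (hR.static (2 * p + 2) j).1
      rw [contractSend, if_neg (by omega), if_neg (by omega), if_neg (by omega), (hstep1 j).1,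
        replies_eq hG]
    have hfin : (R (2 * (p + 1) + 1) i).names x = readReplies (b := b) (fun j =>
        words ((fun C => .inr (C, some (rename G ν (c p) C))) '' askedNames (A i) ν h j))
          (R (2 * p + 1) i).names x := by
      have h1 := (hR.static (2 * p + 2) i).1
      rw [show 2 * (p + 1) + 1 = 2 * p + 2 + 1 by ring, hR.succ (2 * p + 2), hR.cap_eq,
        if_neg (by omega), contractRecv, if_neg (by omega), if_neg (by omega)]
      simp only
      rw [(hstep1 i).2]
      congr 1
      funext j
      rw [hr, truncate_eq]
      rw [card_words]
      exact (Set.ncard_image_le (Set.toFinite _)).trans (hasked i j)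
    rw [hfin, readReplies_eq, ih i x hx]
    · rfl
    · rw [ih i x hx]
      intro hno
      rcases rename_eq_or G ν (c p) (ν x) with h' | ⟨-, -, e, he, h1, h2⟩
      · exact h'.2
      -- The name of `x` is at no arc of this machine, but some arc elsewhere would rename it. Since
      -- the machine knows all arcs at its own vertices, `x` is isolated; so its name is `x`, and an
      -- arc starting at a vertex of that name starts at `x`.
      · exfalso
        have hiso : ∀ y, ¬ G.Adj x y := by
          intro y hxy
          rcases hx with hx | ⟨e, he, rfl | rfl⟩
          · exact hno ⟨(x, y), hown i x hx y hxy, .inl rfl⟩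
          · exact hno ⟨e, he, .inl rfl⟩
          · exact hno ⟨e, he, .inr rfl⟩
        have hself : ∀ y, G.Reachable x y → y = x := by
          rintro y ⟨w⟩
          cases w with
          | nil => rfl
          | cons hadj _ => exact absurd hadj (hiso _)
        have hνx : ν x = x := hself _ (reachable_names G c p x)
        have he1 : e.1 = x := hself _ (by
          have := reachable_names G c p e.1
          rw [← hν, h1, hνx] at this
          exact this.symm)
        exact hiso e.2 (he1 ▸ he)

theorem accepts_iff (hR : IsContractRun P keep cap g i₀ I home ω R) {G : SimpleGraph (Fin N)}
    (hG : arcs G = ⋃ i, keptArcs keep (I.machineView home i))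
    (hown : ∀ i, ∀ x ∈ (I.machineView home i).own, ∀ y, G.Adj x y →
      (x, y) ∈ keptArcs keep (I.machineView home i))
    (hload : ∀ p < P, ∀ i j, (askedNames (keptArcs keep (I.machineView home i))
      (names G (g (ω i₀)).1 p) (g (ω i₀)).2 j).ncard ≤
        cap (totalArcs (published keep I home ω)) (topDegree (published keep I home ω)))
    (hcap : 2 ≤ cap (totalArcs (published keep I home ω)) (topDegree (published keep I home ω)))
    (hact : ¬ (activeNames G (names G (g (ω i₀)).1 P)).Nonempty) (i : Fin k) :
    (R (2 * P + 2) i).Accepts chk ↔ chk (totalArcs (published keep I home ω) / 2) = true ∧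
      ∀ u v, G.Reachable (I.ident u) (I.ident v) := by
  have hnames : ∀ j, summary (b := b) (I.machineView home j).own (R (2 * P + 1) j).names =
      summary (I.machineView home j).own (names G (g (ω i₀)).1 P) := by
    intro j
    unfold summary
    rw [Set.image_congr fun x hx => hR.names_eq hG hown hload le_rfl j (.inl hx)]
  have hinbox : (R (2 * P + 2) i).inbox = fun j =>
      words (summary (I.machineView home j).own (names G (g (ω i₀)).1 P)) := by
    have h1 := (hR.static (2 * P + 1) i).1
    rw [hR.succ (2 * P + 1), hR.cap_eq, if_neg (by omega), contractRecv, if_neg (by omega),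
      if_pos (by omega)]
    funext j
    obtain ⟨g1, g2, -⟩ := hR.static (2 * P + 1) j
    simp only [contractSend]
    rw [if_neg (by omega), if_pos g1, g2, hnames, truncate_eq ((card_summary_le _ _).trans hcap)]
  have hpub := (hR.static (2 * P + 2) i).2.2.2.2 (by omega)
  rw [ContractState.Accepts, hpub, hinbox, summary_agree_iff]
  refine and_congr_right fun _ => ⟨fun H u v => ?_, fun H i j x hx y hy => ?_⟩
  · rw [← names_eq_iff_reachable hact]
    exact H (home u) (home v) _ ⟨u, rfl, rfl⟩ _ ⟨v, rfl, rfl⟩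
  · obtain ⟨u, -, rfl⟩ := hx
    obtain ⟨v, -, rfl⟩ := hy
    rw [names_eq_iff_reachable hact]
    exact H u v

end IsContractRun

end Run

/-! ### The graph of the kept edges -/

section Kept

variable {n k N : ℕ} {E : Type}

/-- The graph formed by the edges that are kept. -/
def keptGraph (keep : E → Bool) (I : Input n N E) : SimpleGraph (Fin n) :=
  SimpleGraph.fromEdgeSet {e | e ∈ I.graph.edgeSet ∧ keep (I.label e) = true}

theorem keptGraph_adj {keep : E → Bool} {I : Input n N E} {u v : Fin n} :
    (keptGraph keep I).Adj u v ↔ I.graph.Adj u v ∧ keep (I.label s(u, v)) = true := by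
  simp only [keptGraph, SimpleGraph.fromEdgeSet_adj, Set.mem_ofPred_eq, SimpleGraph.mem_edgeSet]
  exact ⟨fun h => h.1, fun h => ⟨h, h.1.ne⟩⟩

theorem keptGraph_le (keep : E → Bool) (I : Input n N E) : keptGraph keep I ≤ I.graph :=
  fun _ _ h => (keptGraph_adj.1 h).1

theorem keptArcs_eq (keep : E → Bool) (I : Input n N E) (home : Fin n → Fin k) (i : Fin k) :
    keptArcs keep (I.machineView home i) = Prod.map I.ident I.ident ''
      {e : Fin n × Fin n | home e.1 = i ∧ (keptGraph keep I).Adj e.1 e.2} := by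
  ext ⟨x, y⟩
  constructor
  · rintro ⟨h, d, ⟨u, v, hu, huv, heq⟩, hd⟩
    simp only [Prod.mk.injEq] at heq
    obtain ⟨rfl, rfl, rfl, rfl⟩ := heq
    exact ⟨(u, v), ⟨hu, keptGraph_adj.2 ⟨huv, hd⟩⟩, rfl⟩
  · rintro ⟨⟨u, v⟩, ⟨hu, huv⟩, heq⟩
    simp only [Prod.map_apply, Prod.mk.injEq] at heq
    obtain ⟨rfl, rfl⟩ := heq
    exact ⟨home v, _, ⟨u, v, hu, (keptGraph_adj.1 huv).1, rfl⟩, (keptGraph_adj.1 huv).2⟩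

theorem arcs_keptGraph (keep : E → Bool) (I : Input n N E) (home : Fin n → Fin k) :
    arcs ((keptGraph keep I).map I.ident) = ⋃ i, keptArcs keep (I.machineView home i) := by
  ext ⟨x, y⟩
  simp only [Set.mem_iUnion, keptArcs_eq]
  constructor
  · intro h
    obtain ⟨u, v, huv, rfl, rfl⟩ := (SimpleGraph.map_adj _ _ _ _).1 h
    exact ⟨home u, (u, v), ⟨rfl, huv⟩, rfl⟩
  · rintro ⟨i, ⟨u, v⟩, ⟨-, huv⟩, heq⟩
    simp only [Prod.map_apply, Prod.mk.injEq] at heq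
    obtain ⟨rfl, rfl⟩ := heq
    exact (SimpleGraph.map_adj _ _ _ _).2 ⟨u, v, huv, rfl, rfl⟩

theorem mem_keptArcs_of_own (keep : E → Bool) (I : Input n N E) (home : Fin n → Fin k) (i : Fin k)
    (x : Fin N) (hx : x ∈ (I.machineView home i).own) (y : Fin N)
    (h : ((keptGraph keep I).map I.ident).Adj x y) :
    (x, y) ∈ keptArcs keep (I.machineView home i) := by
  obtain ⟨u, v, huv, rfl, rfl⟩ := (SimpleGraph.map_adj _ _ _ _).1 h
  obtain ⟨u', hu', heq⟩ := hx
  rw [I.ident.injective heq] at hu'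
  rw [keptArcs_eq]
  exact ⟨(u, v), ⟨hu', huv⟩, rfl⟩

/-- The degree of a vertex. -/
noncomputable def deg (G : SimpleGraph (Fin n)) (u : Fin n) : ℕ := (G.neighborSet u).ncard

theorem ncard_keptArcs (keep : E → Bool) (I : Input n N E) (home : Fin n → Fin k) (i : Fin k) :
    (keptArcs keep (I.machineView home i)).ncard =
      ∑ u with home u = i, deg (keptGraph keep I) u := by
  classical
  rw [keptArcs_eq, Set.ncard_image_of_injective _
    (I.ident.injective.prodMap I.ident.injective)]
  have h1 : {e : Fin n × Fin n | home e.1 = i ∧ (keptGraph keep I).Adj e.1 e.2} =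
      ((Finset.univ.filter fun u => home u = i).biUnion fun u =>
        ((keptGraph keep I).neighborSet u).toFinset.image fun v => (u, v) :
        Finset (Fin n × Fin n)) := by
    ext ⟨u, v⟩
    simp [and_comm]
  rw [h1, Set.ncard_coe_finset, Finset.card_biUnion]
  · refine Finset.sum_congr rfl fun u _ => ?_
    rw [Finset.card_image_of_injective _ (Prod.mk_right_injective u), deg,
      Set.ncard_eq_toFinset_card']
  · intro u _ v _ huv
    rw [Function.onFun, Finset.disjoint_left]
    intro e he he'
    simp only [Finset.mem_image] at he he'
    obtain ⟨_, _, rfl⟩ := he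
    obtain ⟨_, _, h⟩ := he'
    exact huv (Prod.ext_iff.1 h).1.symm

/-- Each kept edge is counted once at the home of either end, even if the homes coincide. Thus the
capacity is independent of partition and coins, and the machines learn the number of edges exactly.
-/
theorem totalArcs_published {b : ℕ} (keep : E → Bool) (I : Input n N E) (home : Fin n → Fin k)
    (ω : Fin k → Fin b → Bool) :
    totalArcs (published keep I home ω) = 2 * numEdges (keptGraph keep I) := by
  classical
  change ∑ i, (keptArcs keep (I.machineView home i)).ncard = _
  simp only [ncard_keptArcs]
  rw [Finset.sum_fiberwise, numEdges, Set.ncard_eq_toFinset_card', ← SimpleGraph.edgeFinset,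
    ← SimpleGraph.sum_degrees_eq_twice_card_edges]
  refine Finset.sum_congr rfl fun u _ => ?_
  rw [deg, Set.ncard_eq_toFinset_card']
  rfl

theorem topDegree_published {b : ℕ} (keep : E → Bool) (I : Input n N E) (home : Fin n → Fin k)
    (ω : Fin k → Fin b → Bool) : topDegree (published keep I home ω) =
      Finset.univ.sup (deg (keptGraph keep I)) := by
  have hdeg : ∀ u, {y | (I.ident u, y) ∈ keptArcs keep (I.machineView home (home u))}.ncard =
      deg (keptGraph keep I) u := by
    intro u
    rw [deg, ← Set.ncard_image_of_injective _ I.ident.injective]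
    congr 1
    ext y
    simp only [keptArcs_eq]
    constructor
    · rintro ⟨⟨u', v⟩, ⟨-, huv⟩, heq⟩
      simp only [Prod.map_apply, Prod.mk.injEq, EmbeddingLike.apply_eq_iff_eq] at heq
      obtain ⟨rfl, rfl⟩ := heq
      exact ⟨v, huv, rfl⟩
    · rintro ⟨v, huv, rfl⟩
      exact ⟨(u, v), ⟨rfl, huv⟩, rfl⟩
  apply le_antisymm
  · refine Finset.sup_le fun i _ => ?_
    change (Finset.univ.sup fun x =>
      {y | (x, y) ∈ keptArcs keep (I.machineView home i)}.ncard) ≤ _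
    refine Finset.sup_le fun x _ => ?_
    by_cases hx : ∃ u, home u = i ∧ I.ident u = x
    · obtain ⟨u, rfl, rfl⟩ := hx
      rw [hdeg]
      exact Finset.le_sup (Finset.mem_univ u)
    · rw [Set.ncard_eq_zero (Set.toFinite _) |>.2]
      · exact Nat.zero_le _
      · rw [Set.eq_empty_iff_forall_notMem]
        intro y hy
        change (x, y) ∈ keptArcs keep (I.machineView home i) at hy
        rw [keptArcs_eq] at hy
        obtain ⟨⟨u, v⟩, ⟨hu, -⟩, heq⟩ := hy
        exact hx ⟨u, hu, (Prod.ext_iff.1 heq).1⟩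
  · refine Finset.sup_le fun u _ => ?_
    rw [← hdeg]
    refine le_trans ?_ (Finset.le_sup (f := fun i => ((published keep I home ω i).2.2 : ℕ))
      (Finset.mem_univ (home u)))
    exact Finset.le_sup (f := fun x =>
      {y | (x, y) ∈ keptArcs keep (I.machineView home (home u))}.ncard) (Finset.mem_univ (I.ident u))

theorem sup_deg_le_maxDeg {G H : SimpleGraph (Fin n)} (h : H ≤ G) :
    Finset.univ.sup (deg H) ≤ maxDeg G := by
  classical
  refine Finset.sup_le fun u _ => ?_
  have h1 : deg H u ≤ (G.neighborSet u).ncard :=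
    Set.ncard_le_ncard (fun v hv => h hv) (Set.toFinite _)
  refine h1.trans ?_
  unfold maxDeg
  rw [Set.ncard_eq_toFinset_card']
  convert! G.degree_le_maxDegree u

theorem one_le_diameter {G : SimpleGraph (Fin n)} {u v : Fin n} (h : G.Adj u v) :
    1 ≤ diameter G := by
  rw [← SimpleGraph.dist_eq_one_iff_adj.2 h]
  exact Finset.le_sup (f := fun p : Fin n × Fin n => G.dist p.1 p.2) (Finset.mem_univ (u, v))

end Kept

/-! ### Loads -/

section Loads

variable {k N : ℕ}

/-- All names at the ends of the arcs in `A`. -/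
def endNames (A : Set (Fin N × Fin N)) (ν : Fin N → Fin N) : Set (Fin N) :=
  {C | ∃ e ∈ A, ν e.1 = C ∨ ν e.2 = C}

theorem ncard_endNames_le (A : Set (Fin N × Fin N)) (ν : Fin N → Fin N) :
    (endNames A ν).ncard ≤ 2 * A.ncard := by
  have hsub : endNames A ν ⊆ (fun e => ν e.1) '' A ∪ (fun e => ν e.2) '' A := by
    rintro C ⟨e, he, h | h⟩
    · exact .inl ⟨e, he, h⟩
    · exact .inr ⟨e, he, h⟩
  have h1 := Set.ncard_le_ncard hsub (Set.toFinite _)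
  have h2 := Set.ncard_union_le ((fun e => ν e.1) '' A) ((fun e => ν e.2) '' A)
  have h3 := Set.ncard_image_le (f := fun e : Fin N × Fin N => ν e.1) (Set.toFinite A)
  have h4 := Set.ncard_image_le (f := fun e : Fin N × Fin N => ν e.2) (Set.toFinite A)
  omega

/-- The names are fixed here and their proxies are independent, so each link receives about a `1/k`
share. -/
theorem prob_askedNames_le (A : Set (Fin N × Fin N)) (ν : Fin N → Fin N) (j : Fin k) {μ s κ : ℕ}
    (hμ : (endNames A ν).ncard ≤ μ) (hκ : 2 * (μ / k + 1) + s ≤ κ) :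
    (prob fun h : Fin N → Fin k => κ < (askedNames A ν h j).ncard) ≤ (1 / 2) ^ s := by
  classical
  have hk : 0 < k := Nat.pos_of_ne_zero fun h => by subst h; exact j.elim0
  refine (prob_mono fun h hh => ?_).trans (prob_heavy_le j
    (fun C => if C ∈ endNames A ν then (1 : ℝ) else 0) (fun C => by positivity)
    (fun C => by split_ifs <;> norm_num) s)
  have h1 : ∑ C, (if C ∈ endNames A ν then (1 : ℝ) else 0) = (endNames A ν).ncard := by
    rw [Finset.sum_boole, Set.ncard_eq_toFinset_card', Nat.cast_inj]
    congr 1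
    ext C
    simp
  have h2 : ∑ C with h C = j, (if C ∈ endNames A ν then (1 : ℝ) else 0) =
      (askedNames A ν h j).ncard := by
    rw [Finset.sum_boole, Set.ncard_eq_toFinset_card', Nat.cast_inj, Finset.filter_filter]
    congr 1
    ext C
    simp only [Finset.mem_filter, Finset.mem_univ, true_and, Set.mem_toFinset]
    rfl
  rw [h1, h2]
  have h3 : ((endNames A ν).ncard : ℝ) / k ≤ (μ / k : ℕ) + 1 := by
    rw [div_le_iff₀ (by exact_mod_cast hk)]
    exact_mod_cast hμ.trans ((Nat.lt_div_mul_add hk).le.trans_eq (by ring))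
  have h4 : (2 : ℝ) * ((μ / k : ℕ) + 1) + s ≤ κ := by exact_mod_cast hκ
  have h5 : (κ : ℝ) < (askedNames A ν h j).ncard := by exact_mod_cast hh
  rw [mul_div_assoc]
  linarith

theorem arcs_injective : Function.Injective (arcs (N := N)) := by
  intro G H h
  ext x y
  exact iff_of_eq (congrArg (fun S : Set (Fin N × Fin N) => (x, y) ∈ S) h)

/-- The randomness fails: some names are still active at the end, or some load is too large. -/
def Fails (P κ : ℕ) (G : SimpleGraph (Fin N)) (A : Fin k → Set (Fin N × Fin N))
    (σ : (ℕ → Fin N → Bool) × (Fin N → Fin k)) : Prop :=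
  (activeNames G (names G σ.1 P)).Nonempty ∨
    ∃ (p : Fin P) (i j : Fin k), κ < (askedNames (A i) (names G σ.1 p) σ.2 j).ncard

/-- The names depend on the coins only, so after conditioning on the coins the proxies are still
uniform. Hence one choice of proxies serves all phases. -/
theorem prob_fails_le {P κ μ s : ℕ} {G : SimpleGraph (Fin N)} {A : Fin k → Set (Fin N × Fin N)}
    (hμ : ∀ i ν, (endNames (A i) ν).ncard ≤ μ) (hκ : 2 * (μ / k + 1) + s ≤ κ) :
    (prob fun σ : (Fin P → Fin N → Bool) × (Fin N → Fin k) =>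
      Fails P κ G A (extendSeq (fun _ => false) σ.1, σ.2)) ≤
      (3 / 4) ^ P * N + P * k * k * (1 / 2) ^ s := by
  change (prob fun σ : (Fin P → Fin N → Bool) × (Fin N → Fin k) =>
    (activeNames G (names G (extendSeq (fun _ => false) σ.1) P)).Nonempty ∨
      ∃ (p : Fin P) (i j : Fin k), κ < (askedNames (A i)
        (names G (extendSeq (fun _ => false) σ.1) p) σ.2 j).ncard) ≤ _
  refine (prob_or_le (fun σ : (Fin P → Fin N → Bool) × (Fin N → Fin k) =>
    (activeNames G (names G (extendSeq (fun _ => false) σ.1) P)).Nonempty) _).trans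
    (add_le_add ?_ ?_)
  · exact (prob_fst_le fun c : Fin P → Fin N → Bool =>
      (activeNames G (names G (extendSeq (fun _ => false) c) P)).Nonempty).trans
      (prob_activeNames_le G _ P)
  · refine (prob_prod_le (p := fun (c : Fin P → Fin N → Bool) (h : Fin N → Fin k) =>
      ∃ (p : Fin P) (i j : Fin k), κ < (askedNames (A i)
        (names G (extendSeq (fun _ => false) c) p) h j).ncard) (q := fun _ => False)
      (ε := P * k * k * (1 / 2) ^ s) (by positivity) fun c _ => ?_).trans_eq ?_
    · refine (prob_mono (q := fun h => ∃ x : Fin P × Fin k × Fin k, κ < (askedNames (A x.2.1)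
        (names G (extendSeq (fun _ => false) c) x.1) h x.2.2).ncard) ?_).trans
        ((prob_exists_le _).trans ((Finset.sum_le_sum fun x _ =>
          prob_askedNames_le (A x.2.1) _ x.2.2 (hμ _ _) hκ).trans_eq ?_))
      · rintro h ⟨p, i, j, hpij⟩
        exact ⟨(p, i, j), hpij⟩
      · simp [mul_assoc]
    · simp [prob]

/-- A bound for the number of arcs at a machine. -/
def arcBound (k s m₂ Δ : ℕ) : ℕ := 2 * (m₂ / k + 1) + Δ * s

/-- Degrees are divided by the maximum degree to fit the unit interval; scaling back turns the
deviation `s` into `Δ * s`. -/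
theorem prob_heavy_machine_le {n : ℕ} (d : Fin n → ℕ) (i : Fin k) (s : ℕ) :
    (prob fun home : Fin n → Fin k => arcBound k s (∑ u, d u) (Finset.univ.sup d) <
      ∑ u with home u = i, d u) ≤ (1 / 2) ^ s := by
  classical
  have hk : 0 < k := Nat.pos_of_ne_zero fun h => by subst h; exact i.elim0
  set Δ := Finset.univ.sup d with hΔ
  have hd : ∀ u, d u ≤ Δ := fun u => Finset.le_sup (Finset.mem_univ u)
  by_cases h0 : Δ = 0
  · refine le_trans (le_of_eq ?_) (by positivity : (0 : ℝ) ≤ (1 / 2) ^ s)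
    have hd0 : ∀ u, d u = 0 := fun u => Nat.le_zero.1 (h0 ▸ hd u)
    simp [prob, hd0]
  have hpos : (0 : ℝ) < Δ := by exact_mod_cast Nat.pos_of_ne_zero h0
  refine (prob_mono fun home h => ?_).trans (prob_heavy_le i (fun u => (d u : ℝ) / Δ)
    (fun u => by positivity) (fun u => ?_) s)
  · rw [← Finset.sum_div, ← Finset.sum_div, le_div_iff₀ hpos, add_mul, ← mul_div_assoc,
      div_mul_eq_mul_div, div_mul_cancel₀ _ hpos.ne']
    have h1 : ((∑ u, d u : ℕ) : ℝ) / k ≤ ((∑ u, d u) / k : ℕ) + 1 := by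
      rw [div_le_iff₀ (by exact_mod_cast hk)]
      exact_mod_cast (Nat.lt_div_mul_add hk).le.trans_eq (by ring)
    have h2 : ((arcBound k s (∑ u, d u) Δ : ℕ) : ℝ) ≤ (∑ u with home u = i, d u : ℕ) := by
      exact_mod_cast h.le
    rw [arcBound] at h2
    push_cast at h1 h2
    rw [mul_div_assoc]
    linarith
  · rw [div_le_one hpos]
    exact_mod_cast hd u

/-- The capacity of the links. -/
def linkCap (n k s s' m₂ Δ : ℕ) : ℕ := 2 * (min n (2 * arcBound k s m₂ Δ) / k + 1) + s'

/-- The arc sets of the machines, if they are balanced. -/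
def Balanced (n s : ℕ) (A : Fin k → Set (Fin N × Fin N)) (m₂ Δ : ℕ) : Prop :=
  (∃ S : Set (Fin N), S.ncard ≤ n ∧ ∀ i, ∀ e ∈ A i, e.1 ∈ S ∧ e.2 ∈ S) ∧
    ∀ i, (A i).ncard ≤ arcBound k s m₂ Δ

theorem Balanced.ncard_endNames_le {n s m₂ Δ : ℕ} {A : Fin k → Set (Fin N × Fin N)}
    (h : Balanced n s A m₂ Δ) (i : Fin k) (ν : Fin N → Fin N) :
    (endNames (A i) ν).ncard ≤ min n (2 * arcBound k s m₂ Δ) := by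
  obtain ⟨⟨S, hS, hA⟩, hb⟩ := h
  refine le_min ?_ ((KMachine.ncard_endNames_le _ _).trans (Nat.mul_le_mul_left 2 (hb i)))
  have hsub : endNames (A i) ν ⊆ ν '' S := by
    rintro C ⟨e, he, rfl | rfl⟩
    · exact ⟨_, (hA i e he).1, rfl⟩
    · exact ⟨_, (hA i e he).2, rfl⟩
  exact (Set.ncard_le_ncard hsub (Set.toFinite _)).trans
    ((Set.ncard_image_le (Set.toFinite _)).trans hS)

/-- Few random bits suffice to draw coins and proxies that are good for all balanced inputs. -/
theorem exists_seed_function {n s s' P b : ℕ} (hn : 0 < n) [Nonempty (Fin k)]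
    (hε : (3 / 4 : ℝ) ^ P * N + P * k * k * (1 / 2) ^ s' ≤ 1 / (16 * n))
    (hb : 4 * n * (k * (N * N) + 1) ≤ 2 ^ b) (M D : (Fin k → Set (Fin N × Fin N)) → ℕ) :
    ∃ g : (Fin b → Bool) → (ℕ → Fin N → Bool) × (Fin N → Fin k),
      ∀ (G : SimpleGraph (Fin N)) (A : Fin k → Set (Fin N × Fin N)), arcs G = ⋃ i, A i →
        Balanced n s A (M A) (D A) → (prob fun y => Fails P (linkCap n k s s' (M A) (D A)) G A (g y)) ≤
          1 / (2 * n) := by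
  classical
  -- The inputs of the derandomization are the arc families, which encode graph and partition
  -- together. The arcs determine `G`, and an unbalanced family is never bad.
  let bad : (Fin k → Set (Fin N × Fin N)) → (Fin P → Fin N → Bool) × (Fin N → Fin k) → Prop :=
    fun A σ => ∃ G, arcs G = ⋃ i, A i ∧ Balanced n s A (M A) (D A) ∧
      Fails P (linkCap n k s s' (M A) (D A)) G A (extendSeq (fun _ => false) σ.1, σ.2)
  have hbad : ∀ A, prob (bad A) ≤ 1 / (16 * n) := by
    intro A
    by_cases h : ∃ G, arcs G = ⋃ i, A i ∧ Balanced n s A (M A) (D A)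
    · obtain ⟨G, hG, hA⟩ := h
      refine (prob_mono fun σ hσ => ?_).trans
        ((prob_fails_le (G := G) hA.ncard_endNames_le le_rfl).trans hε)
      obtain ⟨G', hG', -, hf⟩ := hσ
      rwa [arcs_injective (hG'.trans hG.symm)] at hf
    · refine le_trans (le_of_eq ?_) (by positivity : (0 : ℝ) ≤ 1 / (16 * n))
      have : ∀ σ, ¬ bad A σ := fun σ ⟨G, h1, h2, _⟩ => h ⟨G, h1, h2⟩
      simp [prob, this]
  have hcard : Fintype.card (Fin k → Set (Fin N × Fin N)) < 2 ^ (k * (N * N) + 1) := by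
    rw [Fintype.card_fun, Fintype.card_set, Fintype.card_prod, Fintype.card_fin, Fintype.card_fin,
      ← pow_mul, mul_comm (N * N)]
    exact Nat.pow_lt_pow_right one_lt_two (Nat.lt_succ_self _)
  obtain ⟨g, hg⟩ := exists_derandomization (Y := Fin b → Bool) bad hn hbad hcard
    (by rwa [Fintype.card_fun, Fintype.card_bool, Fintype.card_fin])
  exact ⟨fun y => (extendSeq (fun _ => false) (g y).1, (g y).2), fun G A hG hA =>
    (prob_mono fun y hy => ⟨G, hG, hA, hy⟩).trans (hg A)⟩

end Loads

/-! ### Connectivity -/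

section Parameters

variable {n k N c : ℕ}

theorem failure_bound (hn : 2 ≤ n) (hkn : k ≤ n) (hN : N ≤ n ^ c) :
    (3 / 4 : ℝ) ^ (3 * ((c + 1) * digits n + 5)) * N +
      (3 * ((c + 1) * digits n + 5) : ℕ) * k * k * (1 / 2) ^ ((3 * c + 27) * digits n) ≤
        1 / (16 * n) := by
  set L := digits n with hL
  have hL1 : 1 ≤ L := digits_pos n
  have hn' : (0 : ℝ) < n := by exact_mod_cast (by omega : 0 < n)
  have hN' : (N : ℝ) ≤ 2 ^ (c * L) := by exact_mod_cast le_two_pow_of_le_pow hN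
  have hk' : (k : ℝ) ≤ n := by exact_mod_cast hkn
  have h1 : (1 / 2 : ℝ) ^ (1 * L) ≤ (1 / n) ^ 1 := one_half_pow_digits_le hn 1
  have h3 : (1 / 2 : ℝ) ^ (3 * L) ≤ (1 / n) ^ 3 := one_half_pow_digits_le hn 3
  -- Three phases halve the expectation, as `(3/4)^3 ≤ 1/2`. The exponent pays `c L` for `N`, `L`
  -- for `1/n` and 5 for `1/32`.
  have e1 : (3 / 4 : ℝ) ^ (3 * ((c + 1) * L + 5)) * N ≤ 1 / (32 * n) := by
    calc (3 / 4 : ℝ) ^ (3 * ((c + 1) * L + 5)) * N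
        ≤ (1 / 2) ^ ((c + 1) * L + 5) * 2 ^ (c * L) := by
          rw [pow_mul]
          gcongr
          norm_num
      _ = ((1 / 2) ^ (c * L) * 2 ^ (c * L)) * (1 / 2) ^ (1 * L) * (1 / 2) ^ 5 := by ring
      _ = (1 / 2) ^ (1 * L) * (1 / 2) ^ 5 := by rw [← mul_pow]; norm_num
      _ ≤ (1 / n) ^ 1 * (1 / 2) ^ 5 := by gcongr
      _ = 1 / (32 * n) := by field_simp; norm_num
  have hP : ((3 * ((c + 1) * L + 5) : ℕ) : ℝ) ≤ 2 ^ ((3 * c + 18) * L) := by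
    have h5 : 3 * ((c + 1) * L + 5) ≤ (3 * c + 18) * L := by nlinarith
    exact_mod_cast h5.trans Nat.lt_two_pow_self.le
  -- Here `3c + 27` splits into `3c + 18` for the number of phases, 3 to turn `k ^ 2 ≤ n ^ 2` into
  -- `1/n`, and 6 for `1/32`.
  have e2 : (3 * ((c + 1) * L + 5) : ℕ) * k * k * (1 / 2 : ℝ) ^ ((3 * c + 27) * L) ≤
      1 / (32 * n) := by
    calc (3 * ((c + 1) * L + 5) : ℕ) * k * k * (1 / 2 : ℝ) ^ ((3 * c + 27) * L)
        ≤ 2 ^ ((3 * c + 18) * L) * n * n * (1 / 2 : ℝ) ^ ((3 * c + 27) * L) := by gcongr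
      _ = (2 ^ ((3 * c + 18) * L) * (1 / 2 : ℝ) ^ ((3 * c + 18) * L)) * n * n *
            (1 / 2) ^ (3 * L) * (1 / 2) ^ (6 * L) := by ring
      _ = n * n * (1 / 2) ^ (3 * L) * (1 / 2) ^ (6 * L) := by rw [← mul_pow]; norm_num
      _ ≤ n * n * (1 / n) ^ 3 * (1 / 2) ^ 5 := by
          have h5 : (1 / 2 : ℝ) ^ (6 * L) ≤ (1 / 2) ^ 5 :=
            pow_le_pow_of_le_one (by norm_num) (by norm_num) (by omega)
          gcongr
      _ = 1 / (32 * n) := by field_simp; norm_num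
  have e3 : (1 : ℝ) / (16 * n) = 1 / (32 * n) + 1 / (32 * n) := by field_simp; norm_num
  rw [e3]
  exact add_le_add e1 e2

theorem seed_bound (hkn : k ≤ n) (hN : N ≤ n ^ c) :
    4 * n * (k * (N * N) + 1) ≤ 2 ^ ((2 * c + 2) * digits n + 3) := by
  set L := digits n with hL
  have hN' : N ≤ 2 ^ (c * L) := le_two_pow_of_le_pow hN
  have hn2 : n ≤ 2 ^ L := (lt_two_pow_digits n).le
  have h1 : k * (N * N) ≤ 2 ^ L * (2 ^ (c * L) * 2 ^ (c * L)) :=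
    Nat.mul_le_mul (hkn.trans hn2) (Nat.mul_le_mul hN' hN')
  have h2 : 0 < 2 ^ L * (2 ^ (c * L) * 2 ^ (c * L)) := by positivity
  calc 4 * n * (k * (N * N) + 1) ≤ 4 * 2 ^ L * (2 ^ L * (2 ^ (c * L) * 2 ^ (c * L)) +
        2 ^ L * (2 ^ (c * L) * 2 ^ (c * L))) :=
        Nat.mul_le_mul (Nat.mul_le_mul_left 4 hn2) (Nat.add_le_add h1 h2)
    _ = _ := by ring

theorem card_contractWord_lt {b : ℕ} (hN : N ≤ n ^ c) :
    Fintype.card (ContractWord N b) < 2 ^ (b + 3 * c * digits n + 4) := by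
  set L := digits n with hL
  have hN' : N ≤ 2 ^ (c * L) := le_two_pow_of_le_pow hN
  have hcard : Fintype.card (ContractWord N b) =
      2 ^ b * ((N * N + 1) * (N + 1)) + N * (N + 1) := by
    simp [ContractWord, PubMsg]
  have hX : 1 ≤ 2 ^ (c * L) := Nat.one_le_two_pow
  have hB : 1 ≤ 2 ^ b := Nat.one_le_two_pow
  have hpow : 2 ^ (b + 3 * c * L + 4) = 16 * (2 ^ b * (2 ^ (c * L)) ^ 3) := by ring
  rw [hcard, hpow]
  set X := 2 ^ (c * L)
  set B := 2 ^ b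
  have h1 : (N * N + 1) * (N + 1) ≤ 4 * X ^ 3 :=
    calc (N * N + 1) * (N + 1) ≤ (X * X + X * X) * (X + X) := by gcongr; nlinarith
      _ = 4 * X ^ 3 := by ring
  have h2 : N * (N + 1) ≤ 2 * X ^ 3 :=
    calc N * (N + 1) ≤ X * (X + X) := by gcongr
      _ = 2 * (X ^ 2 * 1) := by ring
      _ ≤ 2 * (X ^ 2 * X) := by gcongr
      _ = 2 * X ^ 3 := by ring
  have h3 : 0 < B * X ^ 3 := by positivity
  have h4 : X ^ 3 ≤ B * X ^ 3 := Nat.le_mul_of_pos_left _ hB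
  have h5 := Nat.mul_le_mul_left B h1
  have h6 : B * (4 * X ^ 3) = 4 * (B * X ^ 3) := by ring
  omega

/-- The capacity is of order `min(n/k, m/k² + Δ/k)` up to logarithms, and `Δ/k ≤ D⌈Δ/k⌉`: if `H` has
an edge then `D ≥ 1`, and otherwise its maximum degree is 0. All parameters of `H` are bounded by
those of `G`. -/
theorem linkCap_le (hk : 2 ≤ k) {G H : SimpleGraph (Fin n)} (h : H ≤ G) :
    (linkCap n k (3 * digits n) ((3 * c + 27) * digits n) (2 * numEdges H)
      (Finset.univ.sup (deg H)) : ℝ) ≤ (3 * c + 45) * digits n * (connBound k G + 1) := by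
  set L := digits n with hL
  set Δ := Finset.univ.sup (deg H) with hΔ
  have hk' : (2 : ℝ) ≤ k := by exact_mod_cast hk
  have hk0 : (0 : ℝ) < k := by linarith
  have hL1 : (1 : ℝ) ≤ L := by exact_mod_cast digits_pos n
  have hm : (numEdges H : ℝ) ≤ numEdges G := by
    exact_mod_cast Set.ncard_le_ncard (SimpleGraph.edgeSet_mono h) (Set.toFinite _)
  have hD : (Δ : ℝ) / k ≤ diameter G * (⌈(maxDeg G : ℝ) / k⌉₊ : ℝ) := by
    have h1 : (Δ : ℝ) / k ≤ (⌈(maxDeg G : ℝ) / k⌉₊ : ℝ) := by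
      refine le_trans ?_ (Nat.le_ceil _)
      gcongr
      exact sup_deg_le_maxDeg h
    by_cases hG : ∃ u v, H.Adj u v
    · obtain ⟨u, v, huv⟩ := hG
      have h2 : (1 : ℝ) ≤ diameter G := by exact_mod_cast one_le_diameter (h huv)
      exact h1.trans (le_mul_of_one_le_left (by positivity) h2)
    · have h2 : Δ = 0 := by
        refine Nat.le_zero.1 (Finset.sup_le fun u _ => ?_)
        rw [deg, Set.ncard_eq_zero (Set.toFinite _) |>.2]
        exact Set.eq_empty_iff_forall_notMem.2 fun v hv => hG ⟨u, v, hv⟩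
      rw [h2, Nat.cast_zero, zero_div]
      positivity
  have hx0 : 0 ≤ connBound k G := le_min (by positivity) (by positivity)
  have harc : ((2 * arcBound k (3 * L) (2 * numEdges H) Δ : ℕ) : ℝ) / k ≤
      8 * L * ((numEdges G : ℝ) / (k : ℝ) ^ 2 + diameter G * (⌈(maxDeg G : ℝ) / k⌉₊ : ℝ) + 1) := by
    have h1 : ((2 * numEdges H / k : ℕ) : ℝ) ≤ 2 * numEdges G / k :=
      Nat.cast_div_le.trans (by push_cast; gcongr)
    have h2 : (4 : ℝ) / k ≤ 2 := by rw [div_le_iff₀ hk0]; linarith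
    rw [arcBound]
    push_cast
    calc 2 * (2 * (((2 * numEdges H / k : ℕ) : ℝ) + 1) + Δ * (3 * L)) / (k : ℝ)
        ≤ 2 * (2 * (2 * numEdges G / k + 1) + Δ * (3 * L)) / k := by gcongr
      _ = 8 * (numEdges G / (k : ℝ) ^ 2) + 4 / k + 6 * L * (Δ / k) := by field_simp; ring
      _ ≤ 8 * (L * (numEdges G / (k : ℝ) ^ 2)) + 8 * L +
          8 * L * (diameter G * (⌈(maxDeg G : ℝ) / k⌉₊ : ℝ)) := by
          have h3 : (numEdges G / (k : ℝ) ^ 2) ≤ L * (numEdges G / (k : ℝ) ^ 2) :=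
            le_mul_of_one_le_left (by positivity) hL1
          have h4 : 6 * L * ((Δ : ℝ) / k) ≤ 8 * L * (diameter G * (⌈(maxDeg G : ℝ) / k⌉₊ : ℝ)) := by
            gcongr
            norm_num
          linarith
      _ = _ := by ring
  have hmin : ((min n (2 * arcBound k (3 * L) (2 * numEdges H) Δ) / k : ℕ) : ℝ) ≤
      8 * L * (connBound k G + 1) := by
    refine Nat.cast_div_le.trans ?_
    rw [connBound]
    rcases min_choice ((n : ℝ) / k) ((numEdges G : ℝ) / (k : ℝ) ^ 2 +
      (diameter G : ℝ) * (⌈(maxDeg G : ℝ) / k⌉₊ : ℝ)) with h' | h' <;> rw [h']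
    · have h1 : ((min n (2 * arcBound k (3 * L) (2 * numEdges H) Δ) : ℕ) : ℝ) / k ≤ n / k := by
        gcongr
        exact min_le_left _ _
      have h2 : (n : ℝ) / k ≤ 8 * L * (n / k) := le_mul_of_one_le_left (by positivity) (by linarith)
      linarith
    · refine le_trans ?_ harc
      gcongr
      exact min_le_right _ _
  rw [linkCap]
  push_cast at hmin ⊢
  have h2 : (L : ℝ) ≤ L * (connBound k G + 1) := le_mul_of_one_le_right (by linarith) (by linarith)
  have h3 : (c : ℝ) * L ≤ c * (L * (connBound k G + 1)) := by gcongr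
  nlinarith

end Parameters

section Correctness

variable {n k N b P s s' : ℕ} {E : Type} {keep : E → Bool} {chk : ℕ → Bool}
  {g : (Fin b → Bool) → (ℕ → Fin N → Bool) × (Fin N → Fin k)} {i₀ : Fin k}

open Classical in
/-- The output is correct unless the randomness fails. -/
theorem contract_correct (hn : 0 < n) (hs' : 2 ≤ s') (I : Input n N E) (home : Fin n → Fin k)
    (ω : Fin k → Fin b → Bool)
    (hf : ¬ Fails P (linkCap n k s s' (totalArcs (published keep I home ω))
      (topDegree (published keep I home ω))) ((keptGraph keep I).map I.ident)
      (fun i => keptArcs keep (I.machineView home i)) (g (ω i₀))) (i : Fin k) :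
    (contractPhased P keep chk (linkCap n k s s') g i₀).out i
      ((contractPhased P keep chk (linkCap n k s s') g i₀).run I home ω (2 * P + 2) i) = true ↔
      chk (numEdges (keptGraph keep I)) = true ∧ (keptGraph keep I).Connected := by
  have hR := contractPhased_isRun (P := P) (keep := keep) (chk := chk) (cap := linkCap n k s s')
    (g := g) (i₀ := i₀) I home ω
  rw [Fails, not_or] at hf
  have h := hR.accepts_iff (chk := chk) (arcs_keptGraph keep I home)
    (fun i x hx y => mem_keptArcs_of_own keep I home i x hx y)
    (fun p hp i j => not_lt.1 fun hlt => hf.2 ⟨⟨p, hp⟩, i, j, hlt⟩)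
    (by rw [linkCap]; omega) hf.1 i
  refine (decide_eq_true_iff (p := ContractState.Accepts chk _)).trans (h.trans ?_)
  rw [totalArcs_published, Nat.mul_div_cancel_left _ two_pos]
  refine and_congr_right fun _ => ?_
  have : Nonempty (Fin n) := ⟨⟨0, hn⟩⟩
  rw [SimpleGraph.connected_iff]
  exact ⟨fun H => ⟨fun u v => (reachable_map_iff I.ident).1 (H u v), this⟩,
    fun H u v => (reachable_map_iff I.ident).2 (H.1 u v)⟩

end Correctness

/-- The filter `keep` and the test `chk` on the number of edges make one algorithm serve both
problems: connectivity keeps everything, and verification keeps the marked edges and asks for `n -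
1` of them. -/
theorem exists_machineConn (c : ℕ) : ∃ K a : ℕ, ∀ (n k N W : ℕ),
    2 ≤ k → k ≤ n → 1 ≤ W → N ≤ n ^ c → ∀ {E : Type} (keep : E → Bool) (chk : ℕ → Bool),
    ∃ A : MachineAlg k W N E Bool, SolvesWithin (n := n) A Set.univ
      (fun I _ o => ∀ i, o i = true ↔
        chk (numEdges (keptGraph keep I)) = true ∧ (keptGraph keep I).Connected)
      (1 / n) fun I => K * (digits n : ℝ) ^ a * (connBound k I.graph + 1) := by
  -- The factors bound the number of phases, the capacity and the bits per word; each contributes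
  -- one factor `digits n`.
  refine ⟨(6 * c + 38) * (3 * c + 45) * (5 * c + 9), 3, fun n k N W hk hkn hW hN E keep chk => ?_⟩
  have hn : 2 ≤ n := hk.trans hkn
  set L := digits n with hL
  have hL1 : 1 ≤ L := digits_pos n
  have hn' : (0 : ℝ) < n := by exact_mod_cast (by omega : 0 < n)
  have : Nonempty (Fin k) := ⟨⟨0, by omega⟩⟩
  let i₀ : Fin k := ⟨0, by omega⟩
  set P := 3 * ((c + 1) * L + 5) with hP
  set s := 3 * L with hs
  set s' := (3 * c + 27) * L with hs'
  set b := (2 * c + 2) * L + 3 with hb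
  have hs2 : 2 ≤ s' := by rw [hs']; nlinarith
  obtain ⟨g, hg⟩ := exists_seed_function (k := k) (N := N) (s := s) (s' := s') (P := P) (b := b)
    (by omega : 0 < n) (failure_bound hn hkn hN) (seed_bound hkn hN)
    (fun A => ∑ i, (A i).ncard) (fun A => Finset.univ.sup fun i => (arcDegree (A i) : ℕ))
  refine ⟨(contractPhased P keep chk (linkCap n k s s') g i₀).toAlg hW (b + 3 * c * L + 4),
    solvesWithin_toAlg _ hW (Nat.succ_pos _) (card_contractWord_lt hN) ?_ ?_⟩
  · intro I _ home (ω : Fin k → Fin b → Bool)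
    set cap := linkCap n k s s' (2 * numEdges (keptGraph keep I))
      (Finset.univ.sup (deg (keptGraph keep I))) with hcap
    have hcap0 : 1 ≤ cap := by rw [hcap, linkCap]; omega
    refine ⟨fun p => if p = 0 then 1 else cap, fun p _ => ⟨?_, fun i => ?_⟩, ?_⟩
    · change 0 < if p = 0 then 1 else cap
      split_ifs
      · exact one_pos
      · exact hcap0
    · have h := (contractPhased_isRun (P := P) (keep := keep) (chk := chk)
        (cap := linkCap n k s s') (g := g) (i₀ := i₀) I home ω).cap_eq p i
      rw [totalArcs_published, topDegree_published] at h
      exact h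
    · have h1 : ∑ p ∈ Finset.range (2 * P + 2), (if p = 0 then 1 else cap) * (b + 3 * c * L + 4) ≤
          (6 * c + 38) * L * (cap * ((5 * c + 9) * L)) := by
        have h2 : ∀ p ∈ Finset.range (2 * P + 2),
            (if p = 0 then 1 else cap) * (b + 3 * c * L + 4) ≤ cap * ((5 * c + 9) * L) := by
          intro p _
          refine Nat.mul_le_mul (by split_ifs <;> omega) ?_
          rw [hb]
          nlinarith
        refine (Finset.sum_le_card_nsmul _ _ _ h2).trans ?_
        rw [Finset.card_range, smul_eq_mul]
        refine Nat.mul_le_mul_right _ ?_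
        rw [hP]
        nlinarith
      have h3 := linkCap_le (c := c) hk (keptGraph_le keep I)
      rw [← hL, ← hs, ← hs', ← hcap] at h3
      refine (Nat.cast_le (α := ℝ).2 h1).trans ?_
      push_cast
      calc (6 * c + 38) * (L : ℝ) * (cap * ((5 * c + 9) * L))
          ≤ (6 * c + 38) * (L : ℝ) * ((3 * c + 45) * L * (connBound k I.graph + 1) *
            ((5 * c + 9) * L)) := by gcongr
        _ = _ := by ring
  · intro I _
    let d := deg (keptGraph keep I)
    -- The error is split evenly: `1 / (2n)` for an unbalanced partition and, for a fixed balanced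
    -- partition, `1 / (2n)` for the independent seed of machine `i₀`.
    refine (prob_prod_le (p := fun (home : Fin n → Fin k) (ω : Fin k → Fin b → Bool) =>
      ¬ ∀ i, (contractPhased P keep chk (linkCap n k s s') g i₀).out i
        ((contractPhased P keep chk (linkCap n k s s') g i₀).run I home ω (2 * P + 2) i) = true ↔
        chk (numEdges (keptGraph keep I)) = true ∧ (keptGraph keep I).Connected)
      (q := fun home => ∃ i, arcBound k s (∑ u, d u) (Finset.univ.sup d) <
        ∑ u with home u = i, d u) (ε := 1 / (2 * n)) (by positivity) fun home hq => ?_).trans ?_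
    · simp only [not_exists, not_lt] at hq
      set A : Fin k → Set (Fin N × Fin N) := fun i => keptArcs keep (I.machineView home i) with hA
      have hM : ∀ ω : Fin k → Fin b → Bool, totalArcs (published keep I home ω) =
        ∑ i, (A i).ncard := fun ω => rfl
      have hD : ∀ ω : Fin k → Fin b → Bool, topDegree (published keep I home ω) =
        Finset.univ.sup fun i => (arcDegree (A i) : ℕ) := fun ω => rfl
      have hbal : Balanced n s A (∑ i, (A i).ncard)
          (Finset.univ.sup fun i => (arcDegree (A i) : ℕ)) := by
        refine ⟨⟨Set.range I.ident, ?_, ?_⟩, fun i => ?_⟩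
        · rw [← Set.image_univ]
          exact (Set.ncard_image_le (Set.toFinite _)).trans (by simp)
        · intro i e he
          simp only [hA, keptArcs_eq] at he
          obtain ⟨⟨u, v⟩, -, rfl⟩ := he
          exact ⟨⟨u, rfl⟩, ⟨v, rfl⟩⟩
        · have h1 : ∑ i, (A i).ncard = ∑ u, d u := by
            simp only [hA, ncard_keptArcs]
            exact Finset.sum_fiberwise _ _ _
          rw [h1, ← hD fun _ _ => false, topDegree_published, hA, ncard_keptArcs]
          exact hq i
      refine (prob_mono (q := fun ω : Fin k → Fin b → Bool => Fails P (linkCap n k s s'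
        (∑ i, (A i).ncard) (Finset.univ.sup fun i => (arcDegree (A i) : ℕ)))
        ((keptGraph keep I).map I.ident) A (g (ω i₀))) ?_).trans ?_
      · intro ω hω
        by_contra hf
        exact hω fun i => contract_correct (by omega) hs2 I home ω hf i
      · exact (prob_eval i₀ fun y => Fails P (linkCap n k s s'
          (∑ i, (A i).ncard) (Finset.univ.sup fun i => (arcDegree (A i) : ℕ)))
          ((keptGraph keep I).map I.ident) A (g y)).trans_le
          (hg _ A (arcs_keptGraph keep I home) hbal)
    · have h1 : (prob fun home : Fin n → Fin k => ∃ i, arcBound k s (∑ u, d u)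
          (Finset.univ.sup d) < ∑ u with home u = i, d u) ≤ 1 / (2 * n) := by
        refine (prob_exists_le fun i (home : Fin n → Fin k) => arcBound k s (∑ u, d u)
          (Finset.univ.sup d) < ∑ u with home u = i, d u).trans ?_
        have hk' : (k : ℝ) ≤ n := by exact_mod_cast hkn
        have hn2 : (2 : ℝ) ≤ n := by exact_mod_cast hn
        calc _ ≤ ∑ i : Fin k, ((1 : ℝ) / n) ^ 3 := Finset.sum_le_sum fun i _ =>
              (prob_heavy_machine_le d i s).trans (one_half_pow_digits_le hn 3)
          _ = k * (1 / n) ^ 3 := by simp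
          _ ≤ n * (1 / n) ^ 3 := by gcongr
          _ = 1 / (n * n) := by field_simp
          _ ≤ 1 / (2 * n) := by gcongr
      have h2 : (1 : ℝ) / n = 1 / (2 * n) + 1 / (2 * n) := by field_simp; norm_num
      rw [h2]
      exact add_le_add h1 le_rfl

/-! ### The problems -/

theorem keptGraph_true {n N : ℕ} (I : Input n N Unit) :
    keptGraph (fun _ => true) I = I.graph := by
  ext u v
  simp [keptGraph_adj]

/-- A graph on `n` vertices is a tree iff it is connected with `n - 1` edges, which is what the
contraction algorithm can test. -/
theorem isSpanningTree_marked_iff {n N : ℕ} (I : Input n N Bool) :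
    IsSpanningTree I.graph (markedSubgraph I) ↔
      decide (numEdges (keptGraph id I) + 1 = n) = true ∧ (keptGraph id I).Connected := by
  have h : markedSubgraph I = keptGraph id I := rfl
  rw [h, IsSpanningTree, SimpleGraph.isTree_iff_connected_and_card, decide_eq_true_iff,
    Nat.card_eq_fintype_card (α := Fin n), Fintype.card_fin, numEdges, ← Nat.card_coe_set_eq]
  exact ⟨fun H => ⟨H.2.2, H.2.1⟩, fun H => ⟨keptGraph_le id I, H.2, H.1⟩⟩

theorem SolvesWithin.mono {n k W N : ℕ} {E Out : Type} {A : MachineAlg k W N E Out}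
    {dom : Set (Input n N E)}
    {feasible feasible' : Input n N E → (Fin n → Fin k) → (Fin k → Out) → Prop} {ε : ℝ}
    {bound bound' : Input n N E → ℝ} (h : SolvesWithin A dom feasible ε bound)
    (hf : ∀ I home o, feasible I home o → feasible' I home o) (hb : ∀ I, bound I ≤ bound' I) :
    SolvesWithin A dom feasible' ε bound' := by
  refine fun I hI => ⟨fun home ω => ?_, (h I hI).2.trans (prob_mono fun r => ?_)⟩
  · obtain ⟨t, o, ht, ho⟩ := (h I hI).1 home ω
    exact ⟨t, o, ht.trans (hb I), ho⟩
  · rintro ⟨t, o, ht, ho⟩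
    exact ⟨t, o, ht, hf _ _ _ ho⟩

end KMachine

/-! ### The main theorem -/

theorem mainTheorem7 (c : ℕ) :
    ∃ (C : ℝ) (e : ℕ), ∀ (n k N W : ℕ) (Λ : Finset ℝ),
      2 ≤ k → k ≤ n → 1 ≤ W → N ≤ n ^ c → Λ.card ≤ n ^ c →
      (∃ A : KMachine.BroadcastAlg W N ℝ (Set (Sym2 (Fin N))),
        KMachine.BroadcastComputesMST A (KMachine.weightedInputs n N Λ)
          (KMachine.softO C e n 0) (KMachine.softO C e n n)) ∧
      (∃ A : KMachine.MachineAlg k W N ℝ (Set (Sym2 (Fin N))),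
        KMachine.SolvesWithin A (KMachine.weightedInputs n N Λ) KMachine.mstFeasible
          (1 / n) fun _ => KMachine.softO C e n (n / k)) ∧
      (∃ A : KMachine.MachineAlg k W N Unit Bool,
        KMachine.SolvesWithin (n := n) A Set.univ KMachine.connFeasible
          (1 / n) fun I => KMachine.softO C e n (KMachine.connBound k I.graph)) ∧
      (∃ A : KMachine.MachineAlg k W N Bool Bool,
        KMachine.SolvesWithin (n := n) A Set.univ KMachine.stFeasible
          (1 / n) fun I => KMachine.softO C e n (KMachine.connBound k I.graph)) := by
  obtain ⟨K₁, a₁, h₁⟩ := KMachine.exists_broadcastMST c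
  obtain ⟨K₂, a₂, h₂⟩ := KMachine.exists_machineMST c
  obtain ⟨K₃, a₃, h₃⟩ := KMachine.exists_machineConn c
  -- Sums dominate the separate constants and exponents; the power of 3 comes from `digits n ≤ 3 log
  -- n`.
  refine ⟨((K₁ + K₂ + K₃ : ℕ) : ℝ) * 3 ^ (a₁ + a₂ + a₃), a₁ + a₂ + a₃,
    fun n k N W Λ hk hkn hW hN hΛ => ?_⟩
  have hn : 2 ≤ n := hk.trans hkn
  have hC : ∀ K ≤ K₁ + K₂ + K₃, (K : ℝ) * 3 ^ (a₁ + a₂ + a₃) ≤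
      ((K₁ + K₂ + K₃ : ℕ) : ℝ) * 3 ^ (a₁ + a₂ + a₃) := fun K hK =>
    mul_le_mul_of_nonneg_right (Nat.cast_le.2 hK) (by positivity)
  have hx : ∀ G : SimpleGraph (Fin n), 0 ≤ KMachine.connBound k G := fun G =>
    le_min (by positivity) (by positivity)
  have hconn := fun I : KMachine.Input n N Unit => KMachine.le_softO hn (hx I.graph)
    (by omega : a₃ ≤ a₁ + a₂ + a₃) (hC K₃ (by omega)) le_rfl
  have hst := fun I : KMachine.Input n N Bool => KMachine.le_softO hn (hx I.graph)
    (by omega : a₃ ≤ a₁ + a₂ + a₃) (hC K₃ (by omega)) le_rfl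
  refine ⟨?_, ?_, ?_, ?_⟩
  · obtain ⟨A, hA⟩ := h₁ n N W Λ hW hN hΛ
    refine ⟨A, fun I hI => ?_⟩
    obtain ⟨t, T, ht, hbc, hT, hout⟩ := hA I hI
    exact ⟨t, T, KMachine.le_softO hn le_rfl (by omega) (hC K₁ (by omega)) ht,
      KMachine.le_softO hn (Nat.cast_nonneg n) (by omega) (hC K₁ (by omega)) hbc, hT, hout⟩
  · obtain ⟨A, hA⟩ := h₂ n k N W Λ hk hkn hW hN hΛ
    exact ⟨A, hA.mono (fun _ _ _ h => h) fun _ => KMachine.le_softO hn (by positivity) (by omega)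
      (hC K₂ (by omega)) le_rfl⟩
  · obtain ⟨A, hA⟩ := h₃ n k N W hk hkn hW hN (fun _ : Unit => true) fun _ => true
    refine ⟨A, hA.mono (fun I _ o h i => (h i).trans ?_) hconn⟩
    rw [KMachine.keptGraph_true]
    exact and_iff_right rfl
  · obtain ⟨A, hA⟩ := h₃ n k N W hk hkn hW hN (id : Bool → Bool) fun m => decide (m + 1 = n)
    exact ⟨A, hA.mono (fun I _ o h i => (h i).trans
      (KMachine.isSpanningTree_marked_iff I).symm) hst⟩
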